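/- All varieties are over $\mathbb{C}$. Let $k \ge 1$ and $n \ge 0$ be integers, let $U_0, \dots, U_k$ be copies of $\mathbb{C}^n$, and regard a $k$-tuple $(X_1,\dots,X_k)$ of $n\times n$ matrices as a tuple of linear maps $X_j : U_j \to U_{j-1}$. Let $\mathcal{Z} = \{(X_1,\dots,X_k) : X_1 \cdots X_k = 0\} \subseteq \mathrm{Mat}_{n\times n}^{k}$. A composition of $n$ into $k$ summands is a tuple $\mathbf{p}=(p_1,\dots,p_k)$ of nonnegative integers with $p_1+\dots+p_k=n$; put $h_2(\mathbf{p}) = \sum_{i\le j} p_ip_j$. Let $\mathbf{D}_{\mathbf{p}} = (D_1,\dots,D_k)$, where $D_j$ is the diagonal matrix whose $i$-th diagonal entry is $0$ if $p_1+\dots+p_{j-1} < i \le p_1+\dots+p_j$ and $1$ otherwise, and let $\mathcal{Z}_{\mathbf{p}}$ be the Zariski closure of the orbit of $\mathbf{D}_{\mathbf{p}}$ under the action $(g_0,\dots,g_k)\cdot(X_j)_j = (g_{j-1}X_jg_j^{-1})_j$ of $\mathrm{GL}_n^{k+1}$. Let $\mathcal{I}_{\mathbf{p}}$ be the variety of all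 pairs $(\mathbf{F},\mathbf{X})$ where $\mathbf{X} = (X_1,\dots,X_k)$ and $\mathbf{F}$ consists, for each $j=0,\dots,k$, of a flag $0 = F^{(j)}_{j+1} \subseteq F^{(j)}_j\subseteq\dots\subseteq F^{(j)}_1\subseteq U_j$ with $\dim F^{(j)}_{j'} = p_{j'}+\dots+p_j$, such that $X_j(F^{(j)}_{j'}) \subseteq F^{(j-1)}_{j'}$ for all $1 \le j' \le j \le k$. (1) The irreducible components of $\mathcal{Z}$ are exactly the varieties $\mathcal{Z}_{\mathbf{p}}$, one for each composition $\mathbf{p}$ of $n$ into $k$ summands (distinct compositions give distinct components). (2) For every such $\mathbf{p}$, the projection $\mathcal{I}_{\mathbf{p}} \to \mathrm{Mat}_{n\times n}^{k}$, $(\mathbf{F},\mathbf{X})\mapsto\mathbf{X}$, is birational onto $\mathcal{Z}_{\mathbf{p}}$ (its image is $\mathcal{Z}_{\mathbf{p}}$, and it restricts to an isomorphism between dense open subsets of the irreducible varieties $\mathcal{I}_{\mathbf{p}}$ and $\mathcal{Z}_{\mathbf{p}}$). Moreover $\dim\mathcal{I}_{\mathbf{p}} = \dim\mathcal{Z}_{\mathbf{p}}$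 and $\operatorname{codim}\mathcal{Z}_{\mathbf{p}} = h_2(\mathbf{p})$. (3) Let $q = \lfloor n/k\rfloor$, $r = n-kq$, and let $\mathbf{p} = ((q+1)^r,q^{k-r})$ be the composition of $n$ with $r$ summands $q+1$ followed by $k-r$ summands $q$. For a tensor $T\in V_0\otimes\dots\otimes V_k$ and a chosen factor $V_m$, the geometric rank $\mathrm{GR}(T)$ is the codimension of the variety of all tuples $(\alpha_i)_{i\ne m} \in \prod_{i \ne m} V_i^*$ such that $T(\alpha_0,\dots,\alpha_k)=0$ for all $\alpha_m\in V_m^*$. Let $\mathsf{MaMu}_{(n,\dots,n)} = \sum_{i_0,\dots,i_k} e_{i_0i_k}\otimes e_{i_0i_1}^*\otimes\dots\otimes e_{i_{k-1}i_k}^*$ be the tensor of the multiplication of $k$ matrices of size $n\times n$. Then, for any choice of the factor, \[ \mathrm{GR}(\mathsf{MaMu}_{(n,\dots,n)}) = \operatorname{codim}\mathcal{Z}_{\mathbf{p}} = h_2(\mathbf{p}) = \tfrac12\bigl(n^2+nq+r(q+1)\bigr). \] In particular, if $k$ divides $n$, then $\mathrm{GR}(\mathsf{MaMu}_{(n,\dots,n)})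 = h_2(q,\dots,q) = \frac{k+1}{2k}n^2$. -/

import Mathlib

open scoped TensorProduct Topology

noncomputable section

namespace IterMatMul

/-! ### Varieties over `ℂ` as spaces with functions -/

/-- A space with functions over `ℂ`: a topology, together with the predicate saying which
(germs of) complex valued functions are regular at a point. -/
structure FunSpace (X : Type) where
  /-- the (Zariski) topology -/
  top : TopologicalSpace X
  /-- `RegularAt f x`: the function `f` is regular at the point `x` -/
  RegularAt : (X → ℂ) → X → Prop

namespace FunSpace

variable {X Y : Type}

/-- The Krull dimension of the underlying topological space. -/
def dim (A : FunSpace X) : WithBot ℕ∞ :=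
  @topologicalKrullDim X A.top

/-- The structure induced on a subset: the subspace topology, and the functions that near every
point are restrictions of regular functions of an open subset of the ambient space. -/
def restrict (A : FunSpace X) (S : Set X) : FunSpace S where
  top := @instTopologicalSpaceSubtype X (· ∈ S) A.top
  RegularAt f x := ∃ U : Set X, IsOpen[A.top] U ∧ (x : X) ∈ U ∧
    ∃ F : X → ℂ, (∀ y ∈ U, A.RegularAt F y) ∧ ∀ y : S, (y : X) ∈ U → f y = F y

/-- The quotient structure along a map `π : X → Y`: the quotient topology, and the functions whose
pull-back to `X` is regular. -/
def quotient (A : FunSpace X) (π : X → Y) : FunSpace Y where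
  top := A.top.coinduced π
  RegularAt f y := ∃ V : Set Y, IsOpen[A.top.coinduced π] V ∧ y ∈ V ∧
    ∀ x : X, π x ∈ V → A.RegularAt (f ∘ π) x

/-- Morphisms: continuous maps that pull back regular functions to regular functions. -/
def IsMorphism (A : FunSpace X) (B : FunSpace Y) (φ : X → Y) : Prop :=
  @Continuous X Y A.top B.top φ ∧
    ∀ (f : Y → ℂ) (x : X), B.RegularAt f (φ x) → A.RegularAt (f ∘ φ) x

/-- Isomorphisms: morphisms with a two-sided inverse that is a morphism. -/
def IsIso (A : FunSpace X) (B : FunSpace Y) (φ : X → Y) : Prop :=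
  A.IsMorphism B φ ∧ ∃ ψ : Y → X, B.IsMorphism A ψ ∧
    Function.LeftInverse ψ φ ∧ Function.RightInverse ψ φ

/-- A morphism of irreducible spaces is birational if it restricts to an isomorphism between
dense open subsets. -/
def IsBirational (A : FunSpace X) (B : FunSpace Y) (φ : X → Y) : Prop :=
  A.IsMorphism B φ ∧ @IrreducibleSpace X A.top ∧ @IrreducibleSpace Y B.top ∧
    ∃ (U : Set X) (W : Set Y) (h : Set.MapsTo φ U W),
      IsOpen[A.top] U ∧ @Dense X A.top U ∧ IsOpen[B.top] W ∧ @Dense Y B.top W ∧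
        (A.restrict U).IsIso (B.restrict W) (h.restrict φ U W)

/-- `φ : X → Y` is birational onto the subset `Z` of `Y`: its image is `Z`, and it is birational as
a map from `X` to `Z`. -/
def IsBirationalOnto (A : FunSpace X) (B : FunSpace Y) (φ : X → Y) (Z : Set Y) : Prop :=
  Set.range φ = Z ∧ ∃ h : ∀ x, φ x ∈ Z, A.IsBirational (B.restrict Z) (Set.codRestrict φ Z h)

end FunSpace

section Affine

variable (V : Type) [AddCommGroup V] [Module ℂ V]

/-- Polynomial functions on a vector space: the algebra generated by the linear forms. -/
def polyFun : Subalgebra ℂ (V → ℂ) :=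
  Algebra.adjoin ℂ (Set.range fun (φ : Module.Dual ℂ V) (v : V) => φ v)

/-- The Zariski topology, generated by the basic open sets `{x | f x ≠ 0}`. -/
@[reducible] def zariski : TopologicalSpace V :=
  TopologicalSpace.generateFrom {U | ∃ f ∈ polyFun V, U = {x | f x ≠ 0}}

/-- A vector space as an affine variety; regular functions are locally quotients `g / h` of
polynomial functions. -/
def affine : FunSpace V where
  top := zariski V
  RegularAt f x := ∃ g ∈ polyFun V, ∃ h ∈ polyFun V, h x ≠ 0 ∧ ∀ y, h y ≠ 0 → f y = g y / h y

variable {V}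

/-- Codimension of a subset of a finite dimensional vector space, `dim V - dim S`; it is `⊤` for the empty set. -/
def codim (S : Set V) : ℕ∞ :=
  sInf {c : ℕ∞ | ((Module.finrank ℂ V : ℕ∞) : WithBot ℕ∞) ≤ ((affine V).restrict S).dim + c}

/-- The irreducible components of a subset of a vector space, for the Zariski topology. -/
def components (S : Set V) : Set (Set V) :=
  (fun T : Set S => Subtype.val '' T) '' @irreducibleComponents S ((affine V).restrict S).top

end Affine

/-! ### Geometric rank -/

section GeometricRank

variable {ι : Type} [Fintype ι] {V : ι → Type} [∀ i, AddCommGroup (V i)] [∀ i, Module ℂ (V i)]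

/-- The value `T(α₁, …, α_m)` of a tensor on linear forms. -/
def tensorEval (T : ⨂[ℂ] i, V i) (α : ∀ i, Module.Dual ℂ (V i)) : ℂ :=
  PiTensorProduct.dualDistrib (PiTensorProduct.tprod ℂ α) T

/-- The variety of all tuples of linear forms `(α_i)`, `i ≠ i₀`, such that `T` evaluates to zero on
every completion of the tuple by a linear form on the factor `V i₀`. -/
def rankVariety (T : ⨂[ℂ] i, V i) (i₀ : ι) :
    Set (∀ i : {i : ι // i ≠ i₀}, Module.Dual ℂ (V i)) :=
  {α | ∀ γ : ∀ i, Module.Dual ℂ (V i), (∀ i : {i : ι // i ≠ i₀}, γ i = α i) → tensorEval T γ = 0}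

/-- The geometric rank of `T`, computed with respect to the factor `V i₀`. -/
def geometricRank (T : ⨂[ℂ] i, V i) (i₀ : ι) : ℕ∞ :=
  codim (rankVariety T i₀)

end GeometricRank

/-! ### The iterated matrix multiplication tensor -/

/-- Complex `n × n` matrices. -/
abbrev Mat (n : ℕ) : Type := Matrix (Fin n) (Fin n) ℂ

/-- The tensor factors: `Mat n` for the index `0` and its dual for the indices `1, …, k`. -/
def MamuFactor (n k : ℕ) (j : Fin (k + 1)) : Type :=
  Fin.cases (motive := fun _ => Type) (Mat n) (fun _ => Module.Dual ℂ (Mat n)) j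

instance (n k : ℕ) (j : Fin (k + 1)) : AddCommGroup (MamuFactor n k j) :=
  Fin.cases (motive := fun j => AddCommGroup (MamuFactor n k j))
    (inferInstanceAs (AddCommGroup (Mat n)))
    (fun _ => inferInstanceAs (AddCommGroup (Module.Dual ℂ (Mat n)))) j

instance (n k : ℕ) (j : Fin (k + 1)) : Module ℂ (MamuFactor n k j) :=
  Fin.cases (motive := fun j => Module ℂ (MamuFactor n k j))
    (inferInstanceAs (Module ℂ (Mat n)))
    (fun _ => inferInstanceAs (Module ℂ (Module.Dual ℂ (Mat n)))) j

/-- The family `(e_{i₀ i_k}, e*_{i₀ i₁}, …, e*_{i_{k-1} i_k})`. -/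
def mamuTerm (n k : ℕ) (i : Fin (k + 1) → Fin n) (j : Fin (k + 1)) : MamuFactor n k j :=
  Fin.cases (motive := fun j => MamuFactor n k j)
    (Matrix.single (i 0) (i (Fin.last k)) (1 : ℂ) : Mat n)
    (fun j => (Matrix.entryLinearMap ℂ ℂ (i j.castSucc) (i j.succ) : Module.Dual ℂ (Mat n))) j

/-- The tensor `∑ e_{i₀ i_k} ⊗ e*_{i₀ i₁} ⊗ ⋯ ⊗ e*_{i_{k-1} i_k}` of the product of `k` matrices of
size `n × n`. -/
def mamu (n k : ℕ) : ⨂[ℂ] j, MamuFactor n k j :=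
  ∑ i : Fin (k + 1) → Fin n, PiTensorProduct.tprod ℂ (mamuTerm n k i)

/-! ### The variety `X₁ ⋯ X_k = 0` and the varieties `Z_p`

Indices are shifted by one: `X i` with `i = 0, …, k - 1` stands for `X_{i+1} : U_{i+1} → U_i`, and
`p i` for `p_{i+1}`. -/

/-- The `k`-tuples of `n × n` matrices. -/
abbrev Tuple (n k : ℕ) : Type := Fin k → Mat n

/-- The variety of the tuples with `X₁ ⋯ X_k = 0`. -/
def zeroProduct (n k : ℕ) : Set (Tuple n k) :=
  {X | (List.ofFn X).prod = 0}

/-- Compositions of `n` into `k` summands (which may be zero). -/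
abbrev Comp (n k : ℕ) : Type := {p : Fin k → ℕ // ∑ i, p i = n}

/-- The sum `p_a + ⋯ + p_{b-1}` (zero if `b ≤ a`). -/
def partSum {k : ℕ} (p : Fin k → ℕ) (a b : ℕ) : ℕ :=
  ∑ i : Fin k with a ≤ i.val ∧ i.val < b, p i

/-- The tuple of diagonal matrices `D_p`: the `j`-th one has zeros exactly in the `j`-th of the
consecutive blocks of sizes `p_1, …, p_k`, and ones elsewhere on the diagonal. -/
def diagTuple (n : ℕ) {k : ℕ} (p : Fin k → ℕ) : Tuple n k := fun j =>
  Matrix.diagonal fun i : Fin n =>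
    if partSum p 0 j.val ≤ i.val ∧ i.val < partSum p 0 (j.val + 1) then 0 else 1

/-- The action of `GL(U_0) × ⋯ × GL(U_k)` on tuples of maps `U_{j+1} → U_j`. -/
def act {n k : ℕ} (g : Fin (k + 1) → GL (Fin n) ℂ) (X : Tuple n k) : Tuple n k := fun j =>
  (g j.castSucc : Mat n) * X j * ((g j.succ)⁻¹ : GL (Fin n) ℂ)

/-- `Z_p`: the Zariski closure of the orbit of `D_p`. -/
def compVariety (n : ℕ) {k : ℕ} (p : Fin k → ℕ) : Set (Tuple n k) :=
  @closure _ (zariski (Tuple n k)) (Set.range fun g => act g (diagTuple n p))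

/-- The second complete symmetric function `∑_{i ≤ j} p_i p_j`. -/
def h2 {k : ℕ} (p : Fin k → ℕ) : ℕ :=
  ∑ i, ∑ j with i ≤ j, p i * p j

/-! ### The incidence correspondence over flag varieties -/

/-- A point of the product of the flag varieties on `U_0, …, U_k`. For each `j`, the spaces
`F j 0 ⊇ F j 1 ⊇ ⋯ ⊇ F j j = 0` form a flag in `U_j = ℂⁿ` with `dim F j a = p_a + ⋯ + p_{j-1}`;
for `a ≥ j` the space `F j a` is zero. -/
structure Flags (n : ℕ) {k : ℕ} (p : Fin k → ℕ) where
  /-- the members of the flags -/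
  F : Fin (k + 1) → Fin (k + 1) → Submodule ℂ (Fin n → ℂ)
  /-- the members of each flag are nested -/
  anti : ∀ j, Antitone (F j)
  /-- the dimensions -/
  finrank_eq : ∀ j a, Module.finrank ℂ (F j a) = partSum p a.val j.val

/-- The span of the first `m` columns of a matrix. -/
def colSpan {n : ℕ} (g : Mat n) (m : ℕ) : Submodule ℂ (Fin n → ℂ) :=
  Submodule.span ℂ (g.col '' {c | c.val < m})

theorem finrank_colSpan {n : ℕ} (g : Mat n) (hg : IsUnit g.det) {m : ℕ} (hm : m ≤ n) :
    Module.finrank ℂ (colSpan g m) = m := by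
  have hli : LinearIndependent ℂ g.col :=
    Matrix.linearIndependent_cols_iff_isUnit.2 ((Matrix.isUnit_iff_isUnit_det g).2 hg)
  have h1 : colSpan g m =
      Submodule.span ℂ (Set.range fun c : Fin m => g.col (Fin.castLE hm c)) := by
    unfold colSpan
    congr 1
    ext v
    constructor
    · rintro ⟨c, hc, rfl⟩
      exact ⟨⟨c.val, hc⟩, rfl⟩
    · rintro ⟨c, rfl⟩
      exact ⟨Fin.castLE hm c, c.isLt, rfl⟩
  rw [h1]
  exact (finrank_span_eq_card (hli.comp _ (Fin.castLE_injective hm))).trans (Fintype.card_fin m)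

theorem partSum_le {n k : ℕ} (p : Comp n k) (a b : ℕ) : partSum p.1 a b ≤ n := by
  calc partSum p.1 a b ≤ ∑ i, p.1 i := Finset.sum_le_sum_of_subset (Finset.filter_subset _ _)
    _ = n := p.2

theorem partSum_anti {k : ℕ} (p : Fin k → ℕ) {a a' : ℕ} (h : a ≤ a') (b : ℕ) :
    partSum p a' b ≤ partSum p a b := by
  refine Finset.sum_le_sum_of_subset fun i hi => ?_
  simp only [Finset.mem_filter, Finset.mem_univ, true_and] at hi ⊢
  exact ⟨h.trans hi.1, hi.2⟩

/-- Tuples of frames (invertible matrices) of `U_0, …, U_k`, together with a tuple of maps. -/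
def frameSet (n k : ℕ) : Set ((Fin (k + 1) → Mat n) × Tuple n k) :=
  {z | ∀ j, IsUnit (z.1 j).det}

/-- Every tuple of frames determines a tuple of flags, spanned by the first vectors of the
frames. -/
def frameMap {n k : ℕ} (p : Comp n k) (z : frameSet n k) : Flags n p.1 × Tuple n k :=
  (⟨fun j a => colSpan (z.1.1 j) (partSum p.1 a.val j.val),
    fun j _ _ hab => Submodule.span_mono (Set.image_mono fun _ hc =>
      lt_of_lt_of_le hc (partSum_anti p.1 hab j.val)),
    fun j _ => finrank_colSpan _ (z.2 j) (partSum_le p _ _)⟩, z.1.2)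

/-- The product of the flag varieties `GL_n / P_j` and of the affine space of tuples of maps, as
the quotient of `GL_n^{k+1} × Tuple n k`. -/
def flagHom {n k : ℕ} (p : Comp n k) : FunSpace (Flags n p.1 × Tuple n k) :=
  ((affine ((Fin (k + 1) → Mat n) × Tuple n k)).restrict (frameSet n k)).quotient (frameMap p)

/-- The incidence correspondence `I_p`: pairs of a tuple of flags and a tuple of maps with
`X_{j+1} (F (j+1) a) ⊆ F j a`. -/
def incidence {n k : ℕ} (p : Comp n k) : Set (Flags n p.1 × Tuple n k) :=
  {z | ∀ (j : Fin k) (a : Fin (k + 1)),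
    (z.1.F j.succ a).map (Matrix.toLin' (z.2 j)) ≤ z.1.F j.castSucc a}

/-- `I_p` as a variety. -/
def incidenceVariety {n k : ℕ} (p : Comp n k) : FunSpace (incidence p) :=
  (flagHom p).restrict (incidence p)

/-- The projection from `I_p` to the space of tuples of maps. -/
def projHom {n k : ℕ} (p : Comp n k) (z : incidence p) : Tuple n k := z.1.2

end IterMatMul

end

open scoped TensorProduct Topology

noncomputable section

namespace IterMatMul

set_option linter.unusedSectionVars false

/-! ### Polynomial functions and the Zariski topology -/

section Poly

variable {V W W' : Type} [AddCommGroup V] [Module ℂ V] [AddCommGroup W] [Module ℂ W]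
  [AddCommGroup W'] [Module ℂ W']

/-! Everything is governed by the kernels of the partial products X_a ⋯ X_{j-1} (indices from 0).
Let K_p (`kerLocus`) be the set of tuples for which this kernel has dimension at least p_a + ⋯ +
p_{j-1} for all a ≤ j. It is closed, because kernel dimensions are upper semicontinuous, and
equality throughout is an open condition on K_p. Bases adapted to the kernels, propagated from U_k
down to U_0, conjugate every tuple with equality to a tuple of shifts; hence the locus of equality
is the orbit of D_p (`range_act_diagTuple`).

The image of I_p is K_p: the flags force the kernels to be large, and conversely adapted flags are
built one subspace at a time by a dimension count (`exists_flags`). In frames adapted to the flags,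
preservation of the flags is the vanishing of fixed matrix entries. So I_p is the image of an open
subset of a vector space, I_p and K_p are irreducible, the orbit is dense in K_p, and Z_p = K_p
(`compVariety_eq_kerLocus`).

A tuple with product zero lies in K_p for p_a the jumps of dim ker(X_a ⋯ X_{k-1})
(`exists_mem_kerLocus`), and D_p separates the K_p; being finitely many, closed and irreducible,
they are the components. Over the orbit the flags must be the kernels themselves (`eq_kerFlags`),
and these depend regularly on the tuple (`exists_local_frame`); this gives birationality.

For the dimension, I_p is covered by charts, each a big cell of the flag varieties times the space
of standard tuples (`isOpenEmbedding_chart`); counting coordinates gives kn² - h₂(p)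
(`finrank_chartCoords_add_h2`). Krull dimensions are bounded above by transcendence degree
(`dim_restrict_le_of_forall`) and below by chains of affine subspaces (`le_dim_restrict_of_isOpen`).

Finally, evaluating the tensor gives the trace of a cyclic product, so its rank variety is linearly
isomorphic to {X_1 ⋯ X_k = 0} for every choice of the factor. The geometric rank is therefore the
minimum of h₂, and since 2h₂(p) = n² + Σ p_i², the balanced composition attains it. -/

theorem dual_mem_polyFun (φ : Module.Dual ℂ V) : (fun v => φ v) ∈ polyFun V :=
  Algebra.subset_adjoin ⟨φ, rfl⟩

/-- Polynomial maps between vector spaces. -/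
def PolyMap (m : V → W) : Prop := ∀ f ∈ polyFun W, (fun v => f (m v)) ∈ polyFun V

/-- If the coordinates of a map lie in a subalgebra, so do the pull-backs of all polynomial
functions. -/
theorem comp_mem_of_dual {m : V → W} {A : Subalgebra ℂ (V → ℂ)}
    (h : ∀ φ : Module.Dual ℂ W, (fun v => φ (m v)) ∈ A) {f : W → ℂ} (hf : f ∈ polyFun W) :
    (fun v => f (m v)) ∈ A := by
  induction hf using Algebra.adjoin_induction with
  | mem x hx => obtain ⟨φ, rfl⟩ := hx; exact h φ
  | algebraMap r => exact A.algebraMap_mem r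
  | add x y _ _ hx hy => exact A.add_mem hx hy
  | mul x y _ _ hx hy => exact A.mul_mem hx hy

theorem PolyMap.of_dual {m : V → W}
    (h : ∀ φ : Module.Dual ℂ W, (fun v => φ (m v)) ∈ polyFun V) : PolyMap m :=
  fun _ hf => comp_mem_of_dual h hf

theorem PolyMap.linear (l : V →ₗ[ℂ] W) : PolyMap l :=
  .of_dual fun φ => dual_mem_polyFun (φ.comp l)

theorem PolyMap.comp {m : W → W'} {m' : V → W} (h : PolyMap m) (h' : PolyMap m') :
    PolyMap (fun v => m (m' v)) := fun _ hf => h' _ (h _ hf)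

theorem PolyMap.prodMk {m : V → W} {m' : V → W'} (h : PolyMap m) (h' : PolyMap m') :
    PolyMap (fun v => (m v, m' v)) := by
  refine .of_dual fun φ => ?_
  have : (fun v => φ (m v, m' v)) =
      (fun v => φ.comp (LinearMap.inl ℂ W W') (m v)) +
        fun v => φ.comp (LinearMap.inr ℂ W W') (m' v) := by
    ext v
    simp [← map_add]
  rw [this]
  exact add_mem (h _ (dual_mem_polyFun _)) (h' _ (dual_mem_polyFun _))

/-- A linear form on a finite product, applied to a map with coordinates in a subalgebra. -/
theorem dual_pi_mem {ι : Type} [Finite ι] {U : ι → Type} [∀ i, AddCommGroup (U i)]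
    [∀ i, Module ℂ (U i)] {m : V → ∀ i, U i} {A : Subalgebra ℂ (V → ℂ)}
    (h : ∀ i, ∀ φ : Module.Dual ℂ (U i), (fun v => φ (m v i)) ∈ A)
    (φ : Module.Dual ℂ (∀ i, U i)) : (fun v => φ (m v)) ∈ A := by
  classical
  cases nonempty_fintype ι
  have : (fun v => φ (m v)) = ∑ i, fun v => φ.comp (LinearMap.single ℂ U i) (m v i) := by
    ext v
    simp only [Finset.sum_apply, LinearMap.comp_apply, LinearMap.coe_single]
    rw [← map_sum, Finset.univ_sum_single]
  rw [this]
  exact sum_mem fun i _ => h i _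

theorem dual_scalar_mem {m : V → ℂ} {A : Subalgebra ℂ (V → ℂ)} (h : m ∈ A)
    (φ : Module.Dual ℂ ℂ) : (fun v => φ (m v)) ∈ A := by
  have : (fun v => φ (m v)) = φ 1 • m := by
    ext v
    simpa [mul_comm] using φ.map_smul (m v) 1
  rw [this]
  exact Subalgebra.smul_mem _ h _

theorem PolyMap.pi {ι : Type} [Finite ι] {U : ι → Type} [∀ i, AddCommGroup (U i)]
    [∀ i, Module ℂ (U i)] {m : V → ∀ i, U i} (h : ∀ i, PolyMap (fun v => m v i)) : PolyMap m :=
  .of_dual (dual_pi_mem fun i φ => h i _ (dual_mem_polyFun φ))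

theorem isOpen_ne_zero {f : V → ℂ} (hf : f ∈ polyFun V) : IsOpen[zariski V] {x | f x ≠ 0} :=
  TopologicalSpace.isOpen_generateFrom_of_mem ⟨f, hf, rfl⟩

theorem isClosed_eq_zero {f : V → ℂ} (hf : f ∈ polyFun V) : IsClosed[zariski V] {x | f x = 0} := by
  let _ := zariski V
  exact ⟨by simpa [Set.compl_ofPred] using isOpen_ne_zero hf⟩

theorem isTopologicalBasis_ne_zero : @TopologicalSpace.IsTopologicalBasis V (zariski V)
    {U | ∃ f ∈ polyFun V, U = {x | f x ≠ 0}} := by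
  let _ := zariski V
  refine ⟨?_, ?_, rfl⟩
  · rintro _ ⟨f, hf, rfl⟩ _ ⟨g, hg, rfl⟩ x hx
    exact ⟨{x | f x * g x ≠ 0}, ⟨f * g, mul_mem hf hg, rfl⟩, mul_ne_zero hx.1 hx.2,
      fun y hy => ⟨left_ne_zero_of_mul hy, right_ne_zero_of_mul hy⟩⟩
  · refine Set.eq_univ_of_forall fun x => ⟨{x | (1 : ℂ) ≠ 0}, ⟨1, one_mem _, rfl⟩, one_ne_zero⟩

theorem exists_ne_zero_of_mem_isOpen {U : Set V} (hU : IsOpen[zariski V] U) {x : V} (hx : x ∈ U) :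
    ∃ f ∈ polyFun V, f x ≠ 0 ∧ ∀ y, f y ≠ 0 → y ∈ U := by
  let _ := zariski V
  obtain ⟨_, ⟨f, hf, rfl⟩, hfx, hfU⟩ := isTopologicalBasis_ne_zero.exists_subset_of_mem_open hx hU
  exact ⟨f, hf, hfx, fun y hy => hfU hy⟩

theorem exists_eq_zero_of_notMem_isClosed {C : Set V} (hC : IsClosed[zariski V] C) {x : V}
    (hx : x ∉ C) : ∃ f ∈ polyFun V, f x ≠ 0 ∧ ∀ y ∈ C, f y = 0 := by
  let _ := zariski V
  obtain ⟨f, hf, hfx, hfU⟩ := exists_ne_zero_of_mem_isOpen hC.isOpen_compl hx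
  exact ⟨f, hf, hfx, fun y hy => by_contra fun h => hfU y h hy⟩

theorem PolyMap.continuous {m : V → W} (h : PolyMap m) : Continuous[zariski V, zariski W] m := by
  let _ := zariski V
  let _ := zariski W
  refine continuous_generateFrom_iff.2 ?_
  rintro _ ⟨f, hf, rfl⟩
  exact isOpen_ne_zero (h f hf)

/-- Functions that are regular on the locus where `h` does not vanish. -/
def locFun (h : polyFun V) : Subalgebra ℂ (V → ℂ) where
  -- Nothing is required where `h` vanishes, so the default values of inverses there do no harm.
  carrier := {f | ∃ N : ℕ, ∃ F ∈ polyFun V, ∀ v, h.1 v ≠ 0 → h.1 v ^ N * f v = F v}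
  mul_mem' := by
    rintro f g ⟨N, F, hF, hf⟩ ⟨N', G, hG, hg⟩
    refine ⟨N + N', F * G, mul_mem hF hG, fun v hv => ?_⟩
    rw [Pi.mul_apply, Pi.mul_apply, ← hf v hv, ← hg v hv]
    ring
  add_mem' := by
    rintro f g ⟨N, F, hF, hf⟩ ⟨N', G, hG, hg⟩
    refine ⟨N + N', h.1 ^ N' * F + h.1 ^ N * G,
      add_mem (mul_mem (pow_mem h.2 _) hF) (mul_mem (pow_mem h.2 _) hG), fun v hv => ?_⟩
    simp only [Pi.add_apply, Pi.mul_apply, Pi.pow_apply, ← hf v hv, ← hg v hv]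
    ring
  algebraMap_mem' r := ⟨0, algebraMap _ _ r, Subalgebra.algebraMap_mem _ _, fun v _ => by simp⟩

theorem polyFun_le_locFun (h : polyFun V) : polyFun V ≤ locFun h :=
  fun f hf => ⟨0, f, hf, fun v _ => by simp⟩

theorem inv_mem_locFun {f g : V → ℂ} (hg : g ∈ polyFun V) (h : polyFun V)
    (hfg : ∀ v, h.1 v = f v * g v) : (fun v => (f v)⁻¹) ∈ locFun h := by
  refine ⟨1, g, hg, fun v hv => ?_⟩
  have : f v ≠ 0 := fun h0 => hv (by rw [hfg, h0, zero_mul])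
  rw [hfg]
  field_simp

theorem isOpen_locFun_ne_zero {h : polyFun V} {f : V → ℂ} (hf : f ∈ locFun h) :
    IsOpen[zariski V] {v | h.1 v ≠ 0 ∧ f v ≠ 0} := by
  obtain ⟨N, F, hF, hf⟩ := hf
  convert isOpen_ne_zero (mul_mem h.2 hF) using 1
  ext v
  simp only [Set.mem_ofPred_eq, Pi.mul_apply]
  refine ⟨fun hv => mul_ne_zero hv.1 ?_, fun hv => ⟨left_ne_zero_of_mul hv, fun h0 => ?_⟩⟩
  · rw [← hf v hv.1]
    exact mul_ne_zero (pow_ne_zero _ hv.1) hv.2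
  · exact right_ne_zero_of_mul hv (by rw [← hf v (left_ne_zero_of_mul hv), h0, mul_zero])

/-! ### Irreducibility of affine space -/

section FiniteDimensional

variable [FiniteDimensional ℂ V]

theorem exists_mvPolynomial {f : V → ℂ} (hf : f ∈ polyFun V) :
    ∃ P : MvPolynomial (Fin (Module.finrank ℂ V)) ℂ,
      ∀ v, f v = MvPolynomial.eval ((Module.finBasis ℂ V).equivFun v) P := by
  induction hf using Algebra.adjoin_induction with
  | mem x hx =>
    obtain ⟨φ, rfl⟩ := hx
    refine ⟨∑ i, MvPolynomial.C (φ (Module.finBasis ℂ V i)) * MvPolynomial.X i, fun v => ?_⟩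
    simp only [map_sum, map_mul, MvPolynomial.eval_C, MvPolynomial.eval_X]
    conv_lhs => rw [← (Module.finBasis ℂ V).sum_equivFun v]
    simp only [map_sum, map_smul, smul_eq_mul, mul_comm]
  | algebraMap r => exact ⟨MvPolynomial.C r, fun v => by simp⟩
  | add x y _ _ hx hy =>
    obtain ⟨P, hP⟩ := hx
    obtain ⟨Q, hQ⟩ := hy
    exact ⟨P + Q, fun v => by simp [hP, hQ]⟩
  | mul x y _ _ hx hy =>
    obtain ⟨P, hP⟩ := hx
    obtain ⟨Q, hQ⟩ := hy
    exact ⟨P * Q, fun v => by simp [hP, hQ]⟩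

/-- In coordinates both functions are nonzero polynomials. Their product is nonzero because
polynomials form a domain, and over an infinite field it has a point where it does not vanish. -/
theorem exists_mul_ne_zero {f g : V → ℂ} (hf : f ∈ polyFun V) (hg : g ∈ polyFun V)
    (hf0 : f ≠ 0) (hg0 : g ≠ 0) : ∃ v, f v ≠ 0 ∧ g v ≠ 0 := by
  obtain ⟨P, hP⟩ := exists_mvPolynomial hf
  obtain ⟨Q, hQ⟩ := exists_mvPolynomial hg
  have hP0 : P ≠ 0 := by
    rintro rfl
    exact hf0 (funext fun v => by simp [hP])
  have hQ0 : Q ≠ 0 := by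
    rintro rfl
    exact hg0 (funext fun v => by simp [hQ])
  by_contra! hc
  refine mul_ne_zero hP0 hQ0 (MvPolynomial.funext fun x => ?_)
  have hx := hc ((Module.finBasis ℂ V).equivFun.symm x)
  rw [hP, hQ, LinearEquiv.apply_symm_apply] at hx
  rw [map_mul, map_zero]
  by_cases h : MvPolynomial.eval x P = 0
  · rw [h, zero_mul]
  · rw [hx h, mul_zero]

theorem irreducibleSpace_zariski : @IrreducibleSpace V (zariski V) := by
  let _ := zariski V
  have : PreirreducibleSpace V := by
    refine ⟨fun u v hu hv ⟨x, _, hx⟩ ⟨y, _, hy⟩ => ?_⟩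
    obtain ⟨f, hf, hfx, hfu⟩ := exists_ne_zero_of_mem_isOpen hu hx
    obtain ⟨g, hg, hgy, hgv⟩ := exists_ne_zero_of_mem_isOpen hv hy
    obtain ⟨z, hz⟩ := exists_mul_ne_zero hf hg (fun h => hfx (by simp [h])) fun h =>
      hgy (by simp [h])
    exact ⟨z, trivial, hfu z hz.1, hgv z hz.2⟩
  exact ⟨⟨0⟩⟩

theorem isIrreducible_of_isOpen {U : Set V} (hU : IsOpen[zariski V] U) (hne : U.Nonempty) :
    @IsIrreducible V (zariski V) U := by
  let _ := zariski V
  have := irreducibleSpace_zariski (V := V)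
  exact ⟨hne, (PreirreducibleSpace.isPreirreducible_univ (X := V)).open_subset hU
    (Set.subset_univ _)⟩

end FiniteDimensional

/-! ### Families of matrices with entries in an algebra of functions -/

section Matrices

variable {n : ℕ}

/-- Families of matrices with entries in an algebra of functions. -/
def MatIn (A : Subalgebra ℂ (V → ℂ)) (M : V → Mat n) : Prop :=
  ∀ r c, (fun v => M v r c) ∈ A

variable {A : Subalgebra ℂ (V → ℂ)}

/-- The matrix over the algebra `A` that corresponds to a family of matrices. -/
def MatIn.toMatrix {M : V → Mat n} (h : MatIn A M) : Matrix (Fin n) (Fin n) A :=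
  Matrix.of fun r c => ⟨_, h r c⟩

/-- Evaluation at a point, as a ring homomorphism. -/
def evalAt (A : Subalgebra ℂ (V → ℂ)) (v : V) : A →+* ℂ :=
  (Pi.evalRingHom _ v).comp A.val.toRingHom

theorem MatIn.map_toMatrix {M : V → Mat n} (h : MatIn A M) (v : V) :
    h.toMatrix.map (evalAt A v) = M v := rfl

/-- The determinant is formed over the ring `A`; evaluation at a point is a ring homomorphism and
commutes with it. The same device serves for the adjugate. -/
theorem MatIn.det {M : V → Mat n} (h : MatIn A M) : (fun v => (M v).det) ∈ A := by
  have : (fun v => (M v).det) = (h.toMatrix.det : A) := by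
    ext v
    rw [← h.map_toMatrix v]
    exact ((evalAt A v).map_det _).symm
  rw [this]
  exact Subtype.prop _

theorem MatIn.adjugate {M : V → Mat n} (h : MatIn A M) : MatIn A fun v => (M v).adjugate := by
  intro r c
  have : (fun v => (M v).adjugate r c) = (h.toMatrix.adjugate r c : A) := by
    ext v
    rw [← h.map_toMatrix v]
    exact (congrFun₂ ((evalAt A v).map_adjugate h.toMatrix) r c).symm
  rw [this]
  exact Subtype.prop _

theorem MatIn.mul {M N : V → Mat n} (h : MatIn A M) (h' : MatIn A N) :
    MatIn A fun v => M v * N v := by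
  intro r c
  have : (fun v => (M v * N v) r c) = ∑ i, (fun v => M v r i) * fun v => N v i c := by
    ext v
    simp [Matrix.mul_apply]
  rw [this]
  exact sum_mem fun i _ => mul_mem (h r i) (h' i c)

theorem MatIn.add {M N : V → Mat n} (h : MatIn A M) (h' : MatIn A N) :
    MatIn A fun v => M v + N v := fun r c => add_mem (h r c) (h' r c)

theorem MatIn.smul {f : V → ℂ} {N : V → Mat n} (h : f ∈ A) (h' : MatIn A N) :
    MatIn A fun v => f v • N v := fun r c => mul_mem h (h' r c)

theorem MatIn.mono {B : Subalgebra ℂ (V → ℂ)} {M : V → Mat n} (h : MatIn A M) (hAB : A ≤ B) :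
    MatIn B M := fun r c => hAB (h r c)

theorem MatIn.const (M : Mat n) : MatIn A fun _ => M := fun r c => A.algebraMap_mem (M r c)

theorem MatIn.dual_mem {M : V → Mat n} (h : MatIn A M) (φ : Module.Dual ℂ (Mat n)) :
    (fun v => φ (M v)) ∈ A :=
  dual_pi_mem (U := fun _ : Fin n => Fin n → ℂ) (m := M)
    (fun r => dual_pi_mem fun c => dual_scalar_mem (h r c)) φ

theorem MatIn.polyMap {M : V → Mat n} (h : MatIn (polyFun V) M) : PolyMap M :=
  .of_dual h.dual_mem

theorem PolyMap.matIn {M : V → Mat n} (h : PolyMap M) : MatIn (polyFun V) M :=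
  fun r c => h _ (dual_mem_polyFun (Matrix.entryLinearMap ℂ ℂ r c))

end Matrices

end Poly

/-! ### Dimension of subsets of vector spaces -/

section Dimension

variable {V W : Type} [AddCommGroup V] [Module ℂ V] [AddCommGroup W] [Module ℂ W]

/-- Functions without a nontrivial polynomial relation on a given set. -/
def AlgIndepOn (S : Set W) {d : ℕ} (x : Fin d → W → ℂ) : Prop :=
  ∀ P : MvPolynomial (Fin d) ℂ, (∀ w ∈ S, MvPolynomial.eval (fun i => x i w) P = 0) → P = 0

theorem eval_mem_polyFun {d : ℕ} {x : Fin d → W → ℂ} (hx : ∀ i, x i ∈ polyFun W)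
    (P : MvPolynomial (Fin d) ℂ) : (fun w => MvPolynomial.eval (fun i => x i w) P) ∈ polyFun W := by
  induction P using MvPolynomial.induction_on with
  | C a => simp only [MvPolynomial.eval_C]; exact (polyFun W).algebraMap_mem a
  | add p q hp hq => simpa using! add_mem hp hq
  | mul_X p i hp => simpa using! mul_mem hp (hx i)

/-- A function that vanishes on a subset, but not on the irreducible set `C`, is independent of
functions that are independent on the subset. -/
theorem AlgIndepOn.cons {B C : Set W} (hBC : B ⊆ C) (hC : @IsIrreducible W (zariski W) C) {d : ℕ}
    {x : Fin d → W → ℂ} (hx : ∀ i, x i ∈ polyFun W) (hB : AlgIndepOn B x) {f : W → ℂ}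
    (hf : f ∈ polyFun W) (hfB : ∀ w ∈ B, f w = 0) {w₀ : W} (hw₀ : w₀ ∈ C) (hf₀ : f w₀ ≠ 0) :
    AlgIndepOn C (Fin.cons f x : Fin (d + 1) → W → ℂ) := by
  let _ := zariski W
  intro P hP
  by_contra hP0
  have hG0 : MvPolynomial.finSuccEquiv ℂ d P ≠ 0 := by simpa using hP0
  have hcons : ∀ w, (fun i => (Fin.cons f x : Fin (d + 1) → W → ℂ) i w) =
      Fin.cons (f w) fun i => x i w := by
    intro w
    ext i
    refine Fin.cases ?_ (fun i => ?_) i <;> simp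
  have hev : ∀ G : Polynomial (MvPolynomial (Fin d) ℂ),
      (fun w => Polynomial.eval (f w) (G.map (MvPolynomial.eval fun i => x i w))) ∈ polyFun W := by
    intro G
    have h1 : ∀ i, (Fin.cons f x : Fin (d + 1) → W → ℂ) i ∈ polyFun W :=
      fun i => Fin.cases hf hx i
    have := eval_mem_polyFun h1 ((MvPolynomial.finSuccEquiv ℂ d).symm G)
    simpa only [hcons, MvPolynomial.eval_eq_eval_mv_eval', AlgEquiv.apply_symm_apply] using this
  -- With X the variable of `f`, write P = X^m G with X not dividing G. On the irreducible set `C`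
  -- the product f^m G vanishes while `f` does not, so G vanishes on `C`. On `B`, where f = 0, only
  -- the constant coefficient of G survives; it is a relation between the `x i`, hence zero, a
  -- contradiction.
  obtain ⟨G, hG, hGX⟩ := Polynomial.exists_eq_pow_rootMultiplicity_mul_and_not_dvd _ hG0 0
  rw [Polynomial.C_0, sub_zero] at hG hGX
  have hsub : C ⊆ {w | f w = 0} ∪
      {w | Polynomial.eval (f w) (G.map (MvPolynomial.eval fun i => x i w)) = 0} := by
    intro w hw
    have h := hP w hw
    rw [hcons, MvPolynomial.eval_eq_eval_mv_eval', hG] at h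
    simp only [Polynomial.map_mul, Polynomial.map_pow, Polynomial.map_X, Polynomial.eval_mul,
      Polynomial.eval_pow, Polynomial.eval_X, mul_eq_zero] at h
    exact h.imp (fun h => eq_zero_of_pow_eq_zero h) id
  rcases isPreirreducible_iff_isClosed_union_isClosed.1 hC.isPreirreducible _ _
    (isClosed_eq_zero hf) (isClosed_eq_zero (hev G)) hsub with h | h
  · exact hf₀ (h hw₀)
  · refine hGX (Polynomial.X_dvd_iff.2 (hB _ fun w hw => ?_))
    have := h (hBC hw)
    rw [Set.mem_ofPred_eq, hfB w hw, ← Polynomial.coeff_zero_eq_eval_zero,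
      Polynomial.coeff_map] at this
    exact this

/-- A polynomial relation that holds on the image of `m` holds on its closure, hence on `S`. So the
pull-backs of the `x i` are algebraically independent polynomials in dim V variables, and the
transcendence degree bounds their number. -/
theorem AlgIndepOn.le_finrank [FiniteDimensional ℂ V] {m : V → W} (hm : PolyMap m) {S : Set W}
    (hS : S ⊆ closure[zariski W] (Set.range m)) {d : ℕ} {x : Fin d → W → ℂ}
    (hx : ∀ i, x i ∈ polyFun W) (h : AlgIndepOn S x) : d ≤ Module.finrank ℂ V := by
  let _ := zariski W
  choose P hP using fun i => exists_mvPolynomial (hm _ (hx i))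
  have hind : AlgebraicIndependent ℂ P := by
    rw [algebraicIndependent_iff]
    intro Q hQ
    refine h Q fun w hw => ?_
    have hsub : closure (Set.range m) ⊆ {w | MvPolynomial.eval (fun i => x i w) Q = 0} := by
      refine closure_minimal ?_ (isClosed_eq_zero (eval_mem_polyFun hx Q))
      rintro _ ⟨v, rfl⟩
      have := congrArg (MvPolynomial.eval ((Module.finBasis ℂ V).equivFun v)) hQ
      rw [map_zero, MvPolynomial.aeval_def, MvPolynomial.eval₂_eq', map_sum] at this
      rw [Set.mem_ofPred_eq, MvPolynomial.eval_eq', ← this]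
      refine Finset.sum_congr rfl fun e _ => ?_
      simp [hP]
    exact hsub (hS hw)
  have := hind.cardinalMk_le_trdeg
  rw [MvPolynomial.trdeg_of_isDomain, Cardinal.mk_fin, Cardinal.mk_fin, Cardinal.lift_natCast] at this
  exact_mod_cast this

/-- A set has dimension at most `d` if all its irreducible subsets lie in closures of polynomial
images of vector spaces of dimension at most `d`. -/
theorem dim_restrict_le_of_forall {S : Set W} {d : ℕ}
    (hS : ∀ T ⊆ S, @IsIrreducible W (zariski W) T → ∃ (V : Type) (_ : AddCommGroup V)
      (_ : Module ℂ V) (_ : FiniteDimensional ℂ V) (m : V → W), PolyMap m ∧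
        T ⊆ closure[zariski W] (Set.range m) ∧ Module.finrank ℂ V ≤ d) :
    ((affine W).restrict S).dim ≤ (d : WithBot ℕ∞) := by
  let _ := zariski W
  change Order.krullDim (TopologicalSpace.IrreducibleCloseds S) ≤ _
  refine iSup_le fun l => ?_
  -- The i-th member of a chain of irreducible closed sets carries i independent functions: each
  -- strict inclusion supplies a polynomial that vanishes on the smaller set but not on the larger
  -- one.
  have key : ∀ i (hi : i < l.length + 1), ∃ x : Fin i → W → ℂ, (∀ i, x i ∈ polyFun W) ∧
      AlgIndepOn (Subtype.val '' (l ⟨i, hi⟩ : Set S)) x := by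
    intro i
    induction i with
    | zero =>
      refine fun hi => ⟨Fin.elim0, fun i => i.elim0, fun P hP => ?_⟩
      obtain ⟨s, hs⟩ := (l ⟨0, hi⟩).2.nonempty
      have := hP s ⟨s, hs, rfl⟩
      obtain ⟨a, rfl⟩ := MvPolynomial.C_surjective (Fin 0) P
      rw [MvPolynomial.eval_C] at this
      rw [this, map_zero]
    | succ i ih =>
      intro hi
      obtain ⟨x, hx, hind⟩ := ih (by omega)
      have hlt : l ⟨i, by omega⟩ < l ⟨i + 1, hi⟩ := l.strictMono (by simp [Fin.lt_def])
      obtain ⟨hle, s, hs, hs'⟩ := Set.ssubset_iff_exists.1 (show (l ⟨i, by omega⟩ : Set S) ⊂ l ⟨i + 1, hi⟩ from hlt)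
      obtain ⟨C, hC, (hCl : _ = (l ⟨i, by omega⟩ : Set S))⟩ := isClosed_induced_iff.1 (l ⟨i, by omega⟩).3
      obtain ⟨f, hf, hfs, hfC⟩ := exists_eq_zero_of_notMem_isClosed (x := s.1) hC (fun h => hs' (by
        rw [← hCl]; exact h))
      refine ⟨Fin.cons f x, fun i => Fin.cases hf hx i,
        hind.cons (Set.image_mono hle) ?_ hx hf ?_ ⟨s, hs, rfl⟩ hfs⟩
      · exact (l ⟨i + 1, hi⟩).2.image _ continuous_subtype_val.continuousOn
      · rintro _ ⟨t, ht, rfl⟩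
        rw [← hCl] at ht
        exact hfC _ ht
  obtain ⟨x, hx, hind⟩ := key l.length (by omega)
  obtain ⟨V, _, _, _, m, hm, hT, hd⟩ := hS (Subtype.val '' (l ⟨l.length, by omega⟩ : Set S))
    (by simp) ((l ⟨l.length, by omega⟩).2.image _ continuous_subtype_val.continuousOn)
  have := (hind.le_finrank hm hT hx).trans hd
  exact_mod_cast this

theorem dim_restrict_le [FiniteDimensional ℂ V] {m : V → W} (hm : PolyMap m) {S : Set W}
    (hS : S ⊆ closure[zariski W] (Set.range m)) :
    ((affine W).restrict S).dim ≤ (Module.finrank ℂ V : WithBot ℕ∞) :=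
  dim_restrict_le_of_forall fun _ hT _ =>
    ⟨V, inferInstance, inferInstance, inferInstance, m, hm, hT.trans hS, le_rfl⟩

/-- The chain consists of the intersections of `U` with the affine subspaces through a point of `U`
spanned by the first i basis vectors, for i = 0, …, dim V. -/
theorem le_dim_restrict_of_isOpen [FiniteDimensional ℂ V] {U : Set V} (hU : IsOpen[zariski V] U)
    (hne : U.Nonempty) : (Module.finrank ℂ V : WithBot ℕ∞) ≤ ((affine V).restrict U).dim := by
  let _ := zariski V
  obtain ⟨v₀, hv₀⟩ := hne
  let b := Module.finBasis ℂ V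
  -- the projection to the affine subspace spanned by the first `i` basis vectors
  let L : ℕ → V →ₗ[ℂ] V := fun i => b.constr ℂ fun j => if j.val < i then b j else 0
  have hL : ∀ i v j, b.coord j (L i v) = if j.val < i then b.coord j v else 0 := by
    intro i v j
    have : b.coord j ∘ₗ L i = if j.val < i then b.coord j else 0 := by
      refine b.ext fun l => ?_
      simp only [L, LinearMap.comp_apply, Module.Basis.constr_basis]
      by_cases hlj : l = j
      · subst hlj
        split_ifs <;> simp
      · split_ifs <;> simp [hlj]
    have := LinearMap.congr_fun this v
    split_ifs at this ⊢ <;> simpa using this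
  let q : ℕ → V → V := fun i v => v₀ + L i (v - v₀)
  have hqc : ∀ i v j, b.coord j (q i v - v₀) = if j.val < i then b.coord j (v - v₀) else 0 := by
    intro i v j
    rw [← hL, add_sub_cancel_left]
  have hqid : ∀ i v, (∀ j : Fin _, i ≤ j.val → b.coord j (v - v₀) = 0) → q i v = v := by
    intro i v h
    have : L i (v - v₀) = v - v₀ := by
      refine b.ext_elem fun j => ?_
      have := hL i (v - v₀) j
      split_ifs at this with hj
      · exact this
      · exact this.trans (h j (by omega)).symm
    simp only [q, this, add_sub_cancel]
  have hqp : ∀ i, PolyMap (q i) := by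
    refine fun i => .of_dual fun φ => ?_
    have : (fun v => φ (q i v)) =
        algebraMap ℂ _ (φ v₀ - φ (L i v₀)) + fun v => φ.comp (L i) v := by
      ext v
      simp [q]
      ring
    rw [this]
    exact add_mem (Subalgebra.algebraMap_mem _ _) (dual_mem_polyFun _)
  have hcoord : ∀ j, (fun v => b.coord j (v - v₀)) ∈ polyFun V := by
    intro j
    have : (fun v => b.coord j (v - v₀)) = (fun v => b.coord j v) - algebraMap ℂ _ (b.coord j v₀) := by
      ext v
      simp
    rw [this]
    exact sub_mem (dual_mem_polyFun _) (Subalgebra.algebraMap_mem _ _)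
  let w : ℕ → Set U := fun i => {v | ∀ j : Fin _, i ≤ j.val → b.coord j (v.1 - v₀) = 0}
  have hwc : ∀ i, IsClosed (w i) := by
    intro i
    have : w i = ⋂ j : Fin _, ⋂ _ : i ≤ j.val, Subtype.val ⁻¹' {v | b.coord j (v - v₀) = 0} := by
      ext
      simp [w]
    rw [this]
    exact isClosed_iInter fun j => isClosed_iInter fun _ =>
      (isClosed_eq_zero (hcoord j)).preimage continuous_subtype_val
  have hopen : ∀ i, IsOpen (q i ⁻¹' U) := fun i => hU.preimage (hqp i).continuous
  have hne : ∀ i, (q i ⁻¹' U).Nonempty := fun i => ⟨v₀, by simpa [q] using hv₀⟩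
  have hmem : ∀ i v (hv : q i v ∈ U), (⟨q i v, hv⟩ : U) ∈ w i := by
    intro i v hv j hj
    rw [hqc, if_neg (by omega)]
  have hwi : ∀ i, IsIrreducible (w i) := by
    intro i
    have := isIrreducible_iff_irreducibleSpace.1 (isIrreducible_of_isOpen (hopen i) (hne i))
    have hcont : Continuous fun v : q i ⁻¹' U => (⟨q i v, v.2⟩ : U) :=
      ((hqp i).continuous.comp continuous_subtype_val).subtype_mk _
    -- `q i` fixes `w i` pointwise, so `w i` is the image of `q i ⁻¹' U`, a nonempty open subset of
    -- a vector space.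
    convert (IrreducibleSpace.isIrreducible_univ (q i ⁻¹' U)).image _ hcont.continuousOn
    ext v
    constructor
    · intro hv
      have := hqid i v hv
      exact ⟨⟨v, by rw [Set.mem_preimage, this]; exact v.2⟩, trivial, Subtype.ext this⟩
    · rintro ⟨u, -, rfl⟩
      exact hmem i u u.2
  refine Order.le_krullDim_iff.2 ⟨⟨Module.finrank ℂ V, fun i => ⟨w i.val, hwi _, hwc _⟩, ?_⟩, rfl⟩
  intro i
  have hsub : w i.val ⊆ w (i.val + 1) := fun v hv j hj => hv j (by omega)
  refine (Set.ssubset_iff_exists (s := w i.val) (t := w (i.val + 1))).2 ⟨hsub, ?_⟩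
  let i' : Fin (Module.finrank ℂ V) := i
  have := irreducibleSpace_zariski (V := V)
  -- Two nonempty open sets meet, so some point projects into `U` and has a nonzero i-th coordinate
  -- relative to `v₀`; its projection separates `w (i + 1)` from `w i`.
  obtain ⟨v, hv, hv'⟩ := nonempty_preirreducible_inter (hopen (i.val + 1))
    (isOpen_ne_zero (hcoord i')) (hne _) ⟨b i' + v₀, by simp⟩
  refine ⟨⟨q (i.val + 1) v, hv⟩, hmem _ _ _, fun h => hv' ?_⟩
  have := h i' le_rfl
  rwa [hqc, if_pos (by simp [i'])] at this

end Dimension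

/-! ### Segments of products and partial sums -/

section Segments

variable {n k : ℕ}

/-- The product `X_a ⋯ X_{j-1}`. -/
def seg (X : Tuple n k) (a : ℕ) : ℕ → Mat n
  | 0 => 1
  -- For j + 1 ≤ a the default value 1 is the empty product; beyond `k` it has no meaning.
  | j + 1 => if h : a ≤ j ∧ j < k then seg X a j * X ⟨j, h.2⟩ else 1

theorem seg_succ (X : Tuple n k) {a j : ℕ} (h : a ≤ j) (hj : j < k) :
    seg X a (j + 1) = seg X a j * X ⟨j, hj⟩ := by
  rw [seg, dif_pos ⟨h, hj⟩]

theorem seg_of_le (X : Tuple n k) {a j : ℕ} (h : j ≤ a) : seg X a j = 1 := by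
  cases j with
  | zero => rfl
  | succ j => rw [seg, dif_neg (by omega)]

theorem seg_single (X : Tuple n k) {j : ℕ} (hj : j < k) : seg X j (j + 1) = X ⟨j, hj⟩ := by
  rw [seg_succ X le_rfl hj, seg_of_le X le_rfl, one_mul]

theorem seg_mul_seg (X : Tuple n k) {a b j : ℕ} (hab : a ≤ b) (hbj : b ≤ j) (hj : j ≤ k) :
    seg X a b * seg X b j = seg X a j := by
  induction j, hbj using Nat.le_induction with
  | base => rw [seg_of_le X le_rfl, mul_one]
  | succ j hbj ih => rw [seg_succ X hbj (by omega), seg_succ X (by omega) (by omega),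
      ← mul_assoc, ih (by omega)]

theorem prod_ofFn_eq_seg (X : Tuple n k) : (List.ofFn X).prod = seg X 0 k := by
  have : ∀ m (hm : m ≤ k), (List.ofFn fun i : Fin m => X (Fin.castLE hm i)).prod = seg X 0 m := by
    intro m
    induction m with
    | zero => intro _; simp [seg]
    | succ m ih =>
      intro hm
      rw [seg_succ X (Nat.zero_le _) hm, ← ih (by omega), List.ofFn_succ', List.concat_eq_append,
        List.prod_append, List.prod_singleton]
      rfl
  exact this k le_rfl

theorem mem_zeroProduct {X : Tuple n k} : X ∈ zeroProduct n k ↔ seg X 0 k = 0 := by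
  rw [← prod_ofFn_eq_seg]
  rfl

theorem seg_act (g : Fin (k + 1) → GL (Fin n) ℂ) (X : Tuple n k) {a j : ℕ} (haj : a ≤ j)
    (hj : j ≤ k) : seg (act g X) a j =
      (g ⟨a, by omega⟩ : Mat n) * seg X a j * ((g ⟨j, by omega⟩)⁻¹ : GL (Fin n) ℂ) := by
  induction j, haj using Nat.le_induction with
  | base => simp [seg_of_le]
  | succ j haj ih =>
    have hact : act g X ⟨j, by omega⟩ = (g ⟨j, by omega⟩ : Mat n) * X ⟨j, by omega⟩ *
      ((g ⟨j + 1, by omega⟩)⁻¹ : GL (Fin n) ℂ) := rfl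
    rw [seg_succ _ haj (by omega), seg_succ _ haj (by omega), ih (by omega), hact]
    simp only [mul_assoc, Units.inv_mul_cancel_left]

theorem act_mul (g h : Fin (k + 1) → GL (Fin n) ℂ) (X : Tuple n k) :
    act (g * h) X = act g (act h X) := by
  ext1 j
  simp [act, mul_assoc]

theorem partSum_of_le (p : Fin k → ℕ) {a b : ℕ} (h : b ≤ a) : partSum p a b = 0 := by
  rw [partSum, Finset.filter_false_of_mem, Finset.sum_empty]
  intro i _
  omega

theorem partSum_add (p : Fin k → ℕ) {a b c : ℕ} (hab : a ≤ b) (hbc : b ≤ c) :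
    partSum p a b + partSum p b c = partSum p a c := by
  rw [partSum, partSum, partSum, ← Finset.sum_union]
  · congr 1
    ext i
    simp only [Finset.mem_union, Finset.mem_filter, Finset.mem_univ, true_and]
    omega
  · rw [Finset.disjoint_left]
    intro i
    simp only [Finset.mem_filter, Finset.mem_univ, true_and]
    omega

theorem partSum_single (p : Fin k → ℕ) {j : ℕ} (hj : j < k) : partSum p j (j + 1) = p ⟨j, hj⟩ := by
  rw [partSum, Finset.sum_eq_single_of_mem ⟨j, hj⟩ (by simp)]
  intro i hi hne
  simp only [Finset.mem_filter, Finset.mem_univ, true_and] at hi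
  exact absurd (Fin.ext (by simp; omega)) hne

theorem partSum_succ (p : Fin k → ℕ) {a j : ℕ} (h : a ≤ j) (hj : j < k) :
    partSum p a (j + 1) = partSum p a j + p ⟨j, hj⟩ := by
  rw [← partSum_add p h (Nat.le_succ j), partSum_single]

theorem partSum_total (p : Comp n k) : partSum p.1 0 k = n := by
  rw [partSum, Finset.filter_true_of_mem (fun i _ => ⟨Nat.zero_le _, i.2⟩), p.2]

end Segments

/-! ### Linear algebra -/

/-- Descending recursion along `k, k - 1, …, 0`. -/
theorem exists_descending {α : Type*} {P : ℕ → α → Prop} {Q : ℕ → α → α → Prop} {k : ℕ}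
    (h₀ : ∃ x, P k x) (hs : ∀ j < k, ∀ x, P (j + 1) x → ∃ y, P j y ∧ Q j x y) :
    ∃ f : ℕ → α, (∀ j ≤ k, P j (f j)) ∧ ∀ j < k, Q j (f (j + 1)) (f j) := by
  -- The value at `k` is prescribed, so that the sequence given by the induction hypothesis can be
  -- continued by one more term.
  suffices H : ∀ x, P k x → ∃ f : ℕ → α, f k = x ∧ (∀ j ≤ k, P j (f j)) ∧
      ∀ j < k, Q j (f (j + 1)) (f j) by
    obtain ⟨x, hx⟩ := h₀
    obtain ⟨f, -, hf⟩ := H x hx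
    exact ⟨f, hf⟩
  clear h₀
  induction k with
  | zero => exact fun x hx => ⟨fun _ => x, rfl, fun j hj => by rwa [Nat.le_zero.1 hj], by simp⟩
  | succ k ih =>
    intro x hx
    obtain ⟨y, hy, hxy⟩ := hs k (by omega) x hx
    obtain ⟨f, hfk, hf, hf'⟩ := ih (fun j hj => hs j (by omega)) y hy
    refine ⟨fun j => if j ≤ k then f j else x, by simp, fun j hj => ?_, fun j hj => ?_⟩
    · by_cases h : j ≤ k
      · simpa [h] using hf j h
      · obtain rfl : j = k + 1 := by omega
        simpa using hx
    · by_cases h : j < k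
      · simpa [h, h.le] using hf' j h
      · obtain rfl : j = k := by omega
        simpa [hfk] using hxy

section LinearAlgebra

variable {n : ℕ}

/-- Intermediate subspaces of prescribed dimension. -/
theorem exists_submodule_finrank_eq {E : Type*} [AddCommGroup E] [Module ℂ E]
    [FiniteDimensional ℂ E] {L K : Submodule ℂ E} (hLK : L ≤ K) {d : ℕ}
    (hL : Module.finrank ℂ L ≤ d) (hK : d ≤ Module.finrank ℂ K) :
    ∃ F : Submodule ℂ E, L ≤ F ∧ F ≤ K ∧ Module.finrank ℂ F = d := by
  induction d, hL using Nat.le_induction with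
  | base => exact ⟨L, le_rfl, hLK, rfl⟩
  | succ d hd ih =>
    obtain ⟨F, hLF, hFK, hF⟩ := ih (by omega)
    have hlt : F < K := lt_of_le_of_ne hFK (by rintro rfl; omega)
    obtain ⟨x, hxK, hxF⟩ := SetLike.exists_of_lt hlt
    refine ⟨F ⊔ Submodule.span ℂ {x}, hLF.trans le_sup_left,
      sup_le hFK ((Submodule.span_singleton_le_iff_mem _ _).2 hxK), ?_⟩
    have h1 := Submodule.finrank_add_le_finrank_add_finrank F (Submodule.span ℂ {x})
    have h2 : Module.finrank ℂ (Submodule.span ℂ {x}) ≤ 1 := by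
      simpa using finrank_span_le_card (R := ℂ) ({x} : Set E)
    have h3 : F < F ⊔ Submodule.span ℂ {x} := by
      refine lt_of_le_of_ne le_sup_left fun h => hxF ?_
      rw [h]
      exact Submodule.mem_sup_right (Submodule.mem_span_singleton_self x)
    have h4 := Submodule.finrank_lt_finrank_of_lt h3
    omega

/-- Extension of linearly independent families inside a subspace. -/
theorem exists_linearIndependent_extension {v : ℕ → Fin n → ℂ} {E : Submodule ℂ (Fin n → ℂ)}
    {d e : ℕ} (hde : d ≤ e) (he : e ≤ Module.finrank ℂ E)
    (hv : LinearIndependent ℂ fun c : Fin d => v c) (hvE : ∀ c < d, v c ∈ E) :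
    ∃ w : ℕ → Fin n → ℂ, (∀ c < d, w c = v c) ∧ (LinearIndependent ℂ fun c : Fin e => w c) ∧
      ∀ c < e, w c ∈ E := by
  induction e, hde using Nat.le_induction with
  | base => exact ⟨v, fun _ _ => rfl, hv, hvE⟩
  | succ e hde ih =>
    obtain ⟨w, hwv, hw, hwE⟩ := ih (by omega)
    have hle : Submodule.span ℂ (Set.range fun c : Fin e => w c) ≤ E := by
      rw [Submodule.span_le]
      rintro _ ⟨c, rfl⟩
      exact hwE c c.2
    have hlt : Submodule.span ℂ (Set.range fun c : Fin e => w c) < E := by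
      refine lt_of_le_of_ne hle fun h => ?_
      have := finrank_span_eq_card hw
      rw [h, Fintype.card_fin] at this
      omega
    obtain ⟨x, hxE, hx⟩ := SetLike.exists_of_lt hlt
    refine ⟨Function.update w e x, fun c hc => ?_, ?_, fun c hc => ?_⟩
    · rw [Function.update_of_ne (by omega), hwv c hc]
    · have := linearIndependent_finSnoc.2 ⟨hw, hx⟩
      have heq : (fun c : Fin (e + 1) => Function.update w e x c) =
          Fin.snoc (α := fun _ => Fin n → ℂ) (fun c : Fin e => w c) x := by
        ext1 c
        refine Fin.lastCases ?_ (fun c => ?_) c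
        · simp
        · simp only [Fin.val_castSucc, Fin.snoc_castSucc]
          rw [Function.update_of_ne (by omega)]
      rw [heq]
      exact this
    · by_cases h : c = e
      · subst h
        simpa using hxE
      · rw [Function.update_of_ne h]
        exact hwE c (by omega)

/-- A linearly independent family of length at most `n` extends to an invertible matrix. -/
theorem exists_isUnit_det_col_eq {v : ℕ → Fin n → ℂ} {d : ℕ} (hd : d ≤ n)
    (hv : LinearIndependent ℂ fun c : Fin d => v c) :
    ∃ g : Mat n, IsUnit g.det ∧ ∀ c : Fin n, c.val < d → g.col c = v c := by
  obtain ⟨w, hwv, hw, -⟩ := exists_linearIndependent_extension (E := ⊤) hd (by simp) hv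
    (fun _ _ => trivial)
  refine ⟨(Matrix.of fun c : Fin n => w c).transpose, ?_, fun c hc => ?_⟩
  · rw [← Matrix.isUnit_iff_isUnit_det, ← Matrix.linearIndependent_cols_iff_isUnit]
    exact hw
  · rw [← hwv c hc]
    rfl

theorem linearIndependent_col {g : Mat n} (hg : IsUnit g.det) : LinearIndependent ℂ g.col :=
  Matrix.linearIndependent_cols_iff_isUnit.2 ((Matrix.isUnit_iff_isUnit_det g).2 hg)

theorem colSpan_le_iff {g : Mat n} {m : ℕ} {E : Submodule ℂ (Fin n → ℂ)} :
    colSpan g m ≤ E ↔ ∀ c : Fin n, c.val < m → g.col c ∈ E := by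
  rw [colSpan, Submodule.span_le]
  exact Set.image_subset_iff

theorem col_mem_colSpan (g : Mat n) {m : ℕ} {c : Fin n} (hc : c.val < m) : g.col c ∈ colSpan g m :=
  Submodule.subset_span ⟨c, hc, rfl⟩

theorem colSpan_congr {g g' : Mat n} {m : ℕ} (h : ∀ c : Fin n, c.val < m → g.col c = g'.col c) :
    colSpan g m = colSpan g' m := by
  refine le_antisymm (colSpan_le_iff.2 fun c hc => ?_) (colSpan_le_iff.2 fun c hc => ?_)
  · rw [h c hc]; exact col_mem_colSpan _ hc
  · rw [← h c hc]; exact col_mem_colSpan _ hc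

/-- A chain of subspaces has an adapted frame. -/
theorem exists_adapted_frame {k : ℕ} (F : ℕ → Submodule ℂ (Fin n → ℂ))
    (hF : ∀ a < k, F (a + 1) ≤ F a) :
    ∃ g : Mat n, IsUnit g.det ∧ ∀ a ≤ k, colSpan g (Module.finrank ℂ (F a)) = F a := by
  -- The columns that span `H` are kept, and the following ones are chosen in `E`.
  have step : ∀ (H E : Submodule ℂ (Fin n → ℂ)) (g : Mat n), H ≤ E → IsUnit g.det →
      colSpan g (Module.finrank ℂ H) = H → ∃ g' : Mat n, IsUnit g'.det ∧
        (∀ c : Fin n, c.val < Module.finrank ℂ H → g'.col c = g.col c) ∧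
        colSpan g' (Module.finrank ℂ E) = E := by
    intro H E g hHE hg hgH
    have hEn : Module.finrank ℂ E ≤ n := by simpa using Submodule.finrank_le E
    have hHE' := Submodule.finrank_mono hHE
    obtain ⟨w, hwv, hw, hwE⟩ := exists_linearIndependent_extension (E := E)
      (v := fun c => if h : c < n then g.col ⟨c, h⟩ else 0) hHE' le_rfl
      (by
        convert (linearIndependent_col hg).comp _ (Fin.castLE_injective (hHE'.trans hEn)) using 1
        ext1 c
        simp [show c.val < n by omega, Fin.castLE])
      (fun c hc => by
        simp only [show c < n by omega, dif_pos]
        exact hHE (hgH.le (col_mem_colSpan _ hc)))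
    obtain ⟨g', hg', hgw⟩ := exists_isUnit_det_col_eq hEn hw
    refine ⟨g', hg', fun c hc => ?_, ?_⟩
    · rw [hgw c (by omega), hwv c hc, dif_pos c.2]
    · refine Submodule.eq_of_le_of_finrank_eq (colSpan_le_iff.2 fun c hc => ?_)
        (finrank_colSpan g' hg' hEn)
      rw [hgw c hc]
      exact hwE c hc
  -- The chain decreases, so the construction starts from the smallest space `F k` and enlarges it.
  have key : ∀ m ≤ k, ∃ g : Mat n, IsUnit g.det ∧ ∀ a, k - m ≤ a → a ≤ k →
      colSpan g (Module.finrank ℂ (F a)) = F a := by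
    intro m
    induction m with
    | zero =>
      intro _
      obtain ⟨g, hg, -, hgF⟩ := step ⊥ (F k) 1 bot_le (by simp) (by simp [colSpan])
      refine ⟨g, hg, fun a h1 h2 => ?_⟩
      obtain rfl : a = k := by omega
      exact hgF
    | succ m ih =>
      intro hm
      obtain ⟨g, hg, hgF⟩ := ih (by omega)
      obtain ⟨g', hg', hgg', hgF'⟩ := step (F (k - m)) (F (k - m - 1)) g
        (by simpa [show k - m - 1 + 1 = k - m by omega] using hF (k - m - 1) (by omega)) hg
        (hgF _ le_rfl (by omega))
      refine ⟨g', hg', fun a h1 h2 => ?_⟩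
      by_cases h : k - m ≤ a
      · rw [← hgF a h h2]
        rw [hgF a h h2]
        conv_rhs => rw [← hgF a h h2]
        refine colSpan_congr fun c hc => hgg' c (lt_of_lt_of_le hc (Submodule.finrank_mono ?_))
        clear h1 hc
        induction a, h using Nat.le_induction with
        | base => exact le_rfl
        | succ a ha iha => exact (hF a (by omega)).trans (iha (by omega))
      · obtain rfl : a = k - m - 1 := by omega
        exact hgF'
  obtain ⟨g, hg, hgF⟩ := key k le_rfl
  exact ⟨g, hg, fun a ha => hgF a (by omega) ha⟩

/-- The kernel of a matrix. -/
abbrev kerOf (A : Mat n) : Submodule ℂ (Fin n → ℂ) := LinearMap.ker (Matrix.toLin' A)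

/-- The dimension of the kernel of a matrix. -/
def kdim (A : Mat n) : ℕ := Module.finrank ℂ (kerOf A)

theorem mem_kerOf {A : Mat n} {v : Fin n → ℂ} : v ∈ kerOf A ↔ A.mulVec v = 0 := by
  simp [kerOf]

/-- The shift `e_c ↦ e_{c - m}`. -/
def shift (n m : ℕ) : Mat n := Matrix.of fun r c => if r.val + m = c.val then 1 else 0

theorem col_mul_shift (g : Mat n) (m : ℕ) (c : Fin n) : (g * shift n m).col c =
    if h : m ≤ c.val then g.col ⟨c.val - m, by omega⟩ else 0 := by
  ext r
  simp only [Matrix.col_apply, Matrix.mul_apply, shift, Matrix.of_apply, mul_ite, mul_one, mul_zero]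
  split_ifs with h
  · rw [Finset.sum_eq_single ⟨c.val - m, by omega⟩]
    · simp [h]
    · intro b _ hb
      rw [if_neg]
      intro hb'
      exact hb (Fin.ext (by simp; omega))
    · simp
  · refine Finset.sum_eq_zero fun b _ => if_neg (by omega)

theorem col_mul (g h : Mat n) (c : Fin n) : (g * h).col c = g.mulVec (h.col c) := rfl

/-- If the first `m` columns of a frame span the kernel of `A`, then `A` becomes a shift with
respect to some frame of the target. -/
theorem exists_mul_eq_mul_shift {A g : Mat n} (hg : IsUnit g.det) {m : ℕ}
    (h : colSpan g m = kerOf A) : ∃ g' : Mat n, IsUnit g'.det ∧ A * g = g' * shift n m := by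
  obtain ⟨v, hv⟩ : ∃ v : ℕ → Fin n → ℂ, ∀ c (h : c + m < n), v c = A.mulVec (g.col ⟨c + m, h⟩) :=
    ⟨fun c => if h : c + m < n then A.mulVec (g.col ⟨c + m, h⟩) else 0, fun c h => dif_pos h⟩
  -- The columns of `g` from index m on span a complement of the kernel, so `A` keeps them
  -- independent; their images are the first n - m columns of the new frame.
  have hli : LinearIndependent ℂ fun c : Fin (n - m) => v c := by
    have h1 := (linearIndependent_col hg).comp
      (fun c : Fin (n - m) => (⟨c.val + m, by omega⟩ : Fin n))
      (fun c c' hc => Fin.ext (by simpa using hc))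
    have hdis : Disjoint (Submodule.span ℂ (Set.range (g.col ∘ fun c : Fin (n - m) =>
        (⟨c.val + m, by omega⟩ : Fin n)))) (kerOf A) := by
      rw [← h, colSpan, Set.range_comp]
      refine (linearIndependent_col hg).disjoint_span_image ?_
      rw [Set.disjoint_left]
      rintro _ ⟨c, rfl⟩ hc
      simp at hc
    have heq : (fun c : Fin (n - m) => v c) =
        Matrix.toLin' A ∘ g.col ∘ fun c : Fin (n - m) => (⟨c.val + m, by omega⟩ : Fin n) := by
      ext1 c
      rw [hv c (by omega)]
      rfl
    rw [heq]
    exact h1.map hdis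
  obtain ⟨g', hg', hgc⟩ := exists_isUnit_det_col_eq (Nat.sub_le n m) hli
  refine ⟨g', hg', Matrix.ext_col fun c => ?_⟩
  rw [col_mul_shift, col_mul]
  split_ifs with hc
  · have hlt : c.val - m + m < n := by omega
    rw [hgc _ (by simp; omega), hv _ hlt]
    congr 2
    exact Fin.ext (by simp; omega)
  · rw [← mem_kerOf, ← h]
    exact col_mem_colSpan _ (by omega)

/-- A matrix `A` becomes invertible after adding a matrix of rank `kdim A`. -/
theorem exists_isUnit_det_add (A : Mat n) : ∃ N : Mat n, IsUnit (A + N).det ∧ n ≤ kdim N + kdim A := by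
  obtain ⟨C, hC⟩ := (kerOf A).exists_isCompl
  obtain ⟨D, hD⟩ := (LinearMap.range (Matrix.toLin' A)).exists_isCompl
  have h1 : Module.finrank ℂ (LinearMap.range (Matrix.toLin' A)) + Module.finrank ℂ (kerOf A) = _ :=
    LinearMap.finrank_range_add_finrank_ker (Matrix.toLin' A)
  have h2 := Submodule.finrank_add_eq_of_isCompl hD
  have h3 := Submodule.finrank_add_eq_of_isCompl hC
  rw [Module.finrank_fin_fun] at h1 h2 h3
  -- `N` kills a complement `C` of ker A and maps ker A isomorphically onto a complement `D` of the
  -- range. The sum is then injective, and ker N = C has dimension n - kdim A.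
  let e : kerOf A ≃ₗ[ℂ] D := LinearEquiv.ofFinrankEq _ _ (by omega)
  let N : (Fin n → ℂ) →ₗ[ℂ] (Fin n → ℂ) :=
    D.subtype ∘ₗ e.toLinearMap ∘ₗ Submodule.projectionOnto (kerOf A) C hC
  have hN : ∀ x, N x = 0 ↔ x ∈ C := by
    intro x
    simp [N]
  refine ⟨LinearMap.toMatrix' N, ?_, ?_⟩
  · rw [← Matrix.isUnit_iff_isUnit_det, ← Matrix.mulVec_injective_iff_isUnit]
    refine (injective_iff_map_eq_zero (Matrix.toLin' (A + LinearMap.toMatrix' N))).2 fun x hx => ?_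
    rw [map_add, Matrix.toLin'_toMatrix', LinearMap.add_apply] at hx
    have hND : N x ∈ D := Subtype.prop _
    have hN0 : N x = 0 := by
      refine Submodule.disjoint_def.1 hD.disjoint _ ?_ hND
      rw [← neg_eq_of_add_eq_zero_right hx]
      exact neg_mem (LinearMap.mem_range_self _ _)
    rw [hN0, add_zero] at hx
    exact Submodule.disjoint_def.1 hC.disjoint x hx ((hN x).1 hN0)
  · have : kerOf (LinearMap.toMatrix' N) = C := by
      ext x
      rw [kerOf, Matrix.toLin'_toMatrix', LinearMap.mem_ker, hN]
    rw [kdim, kdim, this]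
    omega

end LinearAlgebra

/-! ### Loci defined by the dimensions of kernels -/

section KernelLoci

variable {n k : ℕ}

theorem kdim_add_rank (A : Mat n) : kdim A + A.rank = n := by
  have h := LinearMap.finrank_range_add_finrank_ker (Matrix.toLin' A)
  rw [Module.finrank_fin_fun, add_comm] at h
  exact h

theorem kdim_mul_mul (g h : GL (Fin n) ℂ) (A : Mat n) :
    kdim ((g : Mat n) * A * (h : Mat n)) = kdim A := by
  have h1 := kdim_add_rank ((g : Mat n) * A * (h : Mat n))
  have h2 := kdim_add_rank A
  rw [Matrix.rank_mul_eq_left_of_isUnit_det (h : Mat n) _ ((Matrix.isUnit_iff_isUnit_det _).1 h.isUnit),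
    Matrix.rank_mul_eq_right_of_isUnit_det (g : Mat n) _ ((Matrix.isUnit_iff_isUnit_det _).1 g.isUnit)] at h1
  omega

/-- The two kernels meet only in zero. Thus a single nonvanishing determinant certifies an upper
bound for a kernel dimension. -/
theorem kdim_le_of_isUnit_det_add {A N : Mat n} (h : IsUnit (A + N).det) : kdim A + kdim N ≤ n := by
  have hdis : Disjoint (kerOf A) (kerOf N) := by
    rw [Submodule.disjoint_def]
    intro x hA hN
    rw [mem_kerOf] at hA hN
    have hinj := Matrix.mulVec_injective_iff_isUnit.2 ((Matrix.isUnit_iff_isUnit_det _).2 h)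
    exact hinj (by rw [Matrix.add_mulVec, hA, hN, add_zero, Matrix.mulVec_zero])
  have h1 := Submodule.finrank_sup_add_finrank_inf_eq (kerOf A) (kerOf N)
  rw [hdis.eq_bot, finrank_bot, add_zero] at h1
  have h2 := Submodule.finrank_le (kerOf A ⊔ kerOf N)
  rw [Module.finrank_fin_fun] at h2
  unfold kdim
  omega

section Family

variable {V : Type} [AddCommGroup V] [Module ℂ V]

/-- For `N` complementary to `M v`, the open condition det(M w + N) ≠ 0 forces kdim (M w) ≤ n - kdim
N ≤ kdim (M v). -/
theorem isOpen_kdim_le {M : V → Mat n} (hM : MatIn (polyFun V) M) (e : ℕ) :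
    IsOpen[zariski V] {v | kdim (M v) ≤ e} := by
  let _ := zariski V
  refine isOpen_iff_forall_mem_open.2 fun v hv => ?_
  obtain ⟨N, hN, hdim⟩ := exists_isUnit_det_add (M v)
  refine ⟨{w | (M w + N).det ≠ 0}, fun w hw => ?_,
    isOpen_ne_zero (hM.add (.const N)).det, hN.ne_zero⟩
  have := kdim_le_of_isUnit_det_add (isUnit_iff_ne_zero.2 hw)
  have : kdim (M v) ≤ e := hv
  change kdim (M w) ≤ e
  omega

theorem isClosed_le_kdim {M : V → Mat n} (hM : MatIn (polyFun V) M) (d : ℕ) :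
    IsClosed[zariski V] {v | d ≤ kdim (M v)} := by
  let _ := zariski V
  cases d with
  | zero => simp
  | succ d =>
    refine ⟨?_⟩
    convert isOpen_kdim_le hM d using 1
    ext v
    simp

end Family

theorem matIn_apply {ι : Type} [Finite ι] (i : ι) : MatIn (polyFun (ι → Mat n)) fun X => X i :=
  (PolyMap.linear (LinearMap.proj (R := ℂ) (φ := fun _ : ι => Mat n) i)).matIn

theorem matIn_seg (a j : ℕ) : MatIn (polyFun (Tuple n k)) fun X => seg X a j := by
  induction j with
  | zero => exact .const 1
  | succ j ih =>
    by_cases h : a ≤ j ∧ j < k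
    · simp only [seg, dif_pos h]
      exact ih.mul (matIn_apply _)
    · simp only [seg, dif_neg h]
      exact .const 1

/-- The tuples for which the kernel of `X_a ⋯ X_{j-1}` has dimension at least `p_a + ⋯ + p_{j-1}`. -/
def kerLocus (n : ℕ) {k : ℕ} (p : Fin k → ℕ) : Set (Tuple n k) :=
  {X | ∀ a j, a ≤ j → j ≤ k → partSum p a j ≤ kdim (seg X a j)}

/-- The tuples for which the kernel of `X_a ⋯ X_{j-1}` has dimension at most `p_a + ⋯ + p_{j-1}`. -/
def smallKerLocus (n : ℕ) {k : ℕ} (p : Fin k → ℕ) : Set (Tuple n k) :=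
  {X | ∀ a j, a ≤ j → j ≤ k → kdim (seg X a j) ≤ partSum p a j}

theorem isClosed_kerLocus (p : Fin k → ℕ) : IsClosed[zariski (Tuple n k)] (kerLocus n p) := by
  let _ := zariski (Tuple n k)
  have : kerLocus n p = ⋂ (a : ℕ) (j : ℕ) (_ : a ≤ j) (_ : j ≤ k),
      {X | partSum p a j ≤ kdim (seg X a j)} := by
    ext X
    simp [kerLocus]
  rw [this]
  exact @isClosed_iInter _ _ (zariski _) _ fun a => @isClosed_iInter _ _ (zariski _) _ fun j =>
    @isClosed_iInter _ _ (zariski _) _ fun _ => @isClosed_iInter _ _ (zariski _) _ fun _ =>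
      isClosed_le_kdim (matIn_seg a j) _

theorem isOpen_smallKerLocus (p : Fin k → ℕ) :
    IsOpen[zariski (Tuple n k)] (smallKerLocus n p) := by
  have : smallKerLocus n p = ⋂ (a : Fin (k + 1)) (j : Fin (k + 1)),
      {X | a.val ≤ j.val → kdim (seg X a j) ≤ partSum p a j} := by
    ext X
    simp only [smallKerLocus, Set.mem_ofPred_eq, Set.mem_iInter]
    exact ⟨fun h a j haj => h a j haj (by omega),
      fun h a j haj hj => h ⟨a, by omega⟩ ⟨j, by omega⟩ haj⟩
  rw [this]
  refine @isOpen_iInter_of_finite _ _ (zariski _) _ _ fun a =>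
    @isOpen_iInter_of_finite _ _ (zariski _) _ _ fun j => ?_
  by_cases h : a.val ≤ j.val
  · simpa [h] using isOpen_kdim_le (matIn_seg a j) _
  · simp [h]

theorem act_mem_kerLocus {p : Fin k → ℕ} (g : Fin (k + 1) → GL (Fin n) ℂ) {X : Tuple n k}
    (hX : X ∈ kerLocus n p) : act g X ∈ kerLocus n p := by
  intro a j haj hj
  rw [seg_act g X haj hj, kdim_mul_mul]
  exact hX a j haj hj

theorem act_mem_smallKerLocus {p : Fin k → ℕ} (g : Fin (k + 1) → GL (Fin n) ℂ) {X : Tuple n k}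
    (hX : X ∈ smallKerLocus n p) : act g X ∈ smallKerLocus n p := by
  intro a j haj hj
  rw [seg_act g X haj hj, kdim_mul_mul]
  exact hX a j haj hj

theorem kdim_diagonal (s : Fin n → Prop) [DecidablePred s] :
    kdim (Matrix.diagonal fun i => if s i then (0 : ℂ) else 1) = Fintype.card {i // s i} := by
  have h1 := kdim_add_rank (Matrix.diagonal fun i => if s i then (0 : ℂ) else 1)
  rw [Matrix.rank_diagonal] at h1
  have h2 := Fintype.card_subtype_compl s
  have h3 : Fintype.card {i // (if s i then (0 : ℂ) else 1) ≠ 0} = Fintype.card {i // ¬ s i} :=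
    Fintype.card_congr (Equiv.subtypeEquivRight fun i => by by_cases h : s i <;> simp [h])
  have h4 := Fintype.card_subtype_le s
  rw [Fintype.card_fin] at h2 h4
  omega

theorem seg_diagTuple (p : Fin k → ℕ) {a j : ℕ} (haj : a ≤ j) (hj : j ≤ k) :
    seg (diagTuple n p) a j = Matrix.diagonal fun i : Fin n =>
      if partSum p 0 a ≤ i.val ∧ i.val < partSum p 0 j then 0 else 1 := by
  induction j, haj using Nat.le_induction with
  | base =>
    rw [seg_of_le _ le_rfl, ← Matrix.diagonal_one]
    congr 1
    ext i
    rw [if_neg (by omega)]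
  | succ j haj ih =>
    rw [seg_succ _ haj (by omega), ih (by omega), diagTuple, Matrix.diagonal_mul_diagonal]
    congr 1
    ext i
    have h1 := partSum_add p (Nat.zero_le a) haj
    have h2 := partSum_add p (Nat.zero_le j) (Nat.le_succ j)
    simp only [Nat.succ_eq_add_one] at h2
    dsimp only
    by_cases hi : partSum p 0 a ≤ i.val ∧ i.val < partSum p 0 j
    · rw [if_pos hi, zero_mul, if_pos (by omega)]
    · rw [if_neg hi, one_mul]
      congr 1
      apply propext
      omega

theorem kdim_seg_diagTuple (p : Comp n k) {a j : ℕ} (haj : a ≤ j) (hj : j ≤ k) :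
    kdim (seg (diagTuple n p.1) a j) = partSum p.1 a j := by
  rw [seg_diagTuple p.1 haj hj, kdim_diagonal]
  have h1 := partSum_add p.1 (Nat.zero_le a) haj
  have h2 := partSum_le p 0 j
  have e : {i : Fin n // partSum p.1 0 a ≤ i.val ∧ i.val < partSum p.1 0 j} ≃
      Fin (partSum p.1 a j) :=
    { toFun := fun i => ⟨i.1.val - partSum p.1 0 a, by have := i.2; omega⟩
      invFun := fun i => ⟨⟨i.val + partSum p.1 0 a, by have := i.2; omega⟩, by
        have := i.2; simp only; omega⟩
      left_inv := fun i => by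
        have := i.2
        ext
        simp
        omega
      right_inv := fun i => by ext; simp }
  rw [Fintype.card_congr e, Fintype.card_fin]

theorem diagTuple_mem_kerLocus (p : Comp n k) : diagTuple n p.1 ∈ kerLocus n p.1 :=
  fun _ _ haj hj => (kdim_seg_diagTuple p haj hj).ge

theorem diagTuple_mem_smallKerLocus (p : Comp n k) : diagTuple n p.1 ∈ smallKerLocus n p.1 :=
  fun _ _ haj hj => (kdim_seg_diagTuple p haj hj).le

/-- The tuple of shifts by `p_0, …, p_{k-1}`. -/
def shiftTuple (n : ℕ) {k : ℕ} (p : Fin k → ℕ) : Tuple n k := fun j => shift n (p j)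

theorem kerOf_seg_le (X : Tuple n k) {a b j : ℕ} (hab : a ≤ b) (hbj : b ≤ j) (hj : j ≤ k) :
    kerOf (seg X b j) ≤ kerOf (seg X a j) := by
  intro x hx
  rw [mem_kerOf] at hx ⊢
  rw [← seg_mul_seg X hab hbj hj, ← Matrix.mulVec_mulVec, hx, Matrix.mulVec_zero]

/-- A tuple with the generic dimensions of kernels is conjugate to the tuple of shifts. -/
theorem exists_act_shiftTuple (p : Comp n k) {X : Tuple n k} (h1 : X ∈ kerLocus n p.1)
    (h2 : X ∈ smallKerLocus n p.1) :
    ∃ g : Fin (k + 1) → GL (Fin n) ℂ, X = act g (shiftTuple n p.1) := by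
  have hdim : ∀ a j, a ≤ j → j ≤ k → kdim (seg X a j) = partSum p.1 a j := fun a j haj hj =>
    le_antisymm (h2 a j haj hj) (h1 a j haj hj)
  -- The frame of U_j is required to be adapted to the kernels of all X_a ⋯ X_{j-1}, and X_j has to
  -- become a shift with respect to the frames of U_{j+1} and U_j.
  refine (exists_descending (k := k)
    (P := fun j g => IsUnit g.det ∧ ∀ a ≤ j, colSpan g (partSum p.1 a j) = kerOf (seg X a j))
    (Q := fun j g' g => ∀ hj : j < k, X ⟨j, hj⟩ * g' = g * shift n (p.1 ⟨j, hj⟩)) ?_ ?_).elim fun f ⟨hf, hf'⟩ => ?_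
  rotate_left 2
  · have hu : ∀ j : Fin (k + 1), IsUnit (f j) := fun j =>
      (Matrix.isUnit_iff_isUnit_det _).2 (hf j (by omega)).1
    refine ⟨fun j => (hu j).unit, funext fun j => ?_⟩
    have h := hf' j j.2 j.2
    have hs : (((hu j.succ).unit : GL (Fin n) ℂ) : Mat n) = f (j.val + 1) := rfl
    have hc : (((hu j.castSucc).unit : GL (Fin n) ℂ) : Mat n) = f j.val := rfl
    rw [act, hc, shiftTuple, ← h, ← hs, mul_assoc, Units.mul_inv, mul_one]
  · obtain ⟨g, hg, hgF⟩ := exists_adapted_frame (k := k) (fun a => kerOf (seg X a k))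
      fun a ha => kerOf_seg_le X (Nat.le_succ a) ha le_rfl
    refine ⟨g, hg, fun a ha => ?_⟩
    rw [← hdim a k ha le_rfl]
    exact hgF a ha
  · rintro j hj g' ⟨hg', hker⟩
    have hk := hker j (Nat.le_succ j)
    rw [seg_single X hj, partSum_single _ hj] at hk
    obtain ⟨g, hg, hgg'⟩ := exists_mul_eq_mul_shift hg' hk
    refine ⟨g, ⟨hg, fun a ha => ?_⟩, fun _ => hgg'⟩
    have hle := partSum_le p a (j + 1)
    rw [partSum_succ _ ha hj] at hle
    refine Submodule.eq_of_le_of_finrank_eq (colSpan_le_iff.2 fun c hc => ?_) ?_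
    -- Column c of the new frame is X_j applied to column c + p_j of the old one, which lies in
    -- ker(X_a ⋯ X_j).
    · have hcol := congrArg (fun M => M.col ⟨c.val + p.1 ⟨j, hj⟩, by omega⟩) hgg'
      simp only [col_mul_shift] at hcol
      rw [col_mul, dif_pos (Nat.le_add_left _ _)] at hcol
      simp only [Nat.add_sub_cancel, Fin.eta] at hcol
      rw [mem_kerOf, ← hcol, Matrix.mulVec_mulVec, ← seg_succ X ha hj, ← mem_kerOf,
        ← hker a (by omega)]
      refine col_mem_colSpan _ ?_
      rw [partSum_succ _ ha hj]
      simpa using hc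
    · rw [finrank_colSpan g hg (partSum_le p _ _)]
      exact (hdim a j ha hj.le).symm

/-- Both loci are invariant under the action and contain D_p. Conversely every tuple in the
intersection, D_p included, is conjugate to the same tuple of shifts. -/
theorem range_act_diagTuple (p : Comp n k) :
    Set.range (fun g => act g (diagTuple n p.1)) = kerLocus n p.1 ∩ smallKerLocus n p.1 := by
  refine subset_antisymm ?_ ?_
  · rintro _ ⟨g, rfl⟩
    exact ⟨act_mem_kerLocus g (diagTuple_mem_kerLocus p),
      act_mem_smallKerLocus g (diagTuple_mem_smallKerLocus p)⟩
  · rintro X ⟨h1, h2⟩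
    obtain ⟨g, rfl⟩ := exists_act_shiftTuple p h1 h2
    obtain ⟨g', hg'⟩ := exists_act_shiftTuple p (diagTuple_mem_kerLocus p)
      (diagTuple_mem_smallKerLocus p)
    refine ⟨g * g'⁻¹, ?_⟩
    simp only
    rw [hg', ← act_mul, inv_mul_cancel_right]

/-! ### Flags adapted to a tuple -/

/-- The maps push the a-th member of the flag on U_j down to the a-th member of the flag on U_a,
which is zero. -/
theorem flags_le_kerOf {p : Fin k → ℕ} {F : Flags n p} {X : Tuple n k}
    (h : ∀ (j : Fin k) (a : Fin (k + 1)),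
      (F.F j.succ a).map (Matrix.toLin' (X j)) ≤ F.F j.castSucc a) {a j : ℕ} (haj : a ≤ j)
    (hj : j ≤ k) : F.F ⟨j, by omega⟩ ⟨a, by omega⟩ ≤ kerOf (seg X a j) := by
  induction j, haj using Nat.le_induction with
  | base =>
    have := F.finrank_eq ⟨a, by omega⟩ ⟨a, by omega⟩
    rw [partSum_of_le _ le_rfl, Submodule.finrank_eq_zero] at this
    rw [this]
    exact bot_le
  | succ j haj ih =>
    intro x hx
    rw [mem_kerOf, seg_succ X haj (by omega), ← Matrix.mulVec_mulVec, ← mem_kerOf]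
    exact ih (by omega) (h ⟨j, by omega⟩ ⟨a, by omega⟩ ⟨x, hx, rfl⟩)

theorem projHom_mem_kerLocus {p : Comp n k} (z : incidence p) : projHom p z ∈ kerLocus n p.1 := by
  intro a j haj hj
  have h1 := Submodule.finrank_mono (flags_le_kerOf z.2 haj hj)
  rwa [z.1.1.finrank_eq] at h1

/-- Descending recursion on a, and for each a on j. The a-th space in U_j has to contain the
(a+1)-th one and the image of the a-th space of U_{j+1}, and to lie in ker(X_a ⋯ X_{j-1}). The
hypothesis on `X` makes the kernel large enough; the point is that the sum of the two required
subspaces is small enough. -/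
theorem exists_flags {p : Comp n k} {X : Tuple n k} (hX : X ∈ kerLocus n p.1) :
    ∃ F : Flags n p.1, (F, X) ∈ incidence p := by
  refine (exists_descending (k := k)
    (P := fun a (G : ℕ → Submodule ℂ (Fin n → ℂ)) => ∀ j ≤ k,
      Module.finrank ℂ (G j) = partSum p.1 a j ∧ G j ≤ kerOf (seg X a j) ∧
        ∀ hj : j < k, (G (j + 1)).map (Matrix.toLin' (X ⟨j, hj⟩)) ≤ G j)
    (Q := fun _ H G => ∀ j ≤ k, H j ≤ G j) ?_ ?_).elim fun G ⟨hG, hG'⟩ => ?_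
  rotate_left 2
  · refine ⟨⟨fun j a => G a j, fun j => ?_, fun j a => (hG a (by omega) j (by omega)).1⟩, ?_⟩
    · refine Fin.antitone_iff_succ_le.2 fun a => ?_
      exact hG' a a.2 j (by omega)
    · intro j a
      exact (hG a (by omega) j (by omega)).2.2 j.2
  · refine ⟨fun _ => ⊥, fun j hj => ⟨?_, bot_le, fun _ => by simp⟩⟩
    rw [partSum_of_le _ hj, finrank_bot]
  · intro a ha H hH
    have hHker : ∀ j ≤ k, H j ≤ kerOf (seg X a j) := by
      intro j hj
      by_cases haj : a < j
      · exact (hH j hj).2.1.trans (kerOf_seg_le X (Nat.le_succ a) haj hj)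
      · have := (hH j hj).1
        rw [partSum_of_le _ (by omega), Submodule.finrank_eq_zero] at this
        rw [this]
        exact bot_le
    have hdim : ∀ j ≤ k, partSum p.1 a j ≤ Module.finrank ℂ (kerOf (seg X a j)) := by
      intro j hj
      by_cases haj : a ≤ j
      · exact hX a j haj hj
      · rw [partSum_of_le _ (by omega)]
        exact Nat.zero_le _
    have hle : ∀ j ≤ k, Module.finrank ℂ (H j) ≤ partSum p.1 a j := by
      intro j hj
      rw [(hH j hj).1]
      exact partSum_anti _ (Nat.le_succ a) _
    refine (exists_descending (k := k)
      (P := fun j (E : Submodule ℂ (Fin n → ℂ)) => Module.finrank ℂ E = partSum p.1 a j ∧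
        H j ≤ E ∧ E ≤ kerOf (seg X a j))
      (Q := fun j E' E => ∀ hj : j < k, E'.map (Matrix.toLin' (X ⟨j, hj⟩)) ≤ E) ?_ ?_).elim fun G ⟨hG, hG'⟩ => ?_
    rotate_left 2
    · exact ⟨G, fun j hj => ⟨(hG j hj).1, (hG j hj).2.2, fun hj' => hG' j hj' hj'⟩,
        fun j hj => (hG j hj).2.1⟩
    · obtain ⟨E, h1, h2, h3⟩ := exists_submodule_finrank_eq (hHker k le_rfl) (hle k le_rfl)
        (hdim k le_rfl)
      exact ⟨E, h3, h1, h2⟩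
    · rintro j hj E' ⟨hE', hHE', hE'ker⟩
      suffices hL : H j ⊔ E'.map (Matrix.toLin' (X ⟨j, hj⟩)) ≤ kerOf (seg X a j) ∧
          Module.finrank ℂ ↥(H j ⊔ E'.map (Matrix.toLin' (X ⟨j, hj⟩))) ≤ partSum p.1 a j by
        obtain ⟨E, h1, h2, h3⟩ := exists_submodule_finrank_eq hL.1 hL.2 (hdim j hj.le)
        exact ⟨E, ⟨h3, le_sup_left.trans h1, h2⟩, fun _ => le_sup_right.trans h1⟩
      by_cases haj : a < j
      · constructor
        · refine sup_le (hHker j hj.le) ?_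
          rintro _ ⟨x, hx, rfl⟩
          have := hE'ker hx
          rw [mem_kerOf, seg_succ X haj.le hj, ← Matrix.mulVec_mulVec, ← mem_kerOf] at this
          exact this
        -- `X j` already maps `H (j + 1)` into `H j`, so only a complement of `H (j + 1)` in `E'`
        -- adds to the sum. Its dimension is p_a, exactly the room available.
        · obtain ⟨C, hC⟩ := (H (j + 1)).exists_isCompl
          have hsup : H (j + 1) ⊔ C ⊓ E' = E' := by
            rw [← sup_inf_assoc_of_le C hHE', hC.sup_eq_top, top_inf_eq]
          have hinf : H (j + 1) ⊓ (C ⊓ E') = ⊥ := by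
            rw [← inf_assoc, hC.inf_eq_bot, bot_inf_eq]
          have h1 := Submodule.finrank_sup_add_finrank_inf_eq (H (j + 1)) (C ⊓ E')
          rw [hsup, hinf, finrank_bot, hE', (hH (j + 1) hj).1] at h1
          have h2 : H j ⊔ E'.map (Matrix.toLin' (X ⟨j, hj⟩)) ≤
              H j ⊔ (C ⊓ E').map (Matrix.toLin' (X ⟨j, hj⟩)) := by
            refine sup_le le_sup_left ?_
            conv_lhs => rw [← hsup]
            rw [Submodule.map_sup]
            exact sup_le_sup_right ((hH j hj.le).2.2 hj) _
          have h3 := (Submodule.finrank_mono h2).trans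
            (Submodule.finrank_add_le_finrank_add_finrank _ _)
          have h4 := Submodule.finrank_map_le (Matrix.toLin' (X ⟨j, hj⟩)) (C ⊓ E')
          rw [(hH j hj.le).1] at h3
          rw [partSum_succ _ haj.le hj, partSum_succ (a := a + 1) _ haj hj] at h1
          omega
      -- Here j ≤ a and nothing is added: for j = a the map kills `E'`, and for j < a the space `E'`
      -- is zero.
      · have hbot : E'.map (Matrix.toLin' (X ⟨j, hj⟩)) = ⊥ := by
          rw [Submodule.eq_bot_iff]
          rintro _ ⟨x, hx, rfl⟩
          by_cases hja : j = a
          · subst hja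
            have := hE'ker hx
            rw [seg_single X hj] at this
            exact this
          · rw [partSum_of_le _ (by omega), Submodule.finrank_eq_zero] at hE'
            rw [hE'] at hx
            rw [(Submodule.mem_bot ℂ).1 hx, map_zero]
        rw [hbot, sup_bot_eq]
        exact ⟨hHker j hj.le, hle j hj.le⟩

theorem range_projHom (p : Comp n k) : Set.range (projHom p) = kerLocus n p.1 := by
  refine subset_antisymm ?_ fun X hX => ?_
  · rintro _ ⟨z, rfl⟩
    exact projHom_mem_kerLocus z
  · obtain ⟨F, hF⟩ := exists_flags hX
    exact ⟨⟨(F, X), hF⟩, rfl⟩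

/-! ### The variety of tuples with product zero -/

theorem kerLocus_subset_zeroProduct (p : Comp n k) : kerLocus n p.1 ⊆ zeroProduct n k := by
  intro X hX
  have h := hX 0 k (Nat.zero_le _) le_rfl
  rw [partSum_total] at h
  have : kerOf (seg X 0 k) = ⊤ := by
    refine Submodule.eq_top_of_finrank_eq (le_antisymm (Submodule.finrank_le _) ?_)
    rw [Module.finrank_fin_fun]
    exact h
  rw [mem_zeroProduct]
  exact Matrix.toLin'.injective (by rw [LinearMap.ker_eq_top.1 this, map_zero])

/-- The parts are the jumps of the kernels in U_k of the maps to U_a as a decreases. These kernels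
grow from 0 for the empty product to all of U_k for the full product, so the jumps add up to n. -/
theorem exists_mem_kerLocus {X : Tuple n k} (hX : X ∈ zeroProduct n k) :
    ∃ p : Comp n k, X ∈ kerLocus n p.1 := by
  have hmono : ∀ a, a < k → kdim (seg X (a + 1) k) ≤ kdim (seg X a k) := fun a ha =>
    Submodule.finrank_mono (kerOf_seg_le X (Nat.le_succ a) ha le_rfl)
  let p : Fin k → ℕ := fun a => kdim (seg X a k) - kdim (seg X (a + 1) k)
  have hp : ∀ a j, a ≤ j → j ≤ k → partSum p a j + kdim (seg X j k) = kdim (seg X a k) := by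
    intro a j haj hj
    induction j, haj using Nat.le_induction with
    | base => rw [partSum_of_le _ le_rfl, zero_add]
    | succ j haj ih =>
      have := hmono j hj
      rw [partSum_succ _ haj hj, ← ih (by omega)]
      simp only [p]
      omega
  have h1 : kdim (seg X k k) = 0 := by
    rw [seg_of_le X le_rfl, kdim, kerOf, Matrix.toLin'_one, LinearMap.ker_id, finrank_bot]
  have h0 : kdim (seg X 0 k) = n := by
    rw [mem_zeroProduct.1 hX, kdim, kerOf, map_zero, LinearMap.ker_zero, finrank_top,
      Module.finrank_fin_fun]
  have hsum : ∑ i, p i = n := by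
    have := hp 0 k (Nat.zero_le _) le_rfl
    rw [h0, h1, add_zero, partSum, Finset.filter_true_of_mem (fun i _ => ⟨Nat.zero_le _, i.2⟩)] at this
    exact this
  refine ⟨⟨p, hsum⟩, fun a j haj hj => ?_⟩
  have h := hp a j haj hj
  -- `ker (U_k → U_a) / ker (U_k → U_j)` embeds into `ker (U_j → U_a)`
  let f : kerOf (seg X a k) →ₗ[ℂ] kerOf (seg X a j) :=
    LinearMap.restrict (Matrix.toLin' (seg X j k)) fun x hx => by
      rw [mem_kerOf] at hx ⊢
      rw [Matrix.toLin'_apply, Matrix.mulVec_mulVec, seg_mul_seg X haj hj le_rfl, hx]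
  have h2 := LinearMap.finrank_range_add_finrank_ker f
  have h3 := Submodule.finrank_le (LinearMap.range f)
  have h4 : Module.finrank ℂ (LinearMap.ker f) ≤ kdim (seg X j k) := by
    rw [← Submodule.finrank_map_subtype_eq, kdim]
    refine Submodule.finrank_mono ?_
    rintro _ ⟨x, hx, rfl⟩
    exact congrArg Subtype.val (LinearMap.mem_ker.1 hx)
  change _ ≤ Module.finrank ℂ (kerOf (seg X a j))
  change _ = Module.finrank ℂ (kerOf (seg X a k)) at h
  simp only
  omega

theorem zeroProduct_eq_iUnion : zeroProduct n k = ⋃ p : Comp n k, kerLocus n p.1 := by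
  refine subset_antisymm (fun X hX => ?_) (Set.iUnion_subset kerLocus_subset_zeroProduct)
  obtain ⟨p, hp⟩ := exists_mem_kerLocus hX
  exact Set.mem_iUnion.2 ⟨p, hp⟩

/-- The j-th entry of D_p has kernel of dimension exactly p_j, so membership of D_p gives q ≤ p in
every part; equal sums force equality. -/
theorem eq_of_kerLocus_subset {p q : Comp n k} (h : kerLocus n p.1 ⊆ kerLocus n q.1) : p = q := by
  have hle : ∀ i, q.1 i ≤ p.1 i := by
    intro i
    have h1 := h (diagTuple_mem_kerLocus p) i (i + 1) (Nat.le_succ _) i.2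
    rwa [kdim_seg_diagTuple p (Nat.le_succ _) i.2, partSum_single _ i.2, partSum_single _ i.2] at h1
  have := (Finset.sum_eq_sum_iff_of_le fun i (_ : i ∈ Finset.univ) => hle i).1 (by rw [p.2, q.2])
  exact Subtype.ext (funext fun i => (this i (Finset.mem_univ _)).symm)

end KernelLoci

/-! ### Frames and the parametrization of the incidence correspondence -/

section Frames

variable {n k : ℕ}

theorem colSpan_eq_of_le {g g' : Mat n} (hg : IsUnit g.det) (hg' : IsUnit g'.det) {m : ℕ}
    (hm : m ≤ n) (h : ∀ c : Fin n, c.val < m → g.col c ∈ colSpan g' m) :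
    colSpan g m = colSpan g' m :=
  Submodule.eq_of_le_of_finrank_eq (colSpan_le_iff.2 h)
    (by rw [finrank_colSpan g hg hm, finrank_colSpan g' hg' hm])

theorem colSpan_mono (g : Mat n) {m m' : ℕ} (h : m ≤ m') : colSpan g m ≤ colSpan g m' :=
  colSpan_le_iff.2 fun _ hc => col_mem_colSpan _ (lt_of_lt_of_le hc h)

theorem mulVec_eq_sum_col (g : Mat n) (v : Fin n → ℂ) : g.mulVec v = ∑ c, v c • g.col c := by
  ext r
  simp [Matrix.mulVec, dotProduct, mul_comm]

theorem mulVec_mem_colSpan (g : Mat n) {m : ℕ} {v : Fin n → ℂ} (h : ∀ r : Fin n, m ≤ r.val → v r = 0) :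
    g.mulVec v ∈ colSpan g m := by
  rw [mulVec_eq_sum_col]
  refine sum_mem fun c _ => ?_
  by_cases hc : c.val < m
  · exact Submodule.smul_mem _ _ (col_mem_colSpan _ hc)
  · rw [h c (by omega), zero_smul]
    exact zero_mem _

theorem mem_colSpan_iff {g : Mat n} (hg : IsUnit g.det) {m : ℕ} {v : Fin n → ℂ} :
    v ∈ colSpan g m ↔ ∀ r : Fin n, m ≤ r.val → g⁻¹.mulVec v r = 0 := by
  constructor
  · intro hv r hr
    induction hv using Submodule.span_induction with
    | mem x hx =>
      obtain ⟨c, hc, rfl⟩ := hx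
      rw [← col_mul, Matrix.nonsing_inv_mul g hg]
      simp only [Matrix.col_apply]
      refine Matrix.one_apply_ne fun h => ?_
      have : c.val < m := hc
      rw [← h] at this
      omega
    | zero => simp
    | add x y _ _ hx hy => rw [Matrix.mulVec_add, Pi.add_apply, hx, hy, add_zero]
    | smul a x _ hx => rw [Matrix.mulVec_smul, Pi.smul_apply, hx, smul_zero]
  · intro h
    have := mulVec_mem_colSpan g h
    rwa [Matrix.mulVec_mulVec, Matrix.mul_nonsing_inv g hg, Matrix.one_mulVec] at this

/-- For fixed frames, compatibility with the flags thus becomes a set of linear equations of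
coordinate type. -/
theorem map_colSpan_le_iff {g g' : Mat n} (hg : IsUnit g.det) (A : Mat n) {m m' : ℕ} :
    (colSpan g' m').map (Matrix.toLin' A) ≤ colSpan g m ↔
      ∀ r c : Fin n, c.val < m' → m ≤ r.val → (g⁻¹ * A * g') r c = 0 := by
  rw [Submodule.map_le_iff_le_comap, colSpan_le_iff]
  simp only [Submodule.mem_comap, Matrix.toLin'_apply, mem_colSpan_iff hg, Matrix.mulVec_mulVec]
  simp only [← col_mul, Matrix.col_apply]
  exact ⟨fun h r c hc hr => h c hc r hr, fun h c hc r hr => h r c hc hr⟩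

theorem colSpan_mul (g h : Mat n) (m : ℕ) :
    colSpan (g * h) m = (colSpan h m).map (Matrix.toLin' g) := by
  rw [colSpan, colSpan, Submodule.map_span, ← Set.image_comp]
  rfl

theorem Flags.ext_F {p : Fin k → ℕ} {F F' : Flags n p} (h : ∀ j a, F.F j a = F'.F j a) : F = F' := by
  cases F
  cases F'
  congr
  ext1 j
  ext1 a
  exact h j a

theorem frameMap_surjective (p : Comp n k) : Function.Surjective (frameMap p) := by
  rintro ⟨F, X⟩
  have : ∀ j, ∃ g : Mat n, IsUnit g.det ∧ ∀ a, colSpan g (partSum p.1 a.val j.val) = F.F j a := by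
    intro j
    obtain ⟨g, hg, hgF⟩ := exists_adapted_frame (k := k)
      (fun a => if h : a < k + 1 then F.F j ⟨a, h⟩ else ⊥) (fun a ha => by
        simp only [show a < k + 1 by omega, show a + 1 < k + 1 by omega, dif_pos]
        exact F.anti j (by simp [Fin.le_def]))
    refine ⟨g, hg, fun a => ?_⟩
    have := hgF a (by omega)
    rw [dif_pos a.2, F.finrank_eq] at this
    exact this
  choose g hg hgF using this
  refine ⟨⟨(g, X), hg⟩, Prod.ext (Flags.ext_F fun j a => ?_) rfl⟩
  exact hgF j a

/-- The positions where the matrices in standard form may be nonzero. -/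
abbrev StdIdx (n : ℕ) {k : ℕ} (p : Fin k → ℕ) : Type :=
  {x : Fin k × Fin n × Fin n // ∀ a, x.2.2.val < partSum p a (x.1.val + 1) →
    x.2.1.val < partSum p a x.1.val}

open Classical in
/-- The tuple with given entries at the positions in `StdIdx`, and zeros elsewhere. -/
def stdTuple (n : ℕ) {k : ℕ} (p : Fin k → ℕ) : (StdIdx n p → ℂ) →ₗ[ℂ] Tuple n k where
  toFun y j := Matrix.of fun r c => if h : _ then y ⟨(j, r, c), h⟩ else 0
  map_add' y y' := by
    ext j r c
    simp only [Matrix.of_apply, Pi.add_apply, Matrix.add_apply]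
    split_ifs
    · rfl
    · rw [add_zero]
  map_smul' t y := by
    ext j r c
    simp only [Matrix.of_apply, Pi.smul_apply, Matrix.smul_apply, RingHom.id_apply]
    split_ifs
    · rfl
    · rw [smul_zero]

theorem stdTuple_apply {p : Fin k → ℕ} (y : StdIdx n p → ℂ) (x : StdIdx n p) :
    stdTuple n p y x.1.1 x.1.2.1 x.1.2.2 = y x :=
  dif_pos x.2

theorem stdTuple_eq_zero {p : Fin k → ℕ} (y : StdIdx n p → ℂ) {j : Fin k} {r c : Fin n} {a : ℕ}
    (hc : c.val < partSum p a (j.val + 1)) (hr : partSum p a j.val ≤ r.val) :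
    stdTuple n p y j r c = 0 :=
  dif_neg fun h => (h a hc).not_ge hr

theorem stdTuple_restrict {p : Fin k → ℕ} {Y : Tuple n k}
    (h : ∀ (j : Fin k) (a : ℕ) (r c : Fin n), c.val < partSum p a (j.val + 1) →
      partSum p a j.val ≤ r.val → Y j r c = 0) :
    stdTuple n p (fun x => Y x.1.1 x.1.2.1 x.1.2.2) = Y := by
  ext j r c
  by_cases hx : ∀ a, c.val < partSum p a (j.val + 1) → r.val < partSum p a j.val
  · exact stdTuple_apply _ ⟨(j, r, c), hx⟩
  · push Not at hx
    obtain ⟨a, hc, hr⟩ := hx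
    rw [stdTuple_eq_zero _ hc hr, h j a r c hc hr]

/-- The tuple `X` in the coordinates given by a tuple of frames, up to scalars. -/
def stdForm (g : Fin (k + 1) → Mat n) (X : Tuple n k) : Tuple n k := fun j =>
  (g j.succ).det⁻¹ • ((g j.castSucc)⁻¹ * X j * g j.succ)

/-- The inverse operation of `stdForm`. -/
def unstdForm (g : Fin (k + 1) → Mat n) (Y : Tuple n k) : Tuple n k := fun j =>
  -- The adjugate in place of the inverse keeps the map polynomial in the frames; the factor det⁻¹
  -- in `stdForm` compensates for it.
  g j.castSucc * Y j * (g j.succ).adjugate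

theorem stdForm_unstdForm {g : Fin (k + 1) → Mat n} (hg : ∀ j, IsUnit (g j).det) (Y : Tuple n k) :
    stdForm g (unstdForm g Y) = Y := by
  ext1 j
  have h1 := Matrix.nonsing_inv_mul _ (hg j.castSucc)
  have h2 := Matrix.adjugate_mul (g j.succ)
  calc stdForm g (unstdForm g Y) j = (g j.succ).det⁻¹ •
        (((g j.castSucc)⁻¹ * g j.castSucc) * Y j * ((g j.succ).adjugate * g j.succ)) := by
          simp only [stdForm, unstdForm, mul_assoc]
    _ = Y j := by
      rw [h1, h2, one_mul, Matrix.mul_smul, mul_one, inv_smul_smul₀ (hg _).ne_zero]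

theorem unstdForm_stdForm {g : Fin (k + 1) → Mat n} (hg : ∀ j, IsUnit (g j).det) (X : Tuple n k) :
    unstdForm g (stdForm g X) = X := by
  ext1 j
  have h1 := Matrix.mul_nonsing_inv _ (hg j.castSucc)
  have h2 := Matrix.mul_adjugate (g j.succ)
  calc unstdForm g (stdForm g X) j = (g j.succ).det⁻¹ •
        ((g j.castSucc * (g j.castSucc)⁻¹) * X j * (g j.succ * (g j.succ).adjugate)) := by
          simp only [stdForm, unstdForm, mul_assoc, Matrix.mul_smul, Matrix.smul_mul]
    _ = X j := by
      rw [h1, h2, one_mul, Matrix.mul_smul, mul_one, inv_smul_smul₀ (hg _).ne_zero]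

theorem frameMap_mem_incidence_iff {p : Comp n k} {z : frameSet n k} :
    frameMap p z ∈ incidence p ↔ ∀ (j : Fin k) (a : ℕ) (r c : Fin n),
      c.val < partSum p.1 a (j.val + 1) → partSum p.1 a j.val ≤ r.val →
        stdForm z.1.1 z.1.2 j r c = 0 := by
  have hdet : ∀ (j : Fin k) (r c : Fin n), stdForm z.1.1 z.1.2 j r c = 0 ↔
      ((z.1.1 j.castSucc)⁻¹ * z.1.2 j * z.1.1 j.succ) r c = 0 := by
    intro j r c
    simp only [stdForm, Matrix.smul_apply, smul_eq_mul, mul_eq_zero, inv_eq_zero,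
      (z.2 j.succ).ne_zero, false_or]
  constructor
  · intro h j a r c hc hr
    rw [hdet]
    -- Allowing every natural number a is harmless: beyond the range the partial sum is zero and the
    -- condition is empty.
    have ha : a < k + 1 := by
      by_contra ha
      rw [partSum_of_le _ (by omega)] at hc
      omega
    exact (map_colSpan_le_iff (z.2 _) _).1 (h j ⟨a, ha⟩) r c hc hr
  · intro h j a
    refine (map_colSpan_le_iff (z.2 _) _).2 fun r c hc hr => ?_
    exact (hdet j r c).1 (h j a r c hc hr)

/-- The open set of parameters `(g, y)` where `g` is a tuple of invertible matrices. -/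
abbrev paramSet (n : ℕ) {k : ℕ} (p : Fin k → ℕ) : Set ((Fin (k + 1) → Mat n) × (StdIdx n p → ℂ)) :=
  {z | ∀ j, IsUnit (z.1 j).det}

/-- The parametrization of the frames with a tuple preserving the flags. -/
def paramFrame {p : Fin k → ℕ} (z : (Fin (k + 1) → Mat n) × (StdIdx n p → ℂ)) :
    (Fin (k + 1) → Mat n) × Tuple n k := (z.1, unstdForm z.1 (stdTuple n p z.2))

theorem polyMap_fst {V W : Type} [AddCommGroup V] [Module ℂ V] [AddCommGroup W] [Module ℂ W] :
    PolyMap (Prod.fst : V × W → V) := .linear (LinearMap.fst ℂ V W)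

theorem polyMap_snd {V W : Type} [AddCommGroup V] [Module ℂ V] [AddCommGroup W] [Module ℂ W] :
    PolyMap (Prod.snd : V × W → W) := .linear (LinearMap.snd ℂ V W)

theorem matIn_fst_apply {W : Type} [AddCommGroup W] [Module ℂ W] (j : Fin (k + 1)) :
    MatIn (polyFun ((Fin (k + 1) → Mat n) × W)) fun z => z.1 j :=
  (((matIn_apply j).polyMap).comp polyMap_fst).matIn

theorem polyMap_paramFrame (p : Fin k → ℕ) : PolyMap (paramFrame (n := n) (p := p)) := by
  refine polyMap_fst.prodMk (PolyMap.pi fun j => MatIn.polyMap ?_)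
  refine ((matIn_fst_apply _).mul ?_).mul (matIn_fst_apply _).adjugate
  exact ((matIn_apply j).polyMap.comp ((PolyMap.linear (stdTuple n p)).comp polyMap_snd)).matIn

/-- The parametrization of the incidence correspondence. -/
def paramMap (p : Comp n k) (z : paramSet n p.1) : incidence p :=
  ⟨frameMap p ⟨paramFrame z.1, z.2⟩, frameMap_mem_incidence_iff.2 fun j a r c hc hr => by
    simp only [paramFrame, stdForm_unstdForm z.2]
    exact stdTuple_eq_zero _ hc hr⟩

theorem eq_paramFrame {p : Comp n k} {z : frameSet n k} (hz : frameMap p z ∈ incidence p) :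
    z.1 = paramFrame (p := p.1) (z.1.1, fun x => stdForm z.1.1 z.1.2 x.1.1 x.1.2.1 x.1.2.2) := by
  refine Prod.ext rfl ?_
  simp only [paramFrame]
  rw [stdTuple_restrict (frameMap_mem_incidence_iff.1 hz), unstdForm_stdForm z.2]

theorem paramMap_surjective (p : Comp n k) : Function.Surjective (paramMap p) := by
  rintro ⟨x, hx⟩
  obtain ⟨z, rfl⟩ := frameMap_surjective p x
  refine ⟨⟨(z.1.1, fun x => stdForm z.1.1 z.1.2 x.1.1 x.1.2.1 x.1.2.2), z.2⟩, Subtype.ext ?_⟩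
  exact congrArg (frameMap p) (Subtype.ext (eq_paramFrame hx).symm)

theorem continuous_paramMap (p : Comp n k) :
    @Continuous _ _ ((affine _).restrict (paramSet n p.1)).top (incidenceVariety p).top
      (paramMap p) := by
  let t₁ := zariski ((Fin (k + 1) → Mat n) × (StdIdx n p.1 → ℂ))
  let t₂ := zariski ((Fin (k + 1) → Mat n) × Tuple n k)
  let t₃ : TopologicalSpace (Flags n p.1 × Tuple n k) := (flagHom p).top
  have h1 : @Continuous _ _ _ t₃ (frameMap p) := continuous_coinduced_rng
  have h2 : Continuous fun z : paramSet n p.1 => (⟨paramFrame z.1, z.2⟩ : frameSet n k) :=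
    ((polyMap_paramFrame p.1).continuous.comp continuous_subtype_val).subtype_mk _
  exact (h1.comp h2).subtype_mk _

theorem isOpen_isUnit_det {ι : Type} [Finite ι] {W : Type} [AddCommGroup W] [Module ℂ W] {M : ι → W → Mat n}
    (h : ∀ j, MatIn (polyFun W) (M j)) : IsOpen[zariski W] {z | ∀ j, IsUnit (M j z).det} := by
  have : {z | ∀ j, IsUnit (M j z).det} = ⋂ j, {z | (M j z).det ≠ 0} := by
    ext z
    simp [isUnit_iff_ne_zero]
  rw [this]
  exact @isOpen_iInter_of_finite _ _ (zariski W) _ _ fun j => isOpen_ne_zero (h j).det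

/-- The parameter space is a nonempty open subset of a vector space, and it maps continuously onto
I_p. -/
theorem irreducibleSpace_incidenceVariety (p : Comp n k) :
    @IrreducibleSpace _ (incidenceVariety p).top := by
  let t₁ := zariski ((Fin (k + 1) → Mat n) × (StdIdx n p.1 → ℂ))
  let t₃ := (incidenceVariety p).top
  have h1 : IsIrreducible (paramSet n p.1) :=
    isIrreducible_of_isOpen (isOpen_isUnit_det fun j => matIn_fst_apply j) ⟨(fun _ => 1, 0), by simp⟩
  have := isIrreducible_iff_irreducibleSpace.1 h1
  have h2 := (IrreducibleSpace.isIrreducible_univ (paramSet n p.1)).image _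
    (continuous_paramMap p).continuousOn
  rw [Set.image_univ, (paramMap_surjective p).range_eq] at h2
  have h3 : PreirreducibleSpace (incidence p) := ⟨h2.isPreirreducible⟩
  exact ⟨h2.nonempty.to_type⟩

theorem continuous_projHom (p : Comp n k) :
    @Continuous _ _ (incidenceVariety p).top (zariski (Tuple n k)) (projHom p) := by
  let t₁ := zariski (Tuple n k)
  let t₂ := zariski ((Fin (k + 1) → Mat n) × Tuple n k)
  let t₃ : TopologicalSpace (Flags n p.1 × Tuple n k) := (flagHom p).top
  have h1 : @Continuous _ _ t₃ t₁ Prod.snd := by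
    refine continuous_coinduced_dom.2 ?_
    have h0 := (polyMap_snd (V := Fin (k + 1) → Mat n) (W := Tuple n k)).continuous
    exact h0.comp (continuous_subtype_val (p := (· ∈ frameSet n k)))
  exact h1.comp continuous_subtype_val

theorem isIrreducible_kerLocus (p : Comp n k) :
    @IsIrreducible _ (zariski (Tuple n k)) (kerLocus n p.1) := by
  let t₁ := zariski (Tuple n k)
  let t₃ := (incidenceVariety p).top
  have := irreducibleSpace_incidenceVariety p
  rw [← range_projHom, ← Set.image_univ]
  exact (IrreducibleSpace.isIrreducible_univ _).image _ (continuous_projHom p).continuousOn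

/-- The orbit is a nonempty open subset of the irreducible closed set `kerLocus`, hence dense in it.
-/
theorem compVariety_eq_kerLocus (p : Comp n k) : compVariety n p.1 = kerLocus n p.1 := by
  let t₁ := zariski (Tuple n k)
  rw [compVariety, range_act_diagTuple]
  refine subset_antisymm ?_ ?_
  · exact @closure_minimal _ (zariski _) _ _ Set.inter_subset_left (isClosed_kerLocus p.1)
  · exact @subset_closure_inter_of_isPreirreducible_of_isOpen _ (zariski _) _ _
      (isIrreducible_kerLocus p).isPreirreducible (isOpen_smallKerLocus p.1)
      ⟨_, diagTuple_mem_kerLocus p, diagTuple_mem_smallKerLocus p⟩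

end Frames

/-! ### Charts of the incidence correspondence -/

section Cells

variable {n k : ℕ}

/-- The first `m` columns of `g`, followed by columns of the identity matrix. -/
def headCols (g : Mat n) (m : ℕ) : Mat n :=
  Matrix.of fun r c => if c.val < m then g r c else (1 : Mat n) r c

theorem headCols_col_of_lt (g : Mat n) {m : ℕ} {c : Fin n} (h : c.val < m) :
    (headCols g m).col c = g.col c := by
  ext r
  simp [headCols, h]

theorem headCols_col_of_le (g : Mat n) {m : ℕ} {c : Fin n} (h : m ≤ c.val) :
    (headCols g m).col c = Pi.single c 1 := by
  ext r
  simp [headCols, h, Matrix.one_apply, Pi.single_apply]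

/-- The vector of the span of the first `m` columns of `g` with first `m` coordinates those of the
`c`-th unit vector. -/
def cellVec (g : Mat n) (m : ℕ) (c : Fin n) : Fin n → ℂ := fun r =>
  if m ≤ r.val then - (headCols g m)⁻¹ r c else (1 : Mat n) r c

theorem headCols_mulVec_of_lt (g : Mat n) {m : ℕ} {x : Fin n → ℂ} (h : ∀ r : Fin n, m ≤ r.val → x r = 0) :
    (headCols g m).mulVec x = g.mulVec x := by
  rw [mulVec_eq_sum_col, mulVec_eq_sum_col]
  refine Finset.sum_congr rfl fun c _ => ?_
  by_cases hc : c.val < m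
  · rw [headCols_col_of_lt g hc]
  · rw [h c (by omega), zero_smul, zero_smul]

theorem headCols_mulVec_of_le (g : Mat n) {m : ℕ} {x : Fin n → ℂ} (h : ∀ r : Fin n, r.val < m → x r = 0) :
    (headCols g m).mulVec x = x := by
  rw [mulVec_eq_sum_col]
  conv_rhs => rw [pi_eq_sum_univ' x]
  refine Finset.sum_congr rfl fun c _ => ?_
  by_cases hc : c.val < m
  · rw [h c hc, zero_smul, zero_smul]
  · rw [headCols_col_of_le g (by omega)]

/-- Let y be the c-th column of the inverse of `headCols g m`, cut at m into a head y₁ and a tail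
y₂. Since `headCols g m` acts as `g` on y₁ and as the identity on y₂, e_c = g y₁ + y₂. So e_c - y₂ =
g y₁ lies in the span, and its entries are those of `cellVec`. -/
theorem cellVec_mem {g : Mat n} {m : ℕ} (hG : IsUnit (headCols g m).det) {c : Fin n} (hc : c.val < m) :
    cellVec g m c ∈ colSpan g m := by
  let y : Fin n → ℂ := (headCols g m)⁻¹.col c
  let y₁ : Fin n → ℂ := fun r => if m ≤ r.val then 0 else y r
  let y₂ : Fin n → ℂ := fun r => if m ≤ r.val then y r else 0
  have hy : y = y₁ + y₂ := by
    ext r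
    simp only [y₁, y₂, Pi.add_apply]
    split_ifs <;> simp
  have h1 : (headCols g m).mulVec y = Pi.single c 1 := by
    rw [← col_mul, Matrix.mul_nonsing_inv _ hG]
    ext r
    simp [Matrix.one_apply, Pi.single_apply]
  have hy₁ : ∀ r : Fin n, m ≤ r.val → y₁ r = 0 := fun r hr => if_pos hr
  have hy₂ : ∀ r : Fin n, r.val < m → y₂ r = 0 := fun r hr => if_neg (by omega)
  rw [hy, Matrix.mulVec_add, headCols_mulVec_of_lt g hy₁, headCols_mulVec_of_le g hy₂] at h1
  have h2 : cellVec g m c = g.mulVec y₁ := by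
    rw [eq_sub_of_add_eq h1]
    ext r
    simp only [cellVec, y₂, Pi.sub_apply, Pi.single_apply, Matrix.one_apply]
    split_ifs with h3 h4 h4
    · rw [h4] at h3; omega
    · simp [y]
    · simp
    · simp
  rw [h2]
  exact mulVec_mem_colSpan g hy₁

/-- The difference x of two such vectors vanishes in the first m rows, and g⁻¹x in the others. Then
`headCols g m` sends both x and g⁻¹x to x, so x = g⁻¹x, which vanishes in all rows. -/
theorem eq_cellVec {g : Mat n} (hg : IsUnit g.det) {m : ℕ} (hG : IsUnit (headCols g m).det) {c : Fin n}
    {w : Fin n → ℂ} (hw : w ∈ colSpan g m)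
    (h : ∀ r : Fin n, r.val < m → w r = (1 : Mat n) r c) (hc : c.val < m) : w = cellVec g m c := by
  rw [← sub_eq_zero]
  have h1 := sub_mem hw (cellVec_mem hG hc)
  set x := w - cellVec g m c
  have h2 : ∀ r : Fin n, r.val < m → x r = 0 := by
    intro r hr
    simp only [x, Pi.sub_apply, h r hr, cellVec, if_neg (not_le.2 hr), sub_self]
  have h3 := (mem_colSpan_iff hg).1 h1
  have h4 : (headCols g m).mulVec (g⁻¹.mulVec x) = (headCols g m).mulVec x := by
    rw [headCols_mulVec_of_lt g h3, headCols_mulVec_of_le g h2, Matrix.mulVec_mulVec,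
      Matrix.mul_nonsing_inv g hg, Matrix.one_mulVec]
  have h5 := Matrix.mulVec_injective_iff_isUnit.2 ((Matrix.isUnit_iff_isUnit_det _).2 hG) h4
  ext r
  by_cases hr : r.val < m
  · exact h2 r hr
  · rw [← h5]
    exact h3 r (by omega)

/-- It shows that invertibility of `headCols` depends only on the span, so that the big cell is a
condition on flags and not on frames. -/
theorem headCols_of_colSpan_eq {g g' : Mat n} (hg : IsUnit g.det) {m : ℕ}
    (h : colSpan g m = colSpan g' m) : headCols g' m = headCols g m * headCols (g⁻¹ * g') m := by
  refine Matrix.ext_col fun c => ?_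
  rw [col_mul]
  by_cases hc : c.val < m
  · rw [headCols_col_of_lt _ hc, headCols_col_of_lt _ hc, headCols_mulVec_of_lt, col_mul,
      Matrix.mulVec_mulVec, Matrix.mul_nonsing_inv g hg, Matrix.one_mulVec]
    rw [col_mul, ← mem_colSpan_iff hg, h]
    exact col_mem_colSpan _ hc
  · rw [headCols_col_of_le _ (by omega), headCols_col_of_le _ (by omega), headCols_mulVec_of_le]
    intro r hr
    refine Pi.single_eq_of_ne (fun h => ?_) _
    rw [h] at hr
    omega

theorem isUnit_det_headCols {g g' : Mat n} (hg : IsUnit g.det) {m : ℕ}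
    (h : colSpan g m = colSpan g' m) (hG : IsUnit (headCols g' m).det) :
    IsUnit (headCols g m).det := by
  rw [headCols_of_colSpan_eq hg h, Matrix.det_mul] at hG
  exact isUnit_of_mul_isUnit_left hG

theorem cellVec_congr {g g' : Mat n} (hg' : IsUnit g'.det) {m : ℕ}
    (h : colSpan g m = colSpan g' m) (hG : IsUnit (headCols g m).det) {c : Fin n} (hc : c.val < m) :
    cellVec g m c = cellVec g' m c := by
  refine eq_cellVec hg' (isUnit_det_headCols hg' h.symm hG) (h ▸ cellVec_mem hG hc) (fun r hr => ?_) hc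
  rw [cellVec, if_neg (by omega)]

/-- The smallest of the numbers `n` and `p_a + ⋯ + p_{j-1}` that is greater than `c`. -/
def cut (n : ℕ) {k : ℕ} (p : Fin k → ℕ) (j c : ℕ) : ℕ :=
  sInf {m | c < m ∧ (m = n ∨ ∃ a, m = partSum p a j)}

theorem cut_spec (p : Fin k → ℕ) (j : ℕ) {c : ℕ} (hc : c < n) :
    c < cut n p j c ∧ (cut n p j c = n ∨ ∃ a, cut n p j c = partSum p a j) :=
  Nat.sInf_mem (s := {m | c < m ∧ (m = n ∨ ∃ a, m = partSum p a j)}) ⟨n, hc, .inl rfl⟩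

theorem lt_cut (p : Fin k → ℕ) (j : ℕ) {c : ℕ} (hc : c < n) : c < cut n p j c := (cut_spec p j hc).1

theorem cut_le_partSum (p : Fin k → ℕ) {j c a : ℕ} (hc : c < partSum p a j) :
    cut n p j c ≤ partSum p a j :=
  Nat.sInf_le ⟨hc, .inr ⟨a, rfl⟩⟩

theorem cut_le (p : Fin k → ℕ) (j : ℕ) {c : ℕ} (hc : c < n) : cut n p j c ≤ n :=
  Nat.sInf_le ⟨hc, .inl rfl⟩

/-- The positions of the free entries of the unipotent matrices in the big cells. -/
abbrev CellIdx (n : ℕ) {k : ℕ} (p : Fin k → ℕ) : Type :=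
  {x : Fin (k + 1) × Fin n × Fin n // cut n p x.1.val x.2.2.val ≤ x.2.1.val}

/-- The unipotent matrices in the big cell. -/
def cellMat {p : Fin k → ℕ} (ν : CellIdx n p → ℂ) (j : Fin (k + 1)) : Mat n :=
  Matrix.of fun r c => if h : cut n p j.val c.val ≤ r.val then ν ⟨(j, r, c), h⟩ else (1 : Mat n) r c

theorem cellMat_apply {p : Fin k → ℕ} (ν : CellIdx n p → ℂ) (x : CellIdx n p) :
    cellMat ν x.1.1 x.1.2.1 x.1.2.2 = ν x := dif_pos x.2

theorem cellMat_of_lt {p : Fin k → ℕ} (ν : CellIdx n p → ℂ) {j : Fin (k + 1)} {r c : Fin n}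
    (h : r.val < cut n p j.val c.val) : cellMat ν j r c = (1 : Mat n) r c :=
  dif_neg (not_le.2 h)

theorem det_eq_one_of_unitriangular {M : Mat n} (h : ∀ r c : Fin n, r ≤ c → M r c = (1 : Mat n) r c) :
    M.det = 1 := by
  rw [Matrix.det_of_isLowerTriangular M fun r c hrc => ?_]
  · exact Finset.prod_eq_one fun i _ => by rw [h i i le_rfl, Matrix.one_apply_eq]
  · have hrc' : r < c := hrc
    rw [h r c hrc'.le, Matrix.one_apply_ne hrc'.ne]

theorem cellMat_of_le {p : Fin k → ℕ} (ν : CellIdx n p → ℂ) (j : Fin (k + 1)) {r c : Fin n}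
    (h : r ≤ c) : cellMat ν j r c = (1 : Mat n) r c :=
  cellMat_of_lt ν (lt_of_le_of_lt h (lt_cut p j c.2))

theorem det_cellMat {p : Fin k → ℕ} (ν : CellIdx n p → ℂ) (j : Fin (k + 1)) : (cellMat ν j).det = 1 :=
  det_eq_one_of_unitriangular fun _ _ => cellMat_of_le ν j

theorem det_headCols_cellMat {p : Fin k → ℕ} (ν : CellIdx n p → ℂ) (j : Fin (k + 1)) (m : ℕ) :
    (headCols (cellMat ν j) m).det = 1 := by
  refine det_eq_one_of_unitriangular fun r c h => ?_
  simp only [headCols, Matrix.of_apply]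
  split_ifs
  · exact cellMat_of_le ν j h
  · rfl

theorem cellVec_cellMat {p : Fin k → ℕ} (ν : CellIdx n p → ℂ) (j : Fin (k + 1)) (c : Fin n) :
    cellVec (cellMat ν j) (cut n p j.val c.val) c = (cellMat ν j).col c :=
  (eq_cellVec (g := cellMat ν j) (by simp [det_cellMat]) (by simp [det_headCols_cellMat])
    (col_mem_colSpan _ (lt_cut p j c.2)) (fun r hr => cellMat_of_lt (r := r) ν hr) (lt_cut p j c.2)).symm

/-- The coordinates of a tuple of frames in the big cell. -/
def cellCoord (p : Fin k → ℕ) (g : Fin (k + 1) → Mat n) : CellIdx n p → ℂ := fun x =>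
  - (headCols (g x.1.1) (cut n p x.1.1.val x.1.2.2.val))⁻¹ x.1.2.1 x.1.2.2

theorem cellMat_cellCoord_col (p : Fin k → ℕ) (g : Fin (k + 1) → Mat n) (j : Fin (k + 1)) (c : Fin n) :
    (cellMat (cellCoord p g) j).col c = cellVec (g j) (cut n p j.val c.val) c := by
  ext r
  simp only [Matrix.col_apply, cellVec]
  split_ifs with h
  · exact cellMat_apply (cellCoord p g) ⟨(j, r, c), h⟩
  · exact cellMat_of_lt _ (not_le.1 h)

theorem cellCoord_eq_of_col {p : Fin k → ℕ} {g : Fin (k + 1) → Mat n} {ν : CellIdx n p → ℂ}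
    (h : ∀ j (c : Fin n), cellVec (g j) (cut n p j.val c.val) c = (cellMat ν j).col c) :
    cellCoord p g = ν := by
  ext x
  rw [← cellMat_apply (cellCoord p g) x, ← cellMat_apply ν x]
  have := congrFun (h x.1.1 x.1.2.2) x.1.2.1
  rw [← cellMat_cellCoord_col] at this
  exact this

theorem cellCoord_cellMat {p : Fin k → ℕ} (ν : CellIdx n p → ℂ) : cellCoord p (cellMat ν) = ν :=
  cellCoord_eq_of_col fun j c => cellVec_cellMat ν j c

/-- The condition that a tuple of frames lies in the big cell. -/
def InCell (p : Fin k → ℕ) (g : Fin (k + 1) → Mat n) : Prop :=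
  ∀ (j : Fin (k + 1)) (c : Fin n), IsUnit (headCols (g j) (cut n p j.val c.val)).det

/-- A cut is either n, where the span is the whole space, or the dimension of a member of the flag.
-/
theorem colSpan_cut_eq {p : Comp n k} {g g' : Fin (k + 1) → Mat n} (hg : ∀ j, IsUnit (g j).det)
    (hg' : ∀ j, IsUnit (g' j).det) (h : ∀ (j : Fin (k + 1)) (a : Fin (k + 1)),
      colSpan (g j) (partSum p.1 a.val j.val) = colSpan (g' j) (partSum p.1 a.val j.val))
    (j : Fin (k + 1)) (c : Fin n) : colSpan (g j) (cut n p.1 j.val c.val) =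
      colSpan (g' j) (cut n p.1 j.val c.val) := by
  rcases cut_spec p.1 j.val c.2 with ⟨hlt, h1 | ⟨a, h1⟩⟩
  · rw [h1]
    have : ∀ (g : Mat n), IsUnit g.det → colSpan g n = ⊤ := fun g hg =>
      Submodule.eq_top_of_finrank_eq (by rw [finrank_colSpan g hg le_rfl, Module.finrank_fin_fun])
    rw [this _ (hg j), this _ (hg' j)]
  · rw [h1]
    by_cases ha : a < k + 1
    · exact h j ⟨a, ha⟩
    · rw [partSum_of_le _ (by omega)] at h1
      omega

theorem InCell.congr {p : Comp n k} {g g' : Fin (k + 1) → Mat n} (hg : ∀ j, IsUnit (g j).det)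
    (hg' : ∀ j, IsUnit (g' j).det) (h : ∀ (j : Fin (k + 1)) (a : Fin (k + 1)),
      colSpan (g j) (partSum p.1 a.val j.val) = colSpan (g' j) (partSum p.1 a.val j.val))
    (hc : InCell p.1 g) : InCell p.1 g' ∧ cellCoord p.1 g' = cellCoord p.1 g := by
  refine ⟨fun j c => isUnit_det_headCols (hg' j) (colSpan_cut_eq hg hg' h j c).symm (hc j c),
    cellCoord_eq_of_col fun j c => ?_⟩
  rw [cellMat_cellCoord_col]
  exact (cellVec_congr (hg' j) (colSpan_cut_eq hg hg' h j c) (hc j c) (lt_cut p.1 j c.2)).symm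

theorem InCell.colSpan_eq {p : Comp n k} {g : Fin (k + 1) → Mat n} (hg : ∀ j, IsUnit (g j).det)
    (hc : InCell p.1 g) (j a : Fin (k + 1)) :
    colSpan (cellMat (cellCoord p.1 g) j) (partSum p.1 a.val j.val) =
      colSpan (g j) (partSum p.1 a.val j.val) := by
  refine colSpan_eq_of_le (by simp [det_cellMat]) (hg j) (partSum_le p _ _) fun c hc' => ?_
  rw [cellMat_cellCoord_col]
  exact colSpan_mono _ (cut_le_partSum _ hc') (cellVec_mem (hc j c) (lt_cut p.1 j c.2))

end Cells

/-! ### Charts of I_p: translated big cells times standard tuples -/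

section Charts

variable {n k : ℕ}

/-- The coordinate space of the charts of the incidence correspondence. -/
abbrev ChartCoords (n : ℕ) {k : ℕ} (p : Fin k → ℕ) : Type :=
  (CellIdx n p → ℂ) × (StdIdx n p → ℂ)

/-- The translate by `g₀` of a point in the big cell. -/
def cellFrame {p : Fin k → ℕ} (g₀ : Fin (k + 1) → Mat n) (ν : CellIdx n p → ℂ) :
    Fin (k + 1) → Mat n := fun j => g₀ j * cellMat ν j

theorem det_cellFrame {p : Fin k → ℕ} (g₀ : Fin (k + 1) → Mat n) (ν : CellIdx n p → ℂ)
    (j : Fin (k + 1)) : (cellFrame g₀ ν j).det = (g₀ j).det := by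
  rw [cellFrame, Matrix.det_mul, det_cellMat, mul_one]

theorem isUnit_det_cellFrame {p : Fin k → ℕ} {g₀ : Fin (k + 1) → Mat n}
    (hg₀ : ∀ j, IsUnit (g₀ j).det) (ν : CellIdx n p → ℂ) (j : Fin (k + 1)) :
    IsUnit (cellFrame g₀ ν j).det := by
  rw [det_cellFrame]
  exact hg₀ j

/-- The charts of the incidence correspondence. -/
def chart (p : Comp n k) (g₀ : Fin (k + 1) → Mat n) (hg₀ : ∀ j, IsUnit (g₀ j).det)
    (t : ChartCoords n p.1) : incidence p :=
  paramMap p ⟨(cellFrame g₀ t.1, t.2), isUnit_det_cellFrame hg₀ t.1⟩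

/-- The coordinates of a point in the domain of a chart. -/
def chartCoord (p : Fin k → ℕ) (g₀ : Fin (k + 1) → Mat n)
    (z : (Fin (k + 1) → Mat n) × Tuple n k) : ChartCoords n p :=
  (cellCoord p fun j => (g₀ j)⁻¹ * z.1 j,
    fun x => stdForm (cellFrame g₀ (cellCoord p fun j => (g₀ j)⁻¹ * z.1 j)) z.2
      x.1.1 x.1.2.1 x.1.2.2)

/-- The function whose nonvanishing locus is the domain of a chart. -/
def chartDenom (p : Fin k → ℕ) (g₀ : Fin (k + 1) → Mat n)
    (z : (Fin (k + 1) → Mat n) × Tuple n k) : ℂ :=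
  ∏ i : Fin (k + 1) × Fin n, (headCols ((g₀ i.1)⁻¹ * z.1 i.1) (cut n p i.1.val i.2.val)).det

theorem chartDenom_ne_zero_iff {p : Fin k → ℕ} {g₀ : Fin (k + 1) → Mat n}
    {z : (Fin (k + 1) → Mat n) × Tuple n k} :
    chartDenom p g₀ z ≠ 0 ↔ InCell p fun j => (g₀ j)⁻¹ * z.1 j := by
  simp only [chartDenom, Finset.prod_ne_zero_iff, InCell, isUnit_iff_ne_zero, Finset.mem_univ,
    true_imp_iff, Prod.forall]

section Regular

variable {V : Type} [AddCommGroup V] [Module ℂ V] {A : Subalgebra ℂ (V → ℂ)}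

theorem MatIn.headCols {M : V → Mat n} (h : MatIn A M) (m : ℕ) :
    MatIn A fun v => headCols (M v) m := by
  intro r c
  by_cases hc : c.val < m
  · simpa [IterMatMul.headCols, hc] using h r c
  · simpa [IterMatMul.headCols, hc] using MatIn.const (A := A) (1 : Mat n) r c

theorem MatIn.cellMat {p : Fin k → ℕ} {ν : V → CellIdx n p → ℂ} (h : ∀ x, (fun v => ν v x) ∈ A)
    (j : Fin (k + 1)) : MatIn A fun v => cellMat (ν v) j := by
  intro r c
  by_cases hc : cut n p j.val c.val ≤ r.val
  · simpa [IterMatMul.cellMat, hc] using h ⟨(j, r, c), hc⟩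
  · simpa [IterMatMul.cellMat, hc] using MatIn.const (A := A) (1 : Mat n) r c

/-- With constant determinant, the inverse is a constant multiple of the adjugate. This applies to
the frames of a translated cell, whose normalized part has determinant 1. -/
theorem MatIn.inv_of_det_eq {M : V → Mat n} (h : MatIn A M) {t : ℂ} (ht : ∀ v, (M v).det = t) :
    MatIn A fun v => (M v)⁻¹ := by
  simp only [Matrix.inv_def, Ring.inverse_eq_inv', ht]
  exact MatIn.smul (f := fun _ => t⁻¹) (A.algebraMap_mem _) h.adjugate

theorem MatIn.inv_mem_locFun {M : V → Mat n} (hM : MatIn (polyFun V) M) {f : V → ℂ}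
    (hf : f ∈ polyFun V) {h : polyFun V} (hh : ∀ v, h.1 v = (M v).det * f v) :
    MatIn (locFun h) fun v => (M v)⁻¹ := by
  simp only [Matrix.inv_def, Ring.inverse_eq_inv']
  exact MatIn.smul (f := fun v => (M v).det⁻¹) (IterMatMul.inv_mem_locFun hf h hh)
    (hM.adjugate.mono (polyFun_le_locFun h))

theorem MatIn.stdForm_cellFrame {p : Fin k → ℕ} {ν : V → CellIdx n p → ℂ}
    (h : ∀ x, (fun v => ν v x) ∈ A) {X : V → Tuple n k} (hX : ∀ j, MatIn A fun v => X v j)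
    (g₀ : Fin (k + 1) → Mat n) (j : Fin k) :
    MatIn A fun v => stdForm (cellFrame g₀ (ν v)) (X v) j := by
  have hF : ∀ j, MatIn A fun v => cellFrame g₀ (ν v) j := fun j =>
    (MatIn.const _).mul (MatIn.cellMat h j)
  have hF' := (hF j.castSucc).inv_of_det_eq fun v => det_cellFrame g₀ (ν v) j.castSucc
  simp only [stdForm, det_cellFrame]
  exact MatIn.smul (f := fun _ => (g₀ j.succ).det⁻¹) (A.algebraMap_mem _)
    ((hF'.mul (hX j)).mul (hF j.succ))

end Regular

theorem chartDenom_mem (p : Fin k → ℕ) (g₀ : Fin (k + 1) → Mat n) :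
    chartDenom p g₀ ∈ polyFun ((Fin (k + 1) → Mat n) × Tuple n k) := by
  have : chartDenom p g₀ = ∏ i : Fin (k + 1) × Fin n,
      fun z : (Fin (k + 1) → Mat n) × Tuple n k =>
        (headCols ((g₀ i.1)⁻¹ * z.1 i.1) (cut n p i.1.val i.2.val)).det := by
    ext z
    simp [chartDenom]
  rw [this]
  exact prod_mem fun i _ => (((MatIn.const _).mul (matIn_fst_apply i.1)).headCols _).det

theorem cellCoord_mem_locFun (p : Fin k → ℕ) (g₀ : Fin (k + 1) → Mat n) (x : CellIdx n p) :
    (fun z : (Fin (k + 1) → Mat n) × Tuple n k => cellCoord p (fun j => (g₀ j)⁻¹ * z.1 j) x) ∈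
      locFun ⟨chartDenom p g₀, chartDenom_mem p g₀⟩ := by
  have hM : ∀ i : Fin (k + 1) × Fin n, MatIn (polyFun ((Fin (k + 1) → Mat n) × Tuple n k))
      fun z => headCols ((g₀ i.1)⁻¹ * z.1 i.1) (cut n p i.1.val i.2.val) :=
    fun i => ((MatIn.const _).mul (matIn_fst_apply i.1)).headCols _
  -- The denominator of the chart is one determinant times this product of the others, so inverting
  -- the denominator inverts each determinant.
  have hprod : (∏ i ∈ Finset.univ.erase (x.1.1, x.1.2.2),
      fun z : (Fin (k + 1) → Mat n) × Tuple n k =>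
        (headCols ((g₀ i.1)⁻¹ * z.1 i.1) (cut n p i.1.val i.2.val)).det) ∈
      polyFun ((Fin (k + 1) → Mat n) × Tuple n k) := prod_mem fun i _ => (hM i).det
  refine neg_mem ((hM (x.1.1, x.1.2.2)).inv_mem_locFun hprod (fun z => ?_) x.1.2.1 x.1.2.2)
  simp only [chartDenom, Finset.prod_apply]
  exact (Finset.mul_prod_erase Finset.univ (fun i : Fin (k + 1) × Fin n =>
    (headCols ((g₀ i.1)⁻¹ * z.1 i.1) (cut n p i.1.val i.2.val)).det)
    (Finset.mem_univ (x.1.1, x.1.2.2))).symm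

theorem dual_chartCoord_mem_locFun (p : Fin k → ℕ) (g₀ : Fin (k + 1) → Mat n)
    (φ : Module.Dual ℂ (ChartCoords n p)) :
    (fun z => φ (chartCoord p g₀ z)) ∈ locFun ⟨chartDenom p g₀, chartDenom_mem p g₀⟩ := by
  have hsplit : (fun z => φ (chartCoord p g₀ z)) =
      (fun z => φ.comp (LinearMap.inl ℂ _ _) (chartCoord p g₀ z).1) +
        fun z => φ.comp (LinearMap.inr ℂ _ _) (chartCoord p g₀ z).2 := by
    ext z
    simp [← map_add]
  rw [hsplit]
  refine add_mem ?_ ?_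
  · exact dual_pi_mem (fun x => dual_scalar_mem (cellCoord_mem_locFun p g₀ x)) _
  · refine dual_pi_mem (fun x => dual_scalar_mem ?_) _
    have hX : ∀ j, MatIn (polyFun ((Fin (k + 1) → Mat n) × Tuple n k)) fun z => z.2 j := fun j =>
      ((matIn_apply j).polyMap.comp polyMap_snd).matIn
    exact MatIn.stdForm_cellFrame (cellCoord_mem_locFun p g₀)
      (fun j => (hX j).mono (polyFun_le_locFun _)) g₀ x.1.1 x.1.2.1 x.1.2.2

/-- The domain and the coordinates of a chart are constant on the fibres of `frameMap`, so they
descend to the quotient. -/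
theorem chartCoord_congr {p : Comp n k} {g₀ : Fin (k + 1) → Mat n} (hg₀ : ∀ j, IsUnit (g₀ j).det)
    {z z' : frameSet n k} (h : frameMap p z = frameMap p z') (hz : chartDenom p.1 g₀ z.1 ≠ 0) :
    chartDenom p.1 g₀ z'.1 ≠ 0 ∧ chartCoord p.1 g₀ z'.1 = chartCoord p.1 g₀ z.1 := by
  have hdet : ∀ (z : frameSet n k) j, IsUnit ((g₀ j)⁻¹ * z.1.1 j).det := by
    intro z j
    rw [Matrix.det_mul]
    exact (Matrix.isUnit_nonsing_inv_det _ (hg₀ j)).mul (z.2 j)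
  have hF : ∀ j a : Fin (k + 1), colSpan ((g₀ j)⁻¹ * z.1.1 j) (partSum p.1 a.val j.val) =
      colSpan ((g₀ j)⁻¹ * z'.1.1 j) (partSum p.1 a.val j.val) := by
    intro j a
    rw [colSpan_mul, colSpan_mul]
    exact congrArg (fun w : Flags n p.1 × Tuple n k =>
      Submodule.map (Matrix.toLin' (g₀ j)⁻¹) (w.1.F j a)) h
  have hX : z.1.2 = z'.1.2 := congrArg (fun w : Flags n p.1 × Tuple n k => w.2) h
  rw [chartDenom_ne_zero_iff] at hz ⊢
  obtain ⟨h1, h2⟩ := hz.congr (hdet z) (hdet z') hF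
  refine ⟨h1, ?_⟩
  simp only [chartCoord, h2, hX]

theorem chart_chartCoord {p : Comp n k} {g₀ : Fin (k + 1) → Mat n} (hg₀ : ∀ j, IsUnit (g₀ j).det)
    {z : frameSet n k} (hz : frameMap p z ∈ incidence p) (hz' : chartDenom p.1 g₀ z.1 ≠ 0) :
    (chart p g₀ hg₀ (chartCoord p.1 g₀ z.1)).1 = frameMap p z := by
  have hdet : ∀ j, IsUnit ((g₀ j)⁻¹ * z.1.1 j).det := by
    intro j
    rw [Matrix.det_mul]
    exact (Matrix.isUnit_nonsing_inv_det _ (hg₀ j)).mul (z.2 j)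
  rw [chartDenom_ne_zero_iff] at hz'
  set u := cellFrame g₀ (chartCoord p.1 g₀ z.1).1 with hu
  have hudet : ∀ j, IsUnit (u j).det := isUnit_det_cellFrame hg₀ _
  -- replace the frame by the one in the big cell
  have hcol : ∀ j a : Fin (k + 1), colSpan (u j) (partSum p.1 a.val j.val) =
      colSpan (z.1.1 j) (partSum p.1 a.val j.val) := by
    intro j a
    have h1 := hz'.colSpan_eq hdet j a
    simp only [hu, chartCoord, cellFrame]
    rw [colSpan_mul, h1, ← colSpan_mul, ← mul_assoc, Matrix.mul_nonsing_inv _ (hg₀ j), one_mul]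
  have hfr : frameMap p (⟨(u, z.1.2), hudet⟩ : frameSet n k) = frameMap p z :=
    Prod.ext (Flags.ext_F hcol) rfl
  rw [← hfr] at hz ⊢
  exact congrArg (frameMap p) (Subtype.ext (eq_paramFrame hz).symm)

theorem chartCoord_paramFrame {p : Comp n k} {g₀ : Fin (k + 1) → Mat n}
    (hg₀ : ∀ j, IsUnit (g₀ j).det) (t : ChartCoords n p.1) :
    chartDenom p.1 g₀ (paramFrame (cellFrame g₀ t.1, t.2)) ≠ 0 ∧
      chartCoord p.1 g₀ (paramFrame (cellFrame g₀ t.1, t.2)) = t := by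
  have hinv : (fun j => (g₀ j)⁻¹ * cellFrame g₀ t.1 j) = cellMat t.1 := by
    ext1 j
    rw [cellFrame, ← mul_assoc, Matrix.nonsing_inv_mul _ (hg₀ j), one_mul]
  constructor
  · rw [chartDenom_ne_zero_iff]
    simp only [paramFrame, hinv]
    intro j c
    simp [det_headCols_cellMat]
  · simp only [chartCoord, paramFrame, hinv, cellCoord_cellMat]
    refine Prod.ext rfl (funext fun x => ?_)
    simp only
    rw [stdForm_unstdForm (isUnit_det_cellFrame hg₀ t.1), stdTuple_apply]

theorem polyMap_cellFrame {p : Fin k → ℕ} (g₀ : Fin (k + 1) → Mat n) :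
    PolyMap fun t : ChartCoords n p => (cellFrame g₀ t.1, t.2) := by
  refine PolyMap.prodMk (PolyMap.pi fun j => MatIn.polyMap ?_) polyMap_snd
  refine (MatIn.const _).mul (MatIn.cellMat (fun x => ?_) j)
  exact polyMap_fst _ (dual_mem_polyFun (LinearMap.proj (R := ℂ) (φ := fun _ => ℂ) x))

theorem continuous_chart (p : Comp n k) (g₀ : Fin (k + 1) → Mat n) (hg₀ : ∀ j, IsUnit (g₀ j).det) :
    @Continuous _ _ (zariski (ChartCoords n p.1)) (incidenceVariety p).top (chart p g₀ hg₀) := by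
  let t₁ := zariski (ChartCoords n p.1)
  let t₂ := zariski ((Fin (k + 1) → Mat n) × (StdIdx n p.1 → ℂ))
  let t₃ := (incidenceVariety p).top
  have h2 : Continuous fun t : ChartCoords n p.1 =>
      (⟨(cellFrame g₀ t.1, t.2), isUnit_det_cellFrame hg₀ t.1⟩ : paramSet n p.1) :=
    (polyMap_cellFrame g₀).continuous.subtype_mk _
  exact (continuous_paramMap p).comp h2

/-- `chartCoord` is a left inverse. For openness, the image of {f ≠ 0} is the trace on I_p of the
image of a set of frames given by nonvanishing of the denominator and of f ∘ `chartCoord`. That set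
is open, as f ∘ `chartCoord` becomes polynomial after clearing denominators, and saturated by
`chartCoord_congr`. -/
theorem isOpenEmbedding_chart (p : Comp n k) (g₀ : Fin (k + 1) → Mat n)
    (hg₀ : ∀ j, IsUnit (g₀ j).det) :
    @Topology.IsOpenEmbedding _ _ (zariski (ChartCoords n p.1)) (incidenceVariety p).top
      (chart p g₀ hg₀) := by
  let t₁ := zariski (ChartCoords n p.1)
  let t₂ := zariski ((Fin (k + 1) → Mat n) × Tuple n k)
  let t₃ : TopologicalSpace (Flags n p.1 × Tuple n k) := (flagHom p).top
  let t₄ := (incidenceVariety p).top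
  refine .of_continuous_injective_isOpenMap (continuous_chart p g₀ hg₀) ?_ ?_
  · intro t t' htt'
    have h1 := chartCoord_paramFrame hg₀ t
    have h2 := chartCoord_paramFrame hg₀ t'
    have h3 := chartCoord_congr hg₀ (congrArg Subtype.val htt') h1.1
    rw [← h1.2, ← h2.2]
    exact h3.2.symm
  · refine isTopologicalBasis_ne_zero.isOpenMap_iff.2 ?_
    rintro _ ⟨f, hf, rfl⟩
    let O : Set (frameSet n k) := {z | chartDenom p.1 g₀ z.1 ≠ 0 ∧ f (chartCoord p.1 g₀ z.1) ≠ 0}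
    have hO : IsOpen O := (isOpen_locFun_ne_zero
      (comp_mem_of_dual (dual_chartCoord_mem_locFun p.1 g₀) hf)).preimage continuous_subtype_val
    have hsat : frameMap p ⁻¹' (frameMap p '' O) = O := by
      refine subset_antisymm ?_ (Set.subset_preimage_image _ _)
      rintro z ⟨z', hz', hzz'⟩
      have h := chartCoord_congr hg₀ hzz' hz'.1
      exact ⟨h.1, by rw [h.2]; exact hz'.2⟩
    have hO' : IsOpen (frameMap p '' O) := by
      refine isOpen_coinduced.2 ?_
      rw [hsat]
      exact hO
    suffices heq : chart p g₀ hg₀ '' {x | f x ≠ 0} = Subtype.val ⁻¹' (frameMap p '' O) by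
      rw [heq]
      exact hO'.preimage (continuous_subtype_val (p := (· ∈ incidence p)))
    ext x
    constructor
    · rintro ⟨t, ht, rfl⟩
      have h := chartCoord_paramFrame hg₀ t
      refine ⟨⟨paramFrame (cellFrame g₀ t.1, t.2), isUnit_det_cellFrame hg₀ t.1⟩, ⟨h.1, ?_⟩, rfl⟩
      simp only [h.2]
      exact ht
    · rintro ⟨z, hz, hzx⟩
      refine ⟨chartCoord p.1 g₀ z.1, hz.2, Subtype.ext ?_⟩
      rw [chart_chartCoord hg₀ (hzx ▸ x.2) hz.1, hzx]

theorem exists_mem_range_chart (p : Comp n k) (x : incidence p) :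
    ∃ (g₀ : Fin (k + 1) → Mat n) (hg₀ : ∀ j, IsUnit (g₀ j).det), x ∈ Set.range (chart p g₀ hg₀) := by
  obtain ⟨⟨z, hz⟩, rfl⟩ := paramMap_surjective p x
  -- The chart is centred at a frame of the point itself; relative to it the point has the identity
  -- frame, which lies in the big cell.
  refine ⟨z.1, hz, chartCoord p.1 z.1 (paramFrame z), Subtype.ext ?_⟩
  refine chart_chartCoord (z := ⟨paramFrame z, hz⟩) hz (paramMap p ⟨z, hz⟩).2 ?_
  rw [chartDenom_ne_zero_iff]
  intro j c
  have : (z.1 j)⁻¹ * (paramFrame z).1 j = 1 := Matrix.nonsing_inv_mul _ (hz j)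
  have h1 : headCols (1 : Mat n) (cut n p.1 j.val c.val) = 1 := by
    ext r c
    simp [headCols]
  change IsUnit (headCols ((z.1 j)⁻¹ * (paramFrame z).1 j) (cut n p.1 j.val c.val)).det
  rw [this, h1, Matrix.det_one]
  exact isUnit_one

/-- The dimension is bounded by that of the members of an open cover. -/
theorem topologicalKrullDim_le_of_cover {X : Type*} [TopologicalSpace X] {d : WithBot ℕ∞}
    (h : ∀ x : X, ∃ (Y : Type) (_ : TopologicalSpace Y) (f : Y → X), Topology.IsOpenEmbedding f ∧
      x ∈ Set.range f ∧ topologicalKrullDim Y ≤ d) : topologicalKrullDim X ≤ d := by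
  -- Every irreducible closed set above `Z` also meets an open set that meets `Z`. Hence the
  -- coheight of `Z` can be computed in a single member of the cover.
  rw [topologicalKrullDim, Order.krullDim_eq_iSup_coheight]
  refine iSup_le fun Z => ?_
  obtain ⟨x, hx⟩ := Z.2.nonempty
  obtain ⟨Y, _, f, hf, ⟨y, rfl⟩, hY⟩ := h x
  let Z' := TopologicalSpace.IrreducibleCloseds.orderIsoOfIsOpenEmbedding f hf
  let Z₁ : TopologicalSpace.IrreducibleCloseds Y := Z'.symm ⟨Z, ⟨y, hx⟩⟩
  have hZ : TopologicalSpace.IrreducibleCloseds.map f hf.continuous Z₁ = Z :=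
    congrArg Subtype.val (Z'.apply_symm_apply ⟨Z, ⟨y, hx⟩⟩)
  rw [← hZ, hf.coheight_map]
  exact (Order.coheight_le_krullDim _).trans hY

theorem dim_affine_le {V : Type} [AddCommGroup V] [Module ℂ V] [FiniteDimensional ℂ V] :
    @topologicalKrullDim V (zariski V) ≤ (Module.finrank ℂ V : WithBot ℕ∞) := by
  let _ := zariski V
  have h := dim_restrict_le (V := V) (W := V) (m := id) (fun f hf => hf) (S := Set.univ)
    (by simp)
  refine le_trans ?_ h
  exact (Homeomorph.Set.univ V).symm.isInducing.topologicalKrullDim_le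

theorem dim_incidenceVariety_le (p : Comp n k) :
    (incidenceVariety p).dim ≤ (Module.finrank ℂ (ChartCoords n p.1) : WithBot ℕ∞) := by
  let t₄ := (incidenceVariety p).top
  refine topologicalKrullDim_le_of_cover fun x => ?_
  obtain ⟨g₀, hg₀, hx⟩ := exists_mem_range_chart p x
  exact ⟨ChartCoords n p.1, zariski _, chart p g₀ hg₀, isOpenEmbedding_chart p g₀ hg₀, hx,
    dim_affine_le⟩

/-- The kernel loci are closures of polynomial images of the coordinate spaces of the charts. -/
theorem exists_polyMap_kerLocus_subset (p : Comp n k) : ∃ m : ChartCoords n p.1 → Tuple n k,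
    PolyMap m ∧ kerLocus n p.1 ⊆ closure[zariski (Tuple n k)] (Set.range m) := by
  let t₁ := zariski (ChartCoords n p.1)
  let t₂ := zariski (Tuple n k)
  let t₄ := (incidenceVariety p).top
  have hg₀ : ∀ j : Fin (k + 1), IsUnit ((fun _ => 1 : Fin (k + 1) → Mat n) j).det := by simp
  let c := chart p (fun _ => 1) hg₀
  have hp : PolyMap fun t => projHom p (c t) := by
    exact (polyMap_snd (V := Fin (k + 1) → Mat n) (W := Tuple n k)).comp
      ((polyMap_paramFrame p.1).comp (polyMap_cellFrame _))
  refine ⟨_, hp, ?_⟩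
  have := irreducibleSpace_incidenceVariety p
  -- A single chart suffices: its image is nonempty and open in an irreducible space.
  have hd : Dense (Set.range c) :=
    (isOpenEmbedding_chart p _ hg₀).isOpen_range.dense ⟨_, ⟨0, rfl⟩⟩
  rw [← range_projHom]
  have h2 := (continuous_projHom p).range_subset_closure_image_dense hd
  rwa [← Set.range_comp] at h2

end Charts

/-! ### Birationality -/

section Birational

variable {n k : ℕ}

theorem shift_mul_shift (n m m' : ℕ) : shift n m * shift n m' = shift n (m + m') := by
  refine Matrix.ext_col fun c => ?_
  rw [col_mul_shift]
  ext r
  split_ifs with h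
  · simp only [Matrix.col_apply, shift, Matrix.of_apply]
    congr 1
    apply propext
    omega
  · simp only [Matrix.col_apply, shift, Matrix.of_apply, Pi.zero_apply]
    rw [if_neg (by omega)]

theorem shift_zero (n : ℕ) : shift n 0 = 1 := by
  ext r c
  simp [shift, Matrix.one_apply, Fin.ext_iff]

theorem seg_shiftTuple (p : Fin k → ℕ) {a j : ℕ} (haj : a ≤ j) (hj : j ≤ k) :
    seg (shiftTuple n p) a j = shift n (partSum p a j) := by
  induction j, haj using Nat.le_induction with
  | base => rw [seg_of_le _ le_rfl, partSum_of_le _ le_rfl, shift_zero]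
  | succ j haj ih => rw [seg_succ _ haj (by omega), ih (by omega), shiftTuple, shift_mul_shift,
      partSum_succ _ haj (by omega)]

theorem shift_mul_apply (A : Mat n) {m : ℕ} {r : Fin n} (hr : m ≤ r.val) (c : Fin n) :
    (shift n m * A) ⟨r.val - m, by omega⟩ c = A r c := by
  rw [Matrix.mul_apply, Finset.sum_eq_single r]
  · simp [shift, hr]
  · intro b _ hb
    rw [shift, Matrix.of_apply, if_neg, zero_mul]
    intro h
    simp only at h
    exact hb (Fin.ext (by omega))
  · simp

/-- The smallest `a` with `p_a + ⋯ + p_{j-1} ≤ c`. -/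
def level (p : Fin k → ℕ) (j c : ℕ) : ℕ := sInf {a | partSum p a j ≤ c}

theorem partSum_level_le (p : Fin k → ℕ) (j c : ℕ) : partSum p (level p j c) j ≤ c :=
  Nat.sInf_mem (s := {a | partSum p a j ≤ c}) ⟨j, by
    rw [Set.mem_ofPred_eq, partSum_of_le _ le_rfl]; exact Nat.zero_le _⟩

theorem level_le (p : Fin k → ℕ) {j c a : ℕ} (h : partSum p a j ≤ c) : level p j c ≤ a :=
  Nat.sInf_le h

theorem level_le_self (p : Fin k → ℕ) (j c : ℕ) : level p j c ≤ j :=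
  level_le p (by rw [partSum_of_le _ le_rfl]; exact Nat.zero_le _)

/-- Coframes with rows that are linear combinations of rows of the products `X_a ⋯ X_{j-1}`. -/
def coframe (p : Fin k → ℕ) (g : Fin (k + 1) → GL (Fin n) ℂ) (X : Tuple n k) (j : Fin (k + 1)) :
    Mat n :=
  Matrix.of fun r c =>
    ((((g ⟨level p j r, by have := level_le_self p j r; omega⟩)⁻¹ : GL (Fin n) ℂ) : Mat n) *
      seg X (level p j r) j) ⟨r.val - partSum p (level p j r) j, by omega⟩ c

theorem matIn_coframe (p : Fin k → ℕ) (g : Fin (k + 1) → GL (Fin n) ℂ) (j : Fin (k + 1)) :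
    MatIn (polyFun (Tuple n k)) fun X => coframe p g X j := fun r c =>
  ((MatIn.const _).mul (matIn_seg (level p j r) j)) _ c

/-- Here X_a ⋯ X_{j-1} = g_a S g_j⁻¹ with S the shift by m = p_a + ⋯ + p_{j-1}, so row r - m of
g_a⁻¹ X_a ⋯ X_{j-1} is row r of g_j⁻¹. In particular the coframe is invertible at the base point,
hence nearby. -/
theorem coframe_act_shiftTuple (p : Fin k → ℕ) (g : Fin (k + 1) → GL (Fin n) ℂ) (j : Fin (k + 1)) :
    coframe p g (act g (shiftTuple n p)) j = ((g j)⁻¹ : GL (Fin n) ℂ) := by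
  ext r c
  rw [coframe, Matrix.of_apply, seg_act _ _ (level_le_self p j r) (by omega),
    seg_shiftTuple _ (level_le_self p j r) (by omega), mul_assoc, Units.inv_mul_cancel_left,
    shift_mul_apply _ (partSum_level_le p j r)]

theorem coframe_mulVec_eq_zero (p : Fin k → ℕ) (g : Fin (k + 1) → GL (Fin n) ℂ) {X : Tuple n k}
    {j a : Fin (k + 1)} (haj : a ≤ j) {v : Fin n → ℂ} (hv : v ∈ kerOf (seg X a j)) {r : Fin n}
    (hr : partSum p a j ≤ r.val) : (coframe p g X j).mulVec v r = 0 := by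
  have h1 := mem_kerOf.1 (kerOf_seg_le X (level_le p hr) haj (by omega) hv)
  have h2 : ((((g ⟨level p j r, by have := level_le_self p j r; omega⟩)⁻¹ : GL (Fin n) ℂ) : Mat n) *
      seg X (level p j r) j).mulVec v = 0 := by
    rw [← Matrix.mulVec_mulVec, h1, Matrix.mulVec_zero]
  exact congrFun h2 ⟨r.val - partSum p (level p j r) j, by omega⟩

/-- The coframe maps the kernel to vectors supported in the first rows, so the kernel lies in the
span of the first columns of the inverse, and the dimensions agree. The adjugate is the inverse up
to a scalar and is polynomial in `X`. -/
theorem colSpan_adjugate_coframe (p : Comp n k) (g : Fin (k + 1) → GL (Fin n) ℂ) {X : Tuple n k}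
    (hX : X ∈ kerLocus n p.1) (hX' : X ∈ smallKerLocus n p.1) {j : Fin (k + 1)}
    (hQ : IsUnit (coframe p.1 g X j).det) (a : Fin (k + 1)) :
    colSpan (coframe p.1 g X j).adjugate (partSum p.1 a j) = kerOf (seg X a j) := by
  by_cases haj : a ≤ j
  · symm
    refine Submodule.eq_of_le_of_finrank_eq (fun v hv => ?_) ?_
    · have h1 : (coframe p.1 g X j).adjugate.mulVec
          ((coframe p.1 g X j).det⁻¹ • (coframe p.1 g X j).mulVec v) = v := by
        rw [Matrix.mulVec_smul, Matrix.mulVec_mulVec, Matrix.adjugate_mul, Matrix.smul_mulVec,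
          Matrix.one_mulVec, inv_smul_smul₀ hQ.ne_zero]
      rw [← h1]
      refine mulVec_mem_colSpan _ fun r hr => ?_
      rw [Pi.smul_apply, coframe_mulVec_eq_zero p.1 g haj hv hr, smul_zero]
    · rw [finrank_colSpan _ _ (partSum_le p _ _)]
      · exact le_antisymm (hX' a j haj (by omega)) (hX a j haj (by omega))
      · rw [Matrix.det_adjugate]
        exact hQ.pow _
  · have h1 : j.val ≤ a.val := by omega
    rw [partSum_of_le _ h1, seg_of_le _ h1, kerOf, Matrix.toLin'_one, LinearMap.ker_id]
    simp [colSpan]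

/-- The flags of kernels of the products `X_a ⋯ X_{j-1}`. -/
def kerFlags (p : Comp n k) (X : Tuple n k) (hX : X ∈ kerLocus n p.1)
    (hX' : X ∈ smallKerLocus n p.1) : Flags n p.1 where
  F j a := kerOf (seg X a j)
  anti j a b hab := by
    by_cases hbj : b ≤ j
    · exact kerOf_seg_le X hab hbj (by omega)
    · change kerOf (seg X b j) ≤ _
      rw [seg_of_le X (by omega : j.val ≤ b.val), kerOf, Matrix.toLin'_one, LinearMap.ker_id]
      exact bot_le
  finrank_eq j a := by
    by_cases haj : a ≤ j
    · exact le_antisymm (hX' a j haj (by omega)) (hX a j haj (by omega))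
    · have h1 : j.val ≤ a.val := by omega
      rw [seg_of_le X h1, partSum_of_le _ h1, kerOf, Matrix.toLin'_one, LinearMap.ker_id, finrank_bot]

theorem kerFlags_mem_incidence (p : Comp n k) (X : Tuple n k) (hX : X ∈ kerLocus n p.1)
    (hX' : X ∈ smallKerLocus n p.1) : (kerFlags p X hX hX', X) ∈ incidence p := by
  rintro j a _ ⟨v, hv, rfl⟩
  have hv' : v ∈ kerOf (seg X a (j.val + 1)) := hv
  change _ ∈ kerOf (seg X a j.val)
  by_cases haj : a.val ≤ j.val
  · rw [mem_kerOf, seg_succ X haj j.2, ← Matrix.mulVec_mulVec, ← mem_kerOf] at hv'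
    exact hv'
  · rw [seg_of_le X (by omega), kerOf, Matrix.toLin'_one, LinearMap.ker_id, Submodule.mem_bot] at hv'
    rw [hv', map_zero]
    exact zero_mem _

/-- Flags compatible with the tuple are contained in the kernels, and over the generic locus the
dimensions coincide; the fibre is therefore a single point. -/
theorem eq_kerFlags {p : Comp n k} {z : Flags n p.1 × Tuple n k} (hz : z ∈ incidence p)
    (hX : z.2 ∈ kerLocus n p.1) (hX' : z.2 ∈ smallKerLocus n p.1) : kerFlags p z.2 hX hX' = z.1 := by
  refine Flags.ext_F fun j a => ?_
  have hfin : ∀ F : Flags n p.1, j.val ≤ a.val → F.F j a = ⊥ := by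
    intro F h
    rw [← Submodule.finrank_eq_zero, F.finrank_eq, partSum_of_le _ h]
  by_cases haj : a.val ≤ j.val
  · symm
    refine Submodule.eq_of_le_of_finrank_eq (flags_le_kerOf hz haj (by omega)) ?_
    rw [z.1.finrank_eq]
    exact ((kerFlags p z.2 hX hX').finrank_eq j a).symm
  · rw [hfin _ (by omega), hfin _ (by omega)]

/-- Near every point of the locus of generic kernels, the flags of kernels are given by a polynomial
family of frames. -/
theorem exists_local_frame (p : Comp n k) {X₀ : Tuple n k} (hX₀ : X₀ ∈ kerLocus n p.1)
    (hX₀' : X₀ ∈ smallKerLocus n p.1) :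
    ∃ (N : Set (Tuple n k)) (σ : Tuple n k → (Fin (k + 1) → Mat n) × Tuple n k)
      (hσ : ∀ X ∈ N, σ X ∈ frameSet n k), IsOpen[zariski (Tuple n k)] N ∧ X₀ ∈ N ∧ PolyMap σ ∧
      ∀ X (hN : X ∈ N) (hX : X ∈ kerLocus n p.1) (hX' : X ∈ smallKerLocus n p.1),
        frameMap p ⟨σ X, hσ X hN⟩ = (kerFlags p X hX hX', X) := by
  obtain ⟨g, hg⟩ := exists_act_shiftTuple p hX₀ hX₀'
  refine ⟨{X | ∀ j, IsUnit (coframe p.1 g X j).det}, fun X => (fun j => (coframe p.1 g X j).adjugate, X),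
    fun X hX j => ?_, isOpen_isUnit_det fun j => matIn_coframe p.1 g j, fun j => ?_, ?_, ?_⟩
  · simp only [Matrix.det_adjugate]
    exact (hX j).pow _
  · rw [hg, coframe_act_shiftTuple]
    exact (Matrix.isUnit_iff_isUnit_det _).1 (Units.isUnit _)
  · exact PolyMap.prodMk (PolyMap.pi fun j => (matIn_coframe p.1 g j).adjugate.polyMap)
      (.linear LinearMap.id)
  · intro X hN hX hX'
    exact Prod.ext (Flags.ext_F fun j a => colSpan_adjugate_coframe p g hX hX' (hN j) a) rfl

/-! ### Morphisms -/

theorem PolyMap.regularAt {V W : Type} [AddCommGroup V] [Module ℂ V] [AddCommGroup W] [Module ℂ W]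
    {m : V → W} (hm : PolyMap m) {F : W → ℂ} {v : V} (h : (affine W).RegularAt F (m v)) :
    (affine V).RegularAt (F ∘ m) v := by
  obtain ⟨g, hg, h, hh, hne, heq⟩ := h
  exact ⟨_, hm g hg, _, hm h hh, hne, fun y hy => heq (m y) hy⟩

theorem FunSpace.IsMorphism.restrict {X Y : Type} {A : FunSpace X} {B : FunSpace Y} {φ : X → Y}
    (h : A.IsMorphism B φ) {U : Set X} {W : Set Y} (hUW : Set.MapsTo φ U W) :
    (A.restrict U).IsMorphism (B.restrict W) (hUW.restrict φ U W) := by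
  let _ := A.top
  let _ := B.top
  refine ⟨?_, ?_⟩
  · have h1 : Continuous φ := h.1
    exact (h1.comp continuous_subtype_val).subtype_mk _
  · rintro f x ⟨O, hO, hxO, F, hF, hfF⟩
    have h1 : Continuous φ := h.1
    exact ⟨φ ⁻¹' O, hO.preimage h1, hxO, F ∘ φ, fun y hy => h.2 F y (hF _ hy),
      fun y hy => hfF _ hy⟩

theorem isMorphism_projHom (p : Comp n k) {Z : Set (Tuple n k)} (h : ∀ x, projHom p x ∈ Z) :
    (incidenceVariety p).IsMorphism ((affine (Tuple n k)).restrict Z)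
      (Set.codRestrict (projHom p) Z h) := by
  let t₁ := zariski (Tuple n k)
  let t₂ := zariski ((Fin (k + 1) → Mat n) × Tuple n k)
  let t₃ : TopologicalSpace (Flags n p.1 × Tuple n k) := (flagHom p).top
  let t₄ := (incidenceVariety p).top
  have hsnd : PolyMap (Prod.snd : (Fin (k + 1) → Mat n) × Tuple n k → Tuple n k) := polyMap_snd
  have hc : @Continuous _ _ t₃ t₁ Prod.snd :=
    continuous_coinduced_dom.2 (hsnd.continuous.comp (continuous_subtype_val (p := (· ∈ frameSet n k))))
  refine ⟨?_, ?_⟩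
  · have := continuous_projHom p
    exact this.subtype_mk _
  · rintro f x ⟨O, hO, hxO, F, hF, hfF⟩
    have hO' : IsOpen[t₃] (Prod.snd ⁻¹' O) := hO.preimage hc
    -- The same preimage serves at each layer of the structure: the restriction to I_p, the quotient
    -- by frames, and the restriction to invertible frames.
    refine ⟨Prod.snd ⁻¹' O, hO', hxO, fun z => F z.2, fun y hy => ?_, fun y hy => hfF _ hy⟩
    refine ⟨Prod.snd ⁻¹' O, hO', hy, fun z hz => ?_⟩
    refine ⟨Prod.snd ⁻¹' O, hO.preimage hsnd.continuous, hz, F ∘ Prod.snd, fun w hw => ?_,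
      fun w _ => rfl⟩
    exact hsnd.regularAt (hF _ hw)

/-- The inverse of the projection from the incidence correspondence on the locus of generic
kernels. -/
def invProj (p : Comp n k)
    (X : {X : kerLocus n p.1 | X.1 ∈ smallKerLocus n p.1}) :
    {z : incidence p | projHom p z ∈ smallKerLocus n p.1} :=
  ⟨⟨(kerFlags p X.1.1 X.1.2 X.2, X.1.1), kerFlags_mem_incidence p _ _ _⟩, X.2⟩

/-- Openness and regularity on the flag side are defined by pull-back to frames. Locally the inverse
lifts to the polynomial map `σ` into frames, so both can be tested after composing with `σ`. -/
theorem isMorphism_invProj (p : Comp n k) :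
    (((affine (Tuple n k)).restrict (kerLocus n p.1)).restrict
      {X | X.1 ∈ smallKerLocus n p.1}).IsMorphism
      ((incidenceVariety p).restrict {z | projHom p z ∈ smallKerLocus n p.1}) (invProj p) := by
  let t₁ := zariski (Tuple n k)
  let t₂ := zariski ((Fin (k + 1) → Mat n) × Tuple n k)
  let t₃ : TopologicalSpace (Flags n p.1 × Tuple n k) := (flagHom p).top
  let t₄ := (incidenceVariety p).top
  let t₅ := ((affine (Tuple n k)).restrict (kerLocus n p.1)).top
  have hval : Continuous fun X : {X : kerLocus n p.1 | X.1 ∈ smallKerLocus n p.1} => X.1.1 :=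
    continuous_subtype_val.comp continuous_subtype_val
  have hc : Continuous fun X : {X : kerLocus n p.1 | X.1 ∈ smallKerLocus n p.1} =>
      (invProj p X).1 := by
    have hc : Continuous fun X : {X : kerLocus n p.1 | X.1 ∈ smallKerLocus n p.1} =>
        (invProj p X).1.1 := by
      refine ⟨fun O hO => isOpen_iff_forall_mem_open.2 fun X₀ hX₀ => ?_⟩
      obtain ⟨N, σ, hσ, hN, hX₀N, hσp, heq⟩ := exists_local_frame p X₀.1.2 X₀.2
      obtain ⟨O', hO', hOO'⟩ := isOpen_induced_iff.1 (isOpen_coinduced.1 hO)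
      have hmem : ∀ X : {X : kerLocus n p.1 | X.1 ∈ smallKerLocus n p.1}, ∀ hXN : X.1.1 ∈ N,
          (invProj p X).1.1 ∈ O ↔ σ X.1.1 ∈ O' := by
        intro X hXN
        have h1 : (⟨σ X.1.1, hσ _ hXN⟩ : frameSet n k) ∈ frameMap p ⁻¹' O ↔ σ X.1.1 ∈ O' := by
          rw [← hOO']
          rfl
        rw [← h1, Set.mem_preimage, heq X.1.1 hXN X.1.2 X.2]
        rfl
      refine ⟨(fun X => X.1.1) ⁻¹' (N ∩ σ ⁻¹' O'), fun X hX => (hmem X hX.1).2 hX.2, ?_,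
        ⟨hX₀N, (hmem X₀ hX₀N).1 hX₀⟩⟩
      exact (hN.inter (hO'.preimage hσp.continuous)).preimage hval
    exact hc.subtype_mk _
  refine ⟨hc.subtype_mk _, ?_⟩
  · rintro f X₀ ⟨O₁, hO₁, hX₁, F₁, hF₁, hfF₁⟩
    -- The layers are unwound from the generic locus through I_p and the quotient down to `F₄`,
    -- regular near the lifted point of the vector space of frames; F₄ ∘ σ then represents the
    -- pulled-back function.
    obtain ⟨O₂, hO₂, hX₂, F₂, hF₂, hfF₂⟩ := hF₁ _ hX₁
    obtain ⟨O₃, hO₃, hX₃, hF₃⟩ := hF₂ _ hX₂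
    obtain ⟨N, σ, hσ, hN, hX₀N, hσp, heq⟩ := exists_local_frame p X₀.1.2 X₀.2
    obtain ⟨O₄, hO₄, hX₄, F₄, hF₄, hfF₄⟩ := hF₃ ⟨σ X₀.1.1, hσ _ hX₀N⟩
      (by rw [heq _ hX₀N X₀.1.2 X₀.2]; exact hX₃)
    obtain ⟨O₅, hO₅, hO₅'⟩ := isOpen_induced_iff.1 ((hO₁.inter
      (hO₂.preimage (continuous_subtype_val (p := (· ∈ incidence p))))).preimage hc)
    have hmem : ∀ X : {X : kerLocus n p.1 | X.1 ∈ smallKerLocus n p.1}, X.1 ∈ O₅ ↔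
        (invProj p X).1 ∈ O₁ ∧ (invProj p X).1.1 ∈ O₂ := fun X => Set.ext_iff.1 hO₅' X
    have hopen : IsOpen (N ∩ σ ⁻¹' O₄) := hN.inter (hO₄.preimage hσp.continuous)
    refine ⟨O₅ ∩ Subtype.val ⁻¹' (N ∩ σ ⁻¹' O₄),
      hO₅.inter (hopen.preimage (continuous_subtype_val (p := (· ∈ kerLocus n p.1)))),
      ⟨(hmem X₀).2 ⟨hX₁, hX₂⟩, hX₀N, hX₄⟩, fun X => F₄ (σ X.1), fun X hX => ?_, fun X hX => ?_⟩
    · exact ⟨N ∩ σ ⁻¹' O₄, hopen, hX.2, F₄ ∘ σ, fun Y hY => hσp.regularAt (hF₄ _ hY.2),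
        fun _ _ => rfl⟩
    · obtain ⟨h1, h2⟩ := (hmem X).1 hX.1
      have h3 := hfF₄ ⟨σ X.1.1, hσ _ hX.2.1⟩ hX.2.2
      rw [Function.comp_apply, heq _ hX.2.1 X.1.2 X.2] at h3
      exact (hfF₁ _ h1).trans ((hfF₂ _ h2).trans h3)

theorem isBirationalOnto_projHom (p : Comp n k) :
    (incidenceVariety p).IsBirationalOnto (affine (Tuple n k)) (projHom p) (compVariety n p.1) := by
  rw [compVariety_eq_kerLocus]
  refine ⟨range_projHom p, projHom_mem_kerLocus, ?_⟩
  let t₁ := zariski (Tuple n k)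
  let t₄ := (incidenceVariety p).top
  let t₅ := ((affine (Tuple n k)).restrict (kerLocus n p.1)).top
  have hirr : IrreducibleSpace (incidence p) := irreducibleSpace_incidenceVariety p
  have hirr' : IrreducibleSpace (kerLocus n p.1) :=
    isIrreducible_iff_irreducibleSpace.1 (isIrreducible_kerLocus p)
  have hmor := isMorphism_projHom p (projHom_mem_kerLocus (p := p))
  have hopen : IsOpen {z : incidence p | projHom p z ∈ smallKerLocus n p.1} :=
    (isOpen_smallKerLocus p.1).preimage (continuous_projHom p)
  have hopen' : IsOpen {X : kerLocus n p.1 | X.1 ∈ smallKerLocus n p.1} :=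
    (isOpen_smallKerLocus p.1).preimage (continuous_subtype_val (p := (· ∈ kerLocus n p.1)))
  let D : {X : kerLocus n p.1 | X.1 ∈ smallKerLocus n p.1} :=
    ⟨⟨diagTuple n p.1, diagTuple_mem_kerLocus p⟩, diagTuple_mem_smallKerLocus p⟩
  have hmaps : Set.MapsTo (Set.codRestrict (projHom p) (kerLocus n p.1) projHom_mem_kerLocus)
      {z | projHom p z ∈ smallKerLocus n p.1} {X | X.1 ∈ smallKerLocus n p.1} := fun z hz => hz
  refine ⟨hmor, hirr, hirr', _, _, hmaps, hopen, hopen.dense ⟨_, (invProj p D).2⟩, hopen',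
    hopen'.dense ⟨_, D.2⟩, hmor.restrict hmaps, invProj p, isMorphism_invProj p, fun z => ?_,
    fun X => rfl⟩
  refine Subtype.ext (Subtype.ext (Prod.ext ?_ rfl))
  exact eq_kerFlags z.1.2 (projHom_mem_kerLocus z.1) z.2

end Birational

/-! ### Dimensions -/

section Count

variable {n k : ℕ}

theorem card_subtype_triple {α : Type} [Fintype α] (P : α × Fin n × Fin n → Prop)
    [DecidablePred P] : Fintype.card {x // P x} =
      ∑ j : α, ∑ c : Fin n, ∑ r : Fin n, if P (j, r, c) then 1 else 0 := by
  rw [Fintype.card_subtype, Finset.card_filter, Fintype.sum_prod_type]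
  refine Finset.sum_congr rfl fun j _ => ?_
  rw [Fintype.sum_prod_type, Finset.sum_comm]

theorem sum_ite_lt {m : ℕ} (hm : m ≤ n) : ∑ r : Fin n, (if r.val < m then 1 else 0) = m := by
  rw [Fin.sum_univ_eq_sum_range (fun r => if r < m then 1 else 0) n, ← Finset.card_filter]
  have : (Finset.range n).filter (· < m) = Finset.range m := by
    ext r
    simp only [Finset.mem_filter, Finset.mem_range]
    omega
  rw [this, Finset.card_range]

/-- The sum of the numbers `cut n p j c`. -/
def cutSum (n : ℕ) {k : ℕ} (p : Fin k → ℕ) (j : ℕ) : ℕ := ∑ c ∈ Finset.range n, cut n p j c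

theorem card_cellIdx (p : Fin k → ℕ) :
    Fintype.card (CellIdx n p) + ∑ j : Fin (k + 1), cutSum n p j = (k + 1) * n ^ 2 := by
  have hinner : ∀ (j : Fin (k + 1)) (c : Fin n),
      (∑ r : Fin n, if cut n p j.val c.val ≤ r.val then 1 else 0) + cut n p j.val c.val = n := by
    intro j c
    have h := sum_ite_lt (cut_le p j.val c.2)
    have : ∀ r : Fin n, ((if cut n p j.val c.val ≤ r.val then 1 else 0) +
        if r.val < cut n p j.val c.val then 1 else 0) = 1 := by
      intro r
      split_ifs <;> omega
    have hsum : (∑ r : Fin n, if cut n p j.val c.val ≤ r.val then 1 else 0) +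
        (∑ r : Fin n, if r.val < cut n p j.val c.val then 1 else 0) = n := by
      rw [← Finset.sum_add_distrib, Finset.sum_congr rfl fun r _ => this r]
      simp
    rwa [h] at hsum
  have hcol : ∀ j : Fin (k + 1), (∑ c : Fin n, ∑ r : Fin n,
      if cut n p j.val c.val ≤ r.val then 1 else 0) + cutSum n p j = n ^ 2 := by
    intro j
    rw [cutSum, ← Fin.sum_univ_eq_sum_range (fun c => cut n p j c) n, ← Finset.sum_add_distrib]
    simp only [hinner]
    simp [sq]
  rw [card_subtype_triple, ← Finset.sum_add_distrib]
  simp only [hcol]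
  simp

/-- All dimensions p_a + ⋯ + p_{j-1} with a ≤ j grow by p_j when passing from U_j to U_{j+1}, so the
constraint on column c is read off from the cut at c - p_j. -/
theorem stdIdx_iff (p : Comp n k) {j : Fin k} {r c : Fin n} (hc : p.1 j ≤ c.val) :
    (∀ a, c.val < partSum p.1 a (j.val + 1) → r.val < partSum p.1 a j.val) ↔
      r.val < cut n p.1 j.val (c.val - p.1 j) := by
  constructor
  · intro h
    rcases cut_spec (n := n) p.1 j.val (c := c.val - p.1 j) (by omega) with ⟨hlt, h1 | ⟨a, h1⟩⟩
    · rw [h1]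
      exact r.2
    · rw [h1]
      rw [h1] at hlt
      have haj : a ≤ j.val := by
        by_contra haj
        rw [partSum_of_le _ (by omega)] at hlt
        omega
      refine h a ?_
      rw [partSum_succ _ haj j.2]
      simp only [Fin.eta]
      omega
  · intro h a hca
    have haj : a ≤ j.val := by
      by_contra haj
      rw [partSum_of_le _ (by omega)] at hca
      omega
    rw [partSum_succ _ haj j.2] at hca
    simp only [Fin.eta] at hca
    exact lt_of_lt_of_le h (cut_le_partSum _ (by omega))

theorem cut_eq_of_le (p : Comp n k) (j : Fin k) {c : ℕ} (hc : n - p.1 j ≤ c) (hcn : c < n) :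
    cut n p.1 j.val c = n := by
  rcases cut_spec (n := n) p.1 j.val hcn with ⟨hlt, h1 | ⟨a, h1⟩⟩
  · exact h1
  · have haj : a ≤ j.val := by
      by_contra haj
      rw [partSum_of_le _ (by omega)] at h1
      omega
    have h2 := partSum_le p a (j.val + 1)
    rw [partSum_succ _ haj j.2] at h2
    simp only [Fin.eta] at h2
    omega

theorem part_le (p : Comp n k) (j : Fin k) : p.1 j ≤ n := by
  have h := partSum_le p j (j.val + 1)
  rw [partSum_single _ j.2] at h
  exact h

-- In X_j the first p_j columns are zero, and column c has `cut` at c - p_j free entries. Compared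
-- with `cutSum`, the last p_j cuts are missing; each of them is n, so the deficit is p_j n, and n²
-- after summation over j.
open Classical in
theorem card_stdIdx (p : Comp n k) :
    Fintype.card (StdIdx n p.1) + n ^ 2 = ∑ j : Fin k, cutSum n p.1 j := by
  have hinner : ∀ (j : Fin k) (c : Fin n), (∑ r : Fin n,
      if ∀ a, c.val < partSum p.1 a (j.val + 1) → r.val < partSum p.1 a j.val then 1 else 0) =
        if c.val < p.1 j then 0 else cut n p.1 j.val (c.val - p.1 j) := by
    intro j c
    split_ifs with hc
    · refine Finset.sum_eq_zero fun r _ => if_neg fun h => ?_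
      have := h j.val (by rw [partSum_single _ j.2]; exact hc)
      rw [partSum_of_le _ le_rfl] at this
      omega
    · simp only [stdIdx_iff p (not_lt.1 hc)]
      exact sum_ite_lt (cut_le _ _ (by omega))
  have hcol : ∀ j : Fin k, (∑ c : Fin n, ∑ r : Fin n,
      if ∀ a, c.val < partSum p.1 a (j.val + 1) → r.val < partSum p.1 a j.val then 1 else 0) +
        p.1 j * n = cutSum n p.1 j := by
    intro j
    simp only [hinner]
    rw [Fin.sum_univ_eq_sum_range (fun c => if c < p.1 j then 0 else cut n p.1 j.val (c - p.1 j)) n]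
    obtain ⟨m, hm⟩ := Nat.exists_eq_add_of_le (part_le p j)
    have h1 : ∑ c ∈ Finset.range n, (if c < p.1 j then 0 else cut n p.1 j.val (c - p.1 j)) =
        ∑ c ∈ Finset.range m, cut n p.1 j.val c := by
      rw [show Finset.range n = Finset.range (p.1 j + m) from congrArg _ hm, Finset.sum_range_add]
      rw [Finset.sum_eq_zero (fun c hc => if_pos (Finset.mem_range.1 hc)), zero_add]
      refine Finset.sum_congr rfl fun c _ => ?_
      rw [if_neg (by omega), Nat.add_sub_cancel_left]
    have h2 : cutSum n p.1 j = (∑ c ∈ Finset.range m, cut n p.1 j.val c) + p.1 j * n := by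
      rw [cutSum, show Finset.range n = Finset.range (m + p.1 j) from congrArg _ (hm.trans (add_comm _ _)),
        Finset.sum_range_add, add_right_inj]
      rw [Finset.sum_congr rfl fun x hx => cut_eq_of_le p j (c := m + x) (by omega)
        (by have := Finset.mem_range.1 hx; omega)]
      simp
    rw [h1, h2]
  have hn : n ^ 2 = ∑ j : Fin k, p.1 j * n := by
    rw [← Finset.sum_mul, p.2, sq]
  rw [card_subtype_triple, hn, ← Finset.sum_add_distrib]
  exact Finset.sum_congr rfl fun j _ => hcol j

theorem cut_last_eq (p : Comp n k) {a c : ℕ} (h1 : partSum p.1 (a + 1) k ≤ c)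
    (h2 : c < partSum p.1 a k) : cut n p.1 k c = partSum p.1 a k := by
  refine le_antisymm (cut_le_partSum _ h2) ?_
  have hle := partSum_le p a k
  rcases cut_spec (n := n) p.1 k (c := c) (by omega) with ⟨hlt, h3 | ⟨b, h3⟩⟩
  · rw [h3]
    exact hle
  · rw [h3] at hlt ⊢
    by_cases hba : b ≤ a
    · exact partSum_anti _ hba _
    · have := partSum_anti p.1 (show a + 1 ≤ b by omega) k
      omega

/-- On U_k the cut equals p_a + ⋯ + p_{k-1} on a block of p_a indices, so the sum is Σ p_a (p_a + ⋯
+ p_{k-1}). -/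
theorem cutSum_last (p : Comp n k) : cutSum n p.1 k = h2 p.1 := by
  have key : ∀ m ≤ k, ∑ c ∈ Finset.range (partSum p.1 (k - m) k), cut n p.1 k c =
      ∑ i : Fin k with k - m ≤ i.val, p.1 i * partSum p.1 i.val k := by
    intro m
    induction m with
    | zero =>
      intro _
      rw [Nat.sub_zero, partSum_of_le _ le_rfl, Finset.filter_false_of_mem (fun i _ => by omega)]
      simp
    | succ m ih =>
      intro hm
      obtain ⟨a, ha⟩ : ∃ a, k - (m + 1) = a := ⟨_, rfl⟩
      have ha' : k - m = a + 1 := by omega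
      have hak : a < k := by omega
      rw [ha]
      rw [ha'] at ih
      have h1 : partSum p.1 a k = partSum p.1 (a + 1) k + p.1 ⟨a, hak⟩ := by
        rw [← partSum_add p.1 (Nat.le_succ a) hak, partSum_single _ hak, add_comm]
      have h2 : (Finset.univ.filter fun i : Fin k => a ≤ i.val) =
          insert ⟨a, hak⟩ (Finset.univ.filter fun i : Fin k => a + 1 ≤ i.val) := by
        ext i
        simp only [Finset.mem_filter, Finset.mem_univ, true_and, Finset.mem_insert, Fin.ext_iff]
        omega
      rw [h2, Finset.sum_insert (by simp), ← ih (by omega)]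
      conv_lhs => rw [h1]
      rw [Finset.sum_range_add, add_comm]
      congr 1
      rw [Finset.sum_congr rfl fun x hx => cut_last_eq p (a := a) (c := partSum p.1 (a + 1) k + x)
        (by omega) (by have := Finset.mem_range.1 hx; omega)]
      simp
  have h := key k le_rfl
  rw [Nat.sub_self, partSum_total, Finset.filter_true_of_mem fun i _ => Nat.zero_le _] at h
  rw [cutSum, h]
  unfold h2
  refine Finset.sum_congr rfl fun i _ => ?_
  rw [← Finset.mul_sum, partSum]
  congr 1
  refine Finset.sum_congr ?_ fun _ _ => rfl
  refine Finset.filter_congr fun j _ => ?_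
  rw [Fin.le_def]
  have := j.2
  omega

/-- The cut sums of U_0, …, U_{k-1} are subtracted in the count for the flags and added in that for
the standard tuples. They cancel, and only the sum of U_k remains. -/
theorem finrank_chartCoords_add_h2 (p : Comp n k) :
    Module.finrank ℂ (ChartCoords n p.1) + h2 p.1 = k * n ^ 2 := by
  classical
  have h1 := card_cellIdx (n := n) p.1
  have h2 := card_stdIdx p
  rw [Fin.sum_univ_castSucc] at h1
  simp only [Fin.val_castSucc, Fin.val_last, cutSum_last p] at h1
  rw [Module.finrank_prod, Module.finrank_fintype_fun_eq_card, Module.finrank_fintype_fun_eq_card]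
  have h3 : (k + 1) * n ^ 2 = k * n ^ 2 + n ^ 2 := by ring
  omega

end Count

/-! ### Dimensions, codimensions and irreducible components -/

section Dimensions

variable {n k : ℕ}

theorem finrank_tuple (n k : ℕ) : Module.finrank ℂ (Tuple n k) = k * n ^ 2 := by
  rw [Module.finrank_pi_fintype]
  simp [Module.finrank_matrix, sq]

/-- On the generic locus the projection is a homeomorphism, so a chart of I_p restricted to it
carries an open subset of affine space into K_p; this yields the lower bound for the dimension. -/
theorem exists_isInducing_kerLocus (p : Comp n k) : ∃ (O : Set (ChartCoords n p.1))
    (m : O → kerLocus n p.1), IsOpen[zariski (ChartCoords n p.1)] O ∧ O.Nonempty ∧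
      @Topology.IsInducing _ _ ((affine _).restrict O).top
        ((affine (Tuple n k)).restrict (kerLocus n p.1)).top m := by
  let t₀ := zariski (ChartCoords n p.1)
  let t₁ := zariski (Tuple n k)
  let t₄ := (incidenceVariety p).top
  let t₅ := ((affine (Tuple n k)).restrict (kerLocus n p.1)).top
  have hg₀ : ∀ j : Fin (k + 1), IsUnit ((fun _ => 1 : Fin (k + 1) → Mat n) j).det := by simp
  have hc := isOpenEmbedding_chart p (fun _ => 1) hg₀
  have hirr : IrreducibleSpace (incidence p) := irreducibleSpace_incidenceVariety p
  have hU : IsOpen {z : incidence p | projHom p z ∈ smallKerLocus n p.1} :=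
    (isOpen_smallKerLocus p.1).preimage (continuous_projHom p)
  let D : {X : kerLocus n p.1 | X.1 ∈ smallKerLocus n p.1} :=
    ⟨⟨diagTuple n p.1, diagTuple_mem_kerLocus p⟩, diagTuple_mem_smallKerLocus p⟩
  obtain ⟨_, ⟨t, rfl⟩, ht⟩ := nonempty_preirreducible_inter hc.isOpen_range hU ⟨_, ⟨0, rfl⟩⟩
    ⟨_, (invProj p D).2⟩
  have hmor := isMorphism_projHom p (projHom_mem_kerLocus (p := p))
  have hmaps : Set.MapsTo (Set.codRestrict (projHom p) (kerLocus n p.1) projHom_mem_kerLocus)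
      {z | projHom p z ∈ smallKerLocus n p.1} {X | X.1 ∈ smallKerLocus n p.1} := fun z hz => hz
  have hmor' := (hmor.restrict hmaps).1
  have hinv := (isMorphism_invProj p).1
  let e : {z : incidence p | projHom p z ∈ smallKerLocus n p.1} ≃ₜ
      {X : kerLocus n p.1 | X.1 ∈ smallKerLocus n p.1} :=
    { toFun := hmaps.restrict _ _ _
      invFun := invProj p
      left_inv := fun z => Subtype.ext (Subtype.ext (Prod.ext
        (eq_kerFlags z.1.2 (projHom_mem_kerLocus z.1) z.2) rfl))
      right_inv := fun _ => rfl
      continuous_toFun := hmor'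
      continuous_invFun := hinv }
  have hO : IsOpen (chart p (fun _ => 1) hg₀ ⁻¹' {z | projHom p z ∈ smallKerLocus n p.1}) :=
    hU.preimage hc.continuous
  have h1 : Topology.IsInducing fun t : chart p (fun _ => 1) hg₀ ⁻¹'
      {z | projHom p z ∈ smallKerLocus n p.1} =>
        (⟨chart p (fun _ => 1) hg₀ t.1, t.2⟩ : {z : incidence p | projHom p z ∈ smallKerLocus n p.1}) :=
    (hc.isInducing.comp Topology.IsInducing.subtypeVal).codRestrict fun t => t.2
  exact ⟨_, _, hO, ⟨t, ht⟩, Topology.IsInducing.subtypeVal.comp (e.isInducing.comp h1)⟩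

theorem dim_kerLocus (p : Comp n k) : ((affine (Tuple n k)).restrict (kerLocus n p.1)).dim =
    (Module.finrank ℂ (ChartCoords n p.1) : WithBot ℕ∞) := by
  refine le_antisymm ?_ ?_
  · obtain ⟨m, hm, hsub⟩ := exists_polyMap_kerLocus_subset p
    exact dim_restrict_le hm hsub
  · obtain ⟨O, m, hO, hne, hm⟩ := exists_isInducing_kerLocus p
    let _ := ((affine (ChartCoords n p.1)).restrict O).top
    let _ := ((affine (Tuple n k)).restrict (kerLocus n p.1)).top
    exact (le_dim_restrict_of_isOpen hO hne).trans hm.topologicalKrullDim_le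

theorem dim_incidenceVariety (p : Comp n k) : (incidenceVariety p).dim =
    (Module.finrank ℂ (ChartCoords n p.1) : WithBot ℕ∞) := by
  refine le_antisymm (dim_incidenceVariety_le p) ?_
  let t₀ := zariski (ChartCoords n p.1)
  let t₄ := (incidenceVariety p).top
  have hg₀ : ∀ j : Fin (k + 1), IsUnit ((fun _ => 1 : Fin (k + 1) → Mat n) j).det := by simp
  have hc := isOpenEmbedding_chart p (fun _ => 1) hg₀
  refine (le_dim_restrict_of_isOpen (V := ChartCoords n p.1) isOpen_univ ⟨0, trivial⟩).trans ?_
  exact (hc.isInducing.comp (Homeomorph.Set.univ _).isInducing).topologicalKrullDim_le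

theorem codim_eq_of_dim {V : Type} [AddCommGroup V] [Module ℂ V] {S : Set V} {d c : ℕ}
    (hd : ((affine V).restrict S).dim = (d : WithBot ℕ∞)) (h : d + c = Module.finrank ℂ V) :
    codim S = c := by
  have : {x : ℕ∞ | ((Module.finrank ℂ V : ℕ∞) : WithBot ℕ∞) ≤ ((affine V).restrict S).dim + x} =
      Set.Ici (c : ℕ∞) := by
    ext x
    rw [Set.mem_ofPred_eq, Set.mem_Ici, hd, ← h]
    induction x using ENat.recTopCoe with
    | top =>
      have : (d : WithBot ℕ∞) + ((⊤ : ℕ∞) : WithBot ℕ∞) = ⊤ := rfl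
      exact iff_of_true (this ▸ le_top) le_top
    | coe x => norm_cast; omega
  rw [codim, this, csInf_Ici]

theorem codim_compVariety (p : Comp n k) : codim (compVariety n p.1) = (h2 p.1 : ℕ∞) := by
  rw [compVariety_eq_kerLocus]
  exact codim_eq_of_dim (dim_kerLocus p) (by rw [finrank_tuple, finrank_chartCoords_add_h2])

instance (n k : ℕ) : Finite (Comp n k) := by
  refine Finite.of_injective (fun p : Comp n k => fun i : Fin k => (⟨p.1 i, by
    have := part_le p i; omega⟩ : Fin (n + 1))) fun p q h => Subtype.ext (funext fun i => ?_)
  exact congrArg Fin.val (congrFun h i)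

theorem exists_subset_kerLocus {T : Set (Tuple n k)} (hT : T ⊆ zeroProduct n k)
    (hirr : @IsIrreducible _ (zariski (Tuple n k)) T) : ∃ p : Comp n k, T ⊆ kerLocus n p.1 := by
  let t₁ := zariski (Tuple n k)
  have hfin : (Set.range fun p : Comp n k => kerLocus n p.1).Finite := Set.finite_range _
  obtain ⟨Z, hZ, hTZ⟩ := isIrreducible_iff_sUnion_isClosed.1 hirr hfin.toFinset (by
    intro z hz
    obtain ⟨p, rfl⟩ := hfin.mem_toFinset.1 hz
    exact isClosed_kerLocus p.1) (by
    rw [Set.Finite.coe_toFinset, Set.sUnion_range, ← zeroProduct_eq_iUnion]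
    exact hT)
  obtain ⟨p, rfl⟩ := hfin.mem_toFinset.1 hZ
  exact ⟨p, hTZ⟩

/-- Every irreducible subset lies in some K_q, of dimension kn² - h₂(q), so a minimizer of h₂
determines the dimension of the union. -/
theorem codim_zeroProduct {p : Comp n k} (hp : ∀ q : Comp n k, h2 p.1 ≤ h2 q.1) :
    codim (zeroProduct n k) = (h2 p.1 : ℕ∞) := by
  let t₁ := zariski (Tuple n k)
  refine codim_eq_of_dim (d := Module.finrank ℂ (ChartCoords n p.1)) (le_antisymm ?_ ?_)
    (by rw [finrank_tuple, finrank_chartCoords_add_h2])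
  · refine dim_restrict_le_of_forall fun T hT hirr => ?_
    obtain ⟨q, hq⟩ := exists_subset_kerLocus hT hirr
    obtain ⟨m, hm, hsub⟩ := exists_polyMap_kerLocus_subset q
    refine ⟨ChartCoords n q.1, inferInstance, inferInstance, inferInstance, m, hm, hq.trans hsub, ?_⟩
    have h1 := finrank_chartCoords_add_h2 p
    have h2 := finrank_chartCoords_add_h2 q
    have h3 := hp q
    omega
  · rw [← dim_kerLocus p]
    exact (Topology.IsEmbedding.inclusion (kerLocus_subset_zeroProduct p)).isInducing.topologicalKrullDim_le

theorem components_zeroProduct : components (zeroProduct n k) =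
    Set.range fun p : Comp n k => compVariety n p.1 := by
  let t₁ := zariski (Tuple n k)
  simp only [compVariety_eq_kerLocus]
  have hirr : ∀ p : Comp n k, IsIrreducible (Subtype.val ⁻¹' kerLocus n p.1 : Set (zeroProduct n k)) := by
    intro p
    have := isIrreducible_iff_irreducibleSpace.1 (isIrreducible_kerLocus p)
    have h := (IrreducibleSpace.isIrreducible_univ (kerLocus n p.1)).image _
      (continuous_inclusion (kerLocus_subset_zeroProduct p)).continuousOn
    rwa [Set.image_univ, Set.range_inclusion] at h
  have hval : ∀ p : Comp n k, Subtype.val '' (Subtype.val ⁻¹' kerLocus n p.1 : Set (zeroProduct n k)) =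
      kerLocus n p.1 := fun p => by
    rw [Subtype.image_preimage_coe, Set.inter_eq_right]
    exact kerLocus_subset_zeroProduct p
  have hsub : ∀ s : Set (zeroProduct n k), IsIrreducible s → ∃ p : Comp n k,
      s ⊆ Subtype.val ⁻¹' kerLocus n p.1 := by
    intro s hs
    obtain ⟨p, hp⟩ := exists_subset_kerLocus (T := Subtype.val '' s) (by simp)
      (hs.image _ continuous_subtype_val.continuousOn)
    exact ⟨p, Set.image_subset_iff.1 hp⟩
  ext T
  constructor
  · rintro ⟨s, hs, rfl⟩
    have hs' : Maximal IsIrreducible s := hs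
    obtain ⟨p, hp⟩ := hsub s hs'.prop
    refine ⟨p, ?_⟩
    have heq : s = Subtype.val ⁻¹' kerLocus n p.1 := subset_antisymm hp (hs'.2 (hirr p) hp)
    simp only [heq, hval]
  · rintro ⟨p, rfl⟩
    refine ⟨_, (⟨hirr p, fun s hs hps => ?_⟩ : Maximal IsIrreducible _), hval p⟩
    obtain ⟨q, hq⟩ := hsub s hs
    have h1 : kerLocus n p.1 ⊆ kerLocus n q.1 := by
      rw [← hval p, ← hval q]
      exact Set.image_mono (hps.trans hq)
    rw [eq_of_kerLocus_subset h1]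
    exact hq

theorem compVariety_injective : Function.Injective fun p : Comp n k => compVariety n p.1 := by
  intro p q h
  simp only [compVariety_eq_kerLocus] at h
  exact eq_of_kerLocus_subset h.le

end Dimensions

/-! ### Geometric rank of the matrix multiplication tensor -/

section Codim

variable {V W : Type} [AddCommGroup V] [Module ℂ V] [AddCommGroup W] [Module ℂ W]

theorem codim_preimage_linearEquiv (e : V ≃ₗ[ℂ] W) (S : Set W) : codim (e ⁻¹' S) = codim S := by
  let t₁ := zariski V
  let t₂ := zariski W
  let h : V ≃ₜ W :=
    { e.toEquiv with
      continuous_toFun := (PolyMap.linear e.toLinearMap).continuous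
      continuous_invFun := (PolyMap.linear e.symm.toLinearMap).continuous }
  have hdim : ((affine V).restrict (e ⁻¹' S)).dim = ((affine W).restrict S).dim :=
    (h.subtype (p := fun x => x ∈ e ⁻¹' S) (q := fun y => y ∈ S)
      fun _ => Iff.rfl).isHomeomorph.topologicalKrullDim_eq
  rw [codim, codim, hdim, e.finrank_eq]

end Codim

/-! ### Traces of products as sums over cyclic paths -/

section CyclicSum

variable {n k : ℕ}

/-- The arbitrary weight `f` lets the induction absorb the first matrix into the weight of the
remaining path. -/
theorem sum_path_mul (X : Fin k → Mat n) (f : Fin n → Fin n → ℂ) :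
    ∑ i : Fin (k + 1) → Fin n, f (i 0) (i (Fin.last k)) * ∏ j, X j (i j.castSucc) (i j.succ) =
      ∑ a, ∑ b, f a b * (List.ofFn X).prod a b := by
  induction k generalizing f with
  | zero =>
    rw [← (Equiv.funUnique (Fin 1) (Fin n)).symm.sum_comp]
    simp [Matrix.one_apply]
  | succ k ih =>
    rw [← (Fin.consEquiv fun _ : Fin (k + 2) => Fin n).sum_comp, Fintype.sum_prod_type]
    refine Finset.sum_congr rfl fun a _ => ?_
    have h := ih (fun j => X j.succ) fun c b => f a b * X 0 a c
    simp only [Fin.consEquiv_apply, Fin.prod_univ_succ, Fin.cons_zero, Fin.castSucc_zero,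
      Fin.cons_succ, ← Fin.succ_last, ← Fin.succ_castSucc, ← mul_assoc] at h ⊢
    rw [h, Finset.sum_comm]
    refine Finset.sum_congr rfl fun b _ => ?_
    rw [List.ofFn_succ, List.prod_cons, Matrix.mul_apply, Finset.mul_sum]
    exact Finset.sum_congr rfl fun c _ => by rw [mul_assoc]

/-- The trace of the product of the matrices `Y 1, …, Y k, Y 0`, as a sum over cyclic paths. -/
def cyclicSum (Y : Fin (k + 1) → Mat n) : ℂ :=
  ∑ i : Fin (k + 1) → Fin n, ∏ j, Y j (i (j - 1)) (i j)

theorem cyclicSum_eq_trace (Y : Fin (k + 1) → Mat n) :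
    cyclicSum Y = (Y 0 * (List.ofFn fun j : Fin k => Y j.succ).prod).trace := by
  have h := sum_path_mul (fun j => Y j.succ) fun a b => Y 0 b a
  rw [cyclicSum, Matrix.trace]
  simp only [Matrix.diag_apply, Matrix.mul_apply]
  rw [Finset.sum_comm, ← h]
  refine Finset.sum_congr rfl fun i _ => ?_
  rw [Fin.prod_univ_succ]
  have h0 : (0 : Fin (k + 1)) - 1 = Fin.last k := by
    rw [sub_eq_iff_eq_add, Fin.last_add_one]
  have h1 : ∀ j : Fin k, j.succ - 1 = j.castSucc := fun j => by
    rw [sub_eq_iff_eq_add, Fin.coeSucc_eq_succ]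
  simp only [h0, h1]

/-- Cyclic invariance of the trace, which moves any chosen factor to index 0 and so treats all
factors alike. -/
theorem cyclicSum_shift (Y : Fin (k + 1) → Mat n) (i₀ : Fin (k + 1)) :
    cyclicSum Y = cyclicSum fun j => Y (j + i₀) := by
  refine Fintype.sum_equiv (Equiv.arrowCongr (Equiv.addRight i₀).symm (Equiv.refl (Fin n))) _ _
    fun i => (Fintype.prod_equiv (Equiv.addRight i₀) _ _ fun j => ?_).symm
  change Y (j + i₀) (i (j - 1 + i₀)) (i (j + i₀)) = Y (j + i₀) (i (j + i₀ - 1)) (i (j + i₀))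
  rw [sub_add_eq_add_sub]

end CyclicSum

/-! ### The rank variety of the matrix multiplication tensor -/

section GeometricRank

variable {n k : ℕ}

/-- Linear forms on matrices as matrices, by the trace pairing. -/
def dualMat (n : ℕ) : Module.Dual ℂ (Mat n) ≃ₗ[ℂ] Mat n where
  toFun φ := Matrix.of fun a b => φ (Matrix.single b a 1)
  map_add' _ _ := rfl
  map_smul' _ _ := rfl
  invFun M := Matrix.traceLinearMap (Fin n) ℂ ℂ ∘ₗ LinearMap.mulLeft ℂ M
  left_inv φ := by
    refine Matrix.ext_linearMap _ fun a b => LinearMap.ext_ring ?_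
    simp [Matrix.trace_mul_single]
  right_inv M := by
    ext a b
    simp [Matrix.trace_mul_single]

/-- The dual of a tensor factor, identified with the space of matrices. -/
def factorDual (n k : ℕ) (j : Fin (k + 1)) : Module.Dual ℂ (MamuFactor n k j) ≃ₗ[ℂ] Mat n :=
  Fin.cases (motive := fun j => Module.Dual ℂ (MamuFactor n k j) ≃ₗ[ℂ] Mat n) (dualMat n)
    (fun _ => (Module.evalEquiv ℂ (Mat n)).symm) j

/-- The transposition in the trace pairing turns e_{i_0 i_k} into an entry at (i_k, i_0), so with
indices modulo k + 1 all factors follow the one pattern (j - 1, j). -/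
theorem factorDual_apply (j : Fin (k + 1)) (φ : Module.Dual ℂ (MamuFactor n k j))
    (i : Fin (k + 1) → Fin n) :
    φ (mamuTerm n k i j) = factorDual n k j φ (i (j - 1)) (i j) := by
  induction j using Fin.cases with
  | zero =>
    have h0 : (0 : Fin (k + 1)) - 1 = Fin.last k := by
      rw [sub_eq_iff_eq_add, Fin.last_add_one]
    rw [h0]
    rfl
  | succ j =>
    have h1 : j.succ - 1 = j.castSucc := by
      rw [sub_eq_iff_eq_add, Fin.coeSucc_eq_succ]
    rw [h1]
    exact (Module.apply_evalEquiv_symm_apply ℂ (Mat n)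
      (Matrix.entryLinearMap ℂ ℂ (i j.castSucc) (i j.succ)) φ).symm

theorem tensorEval_mamu (γ : ∀ j, Module.Dual ℂ (MamuFactor n k j)) :
    tensorEval (mamu n k) γ = cyclicSum fun j => factorDual n k j (γ j) := by
  rw [tensorEval, mamu, map_sum, cyclicSum]
  refine Finset.sum_congr rfl fun i _ => ?_
  rw [PiTensorProduct.dualDistrib_apply]
  exact Finset.prod_congr rfl fun j _ => factorDual_apply j (γ j) i

/-- The indices `i₀ + 1, …, i₀ + k` modulo `k + 1`. -/
def cyclicIndex (i₀ : Fin (k + 1)) : Fin k ≃ {i : Fin (k + 1) // i ≠ i₀} :=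
  (finSuccAboveEquiv (0 : Fin (k + 1))).trans
    ((Equiv.addRight i₀).subtypeEquiv fun j => by simp)

/-- The tuples of linear forms on the factors other than the `i₀`-th one, as tuples of matrices. -/
def dualTuple (n : ℕ) {k : ℕ} (i₀ : Fin (k + 1)) :
    (∀ i : {i : Fin (k + 1) // i ≠ i₀}, Module.Dual ℂ (MamuFactor n k i)) ≃ₗ[ℂ] Tuple n k :=
  (LinearEquiv.piCongrRight fun i => factorDual n k i.1).trans
    (LinearEquiv.funCongrLeft ℂ (Mat n) (cyclicIndex i₀))

/-- The tensor evaluates to tr(A X_1 ⋯ X_k) with A the matrix of the form on the chosen factor; the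
trace pairing is nondegenerate, so vanishing for all A means that the product is zero. -/
theorem rankVariety_mamu (i₀ : Fin (k + 1)) :
    rankVariety (mamu n k) i₀ = dualTuple n i₀ ⁻¹' zeroProduct n k := by
  have key : ∀ γ : ∀ j, Module.Dual ℂ (MamuFactor n k j), tensorEval (mamu n k) γ =
      (factorDual n k i₀ (γ i₀) * (List.ofFn (dualTuple n i₀ fun i => γ i)).prod).trace := by
    intro γ
    rw [tensorEval_mamu, cyclicSum_shift _ i₀, cyclicSum_eq_trace, zero_add]
    rfl
  ext α
  constructor
  · intro h
    refine Matrix.ext_iff_trace_mul_left.2 fun A => ?_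
    let γ : ∀ j, Module.Dual ℂ (MamuFactor n k j) := fun j =>
      if hj : j = i₀ then (factorDual n k j).symm A else α ⟨j, hj⟩
    have hγ : (fun i : {i : Fin (k + 1) // i ≠ i₀} => γ i) = α := funext fun i => dif_neg i.2
    have h1 := h γ fun i => congrFun hγ i
    rw [key, hγ, show γ i₀ = (factorDual n k i₀).symm A from dif_pos rfl,
      LinearEquiv.apply_symm_apply] at h1
    rw [h1]
    simp
  · intro h γ hγ
    have hα : (fun i : {i : Fin (k + 1) // i ≠ i₀} => γ i) = α := funext hγ
    rw [key, hα, show (List.ofFn (dualTuple n i₀ α)).prod = 0 from h]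
    simp

theorem geometricRank_mamu (i₀ : Fin (k + 1)) :
    geometricRank (mamu n k) i₀ = codim (zeroProduct n k) := by
  rw [geometricRank, rankVariety_mamu, codim_preimage_linearEquiv]

end GeometricRank

/-! ### Balanced compositions -/

section Balanced

variable {n k : ℕ}

/-- The sums over i ≤ j and over j ≤ i together count every pair once and the diagonal twice. -/
theorem two_mul_h2 (p : Fin k → ℕ) : 2 * h2 p = (∑ i, p i) ^ 2 + ∑ i, p i ^ 2 := by
  have h1 : h2 p = ∑ i, ∑ j, if i ≤ j then p i * p j else 0 := by
    simp only [h2, Finset.sum_filter]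
  have h3 : h2 p = ∑ i, ∑ j, if j ≤ i then p i * p j else 0 := by
    rw [h1, Finset.sum_comm]
    simp only [mul_comm]
  have h4 : ∑ i, p i ^ 2 = ∑ i, ∑ j, if i = j then p i * p j else 0 := by
    simp [sq]
  rw [two_mul]
  nth_rw 1 [h1]
  rw [h3, h4, sq, Finset.sum_mul_sum, ← Finset.sum_add_distrib, ← Finset.sum_add_distrib]
  refine Finset.sum_congr rfl fun i _ => ?_
  rw [← Finset.sum_add_distrib, ← Finset.sum_add_distrib]
  refine Finset.sum_congr rfl fun j _ => ?_
  rcases lt_trichotomy i j with h | h | h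
  · simp [h.le, h.not_ge, h.ne]
  · simp [h]
  · simp [h.le, h.not_ge, h.ne.symm]

/-- The composition `((q + 1)^r, q^(k - r))`. -/
def balanced (q r : ℕ) (i : Fin k) : ℕ := if i.val < r then q + 1 else q

theorem sum_balanced {q r : ℕ} (hr : r ≤ k) : ∑ i : Fin k, balanced q r i = k * q + r := by
  have h : ∀ i : Fin k, balanced q r i = q + if i.val < r then 1 else 0 := fun i => by
    rw [balanced]
    split_ifs <;> rfl
  simp only [h]
  rw [Finset.sum_add_distrib, sum_ite_lt hr]
  simp

theorem two_mul_h2_balanced {q r : ℕ} (hr : r ≤ k) (hn : k * q + r = n) :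
    2 * h2 (balanced q r : Fin k → ℕ) = n ^ 2 + n * q + r * (q + 1) := by
  have h : ∀ i : Fin k, balanced q r i ^ 2 = balanced q r i * q +
      (if i.val < r then 1 else 0) * (q + 1) := fun i => by
    rw [balanced]
    split_ifs <;> ring
  rw [two_mul_h2]
  simp only [h]
  rw [Finset.sum_add_distrib, ← Finset.sum_mul, ← Finset.sum_mul, sum_ite_lt hr, sum_balanced hr, hn,
    add_assoc]

/-- For integers (x - q)(x - q - 1) ≥ 0, with equality at q and q + 1. Summed over the parts, this
bounds Σ p_i² below by its value at the balanced composition. -/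
theorem h2_balanced_le {q r : ℕ} (hr : r ≤ k) (hn : k * q + r = n) (p : Comp n k) :
    h2 (balanced q r : Fin k → ℕ) ≤ h2 p.1 := by
  have h1 := two_mul_h2_balanced hr hn
  have h2 := two_mul_h2 p.1
  have h : ∀ x : ℕ, x * (2 * q + 1) ≤ x ^ 2 + q * (q + 1) := fun x => by
    rcases le_or_gt x q with hx | hx
    · obtain ⟨y, rfl⟩ := Nat.exists_eq_add_of_le hx
      nlinarith
    · obtain ⟨y, rfl⟩ := Nat.exists_eq_add_of_lt hx
      nlinarith
  have h3 := Finset.sum_le_sum fun i (_ : i ∈ Finset.univ) => h (p.1 i)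
  rw [← Finset.sum_mul, Finset.sum_add_distrib, p.2] at h3
  simp only [Finset.sum_const, Finset.card_univ, Fintype.card_fin, smul_eq_mul] at h3
  rw [p.2] at h2
  have h4 : n * (2 * q + 1) = n * q + r * (q + 1) + k * (q * (q + 1)) := by
    rw [← hn]
    ring
  omega

end Balanced

end IterMatMul

end

open IterMatMul in
theorem mainTheorem2 (n k : ℕ) (hk : 1 ≤ k) :
    -- the irreducible components of `{X₁ ⋯ X_k = 0}` are the `Z_p`, one for each composition `p`
    (components (zeroProduct n k) = Set.range (fun p : Comp n k => compVariety n p.1) ∧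
      Function.Injective (fun p : Comp n k => compVariety n p.1)) ∧
    -- the incidence correspondence is birational onto `Z_p`, and `codim Z_p = h₂(p)`
    (∀ p : Comp n k,
      (incidenceVariety p).IsBirationalOnto (affine (Tuple n k)) (projHom p) (compVariety n p.1) ∧
      (incidenceVariety p).dim = ((affine (Tuple n k)).restrict (compVariety n p.1)).dim ∧
      codim (compVariety n p.1) = (h2 p.1 : ℕ∞)) ∧
    -- the geometric rank, with respect to any tensor factor
    (∀ q r : ℕ, q = n / k → r = n - k * q → ∃ p : Comp n k,
      (∀ i, p.1 i = if i.val < r then q + 1 else q) ∧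
      (∀ i₀ : Fin (k + 1), geometricRank (mamu n k) i₀ = codim (compVariety n p.1)) ∧
      codim (compVariety n p.1) = (h2 p.1 : ℕ∞) ∧
      (h2 p.1 : ℚ) = 1 / 2 * ((n : ℚ) ^ 2 + n * q + r * (q + 1))) ∧
    (k ∣ n →
      (∀ i₀ : Fin (k + 1), geometricRank (mamu n k) i₀ = (h2 (fun _ : Fin k => n / k) : ℕ∞)) ∧
      (h2 (fun _ : Fin k => n / k) : ℚ) = ((k : ℚ) + 1) / (2 * k) * (n : ℚ) ^ 2) := by
  have hGR : ∀ {q r : ℕ}, r ≤ k → k * q + r = n → ∀ p : Comp n k, p.1 = balanced q r →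
      ∀ i₀ : Fin (k + 1), geometricRank (mamu n k) i₀ = (h2 p.1 : ℕ∞) := by
    intro q r hr hn p hp i₀
    rw [geometricRank_mamu]
    exact codim_zeroProduct fun p' => hp ▸ h2_balanced_le hr hn p'
  refine ⟨⟨components_zeroProduct, compVariety_injective⟩, fun p => ⟨isBirationalOnto_projHom p, ?_,
    codim_compVariety p⟩, ?_, fun hdvd => ?_⟩
  · rw [compVariety_eq_kerLocus, dim_incidenceVariety, dim_kerLocus]
  · intro q r hq hr'
    have hdiv := Nat.div_add_mod n k
    have hmod := Nat.mod_lt n hk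
    rw [← hq] at hdiv
    have hr : r ≤ k := by omega
    have hn : k * q + r = n := by omega
    refine ⟨⟨balanced q r, (sum_balanced hr).trans hn⟩, fun _ => rfl,
      fun i₀ => ?_, codim_compVariety _, ?_⟩
    · rw [codim_compVariety]
      exact hGR hr hn _ rfl i₀
    · have h := congrArg (Nat.cast (R := ℚ)) (two_mul_h2_balanced hr hn)
      push_cast at h
      dsimp only
      linarith
  · obtain ⟨q, rfl⟩ := hdvd
    have hq : k * q / k = q := Nat.mul_div_cancel_left q hk
    have hb : (fun _ : Fin k => k * q / k) = balanced q 0 := by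
      funext i
      simp [balanced, hq]
    rw [hb]
    refine ⟨hGR (Nat.zero_le k) rfl ⟨balanced q 0, sum_balanced (Nat.zero_le k)⟩ rfl, ?_⟩
    have h := congrArg (Nat.cast (R := ℚ))
      (two_mul_h2_balanced (k := k) (q := q) (Nat.zero_le k) rfl)
    have hk0 : (k : ℚ) ≠ 0 := by
      have : k ≠ 0 := by omega
      exact_mod_cast this
    push_cast at h ⊢
    field_simp
    linear_combination h
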